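/- Let $a>0$. On $\mathbb{R}$ consider the system $$\omega_t+u\,\omega_x=\theta_x,\qquad \theta_t+u\,\theta_x=0,$$ for vorticities $\omega(\cdot,t)$ that are odd in $x$, with velocity given by $u(0,t)=0$ and, for $x\neq 0$, $$\frac{u(x,t)}{x}=\frac1\pi\int_0^\infty F(x,y,a)\,\frac{\omega(y,t)}{y}\,dy,\qquad F(x,y,a)=\frac{y}{x}\left[\log\frac{(x-y)^2}{(x+y)^2}+\log\frac{(x+y)^2+a}{(x-y)^2+a}\right].$$ Call a pair of functions $(\omega_0,\theta_0)$ on $\mathbb{R}$ admissible if $\omega_0,\theta_0\in C^\infty(\mathbb{R})$, $\omega_0$ and $\theta_0'$ are odd, supported in $[-1,1]$ and nonnegative on $[0,1]$, $\theta_0(0)=0$, and $\theta_0'\not\equiv 0$. A classical solution on $[0,T)$ with data $(\omega_0,\theta_0)$ is a pair $(\omega,\theta)$ with $\omega(\cdot,t)$ odd, such that $\omega,\omega_x,\theta,\theta_x,\theta_{xx}$ exist and are continuous on $\mathbb{R}\times[0,T)$, $\omega$ and $\omega_x$ are bounded on $\mathbb{R}\times[0,t_0]$ for every $t_0<T$,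 the two equations hold pointwise on $\mathbb{R}\times[0,T)$ (with one-sided time derivative at $t=0$), and $\omega(\cdot,0)=\omega_0$, $\theta(\cdot,0)=\theta_0$. Theorem. Admissible data exist, and for every admissible $(\omega_0,\theta_0)$ the solution blows up in finite time. That is, there are $T^*\in(0,\infty)$ and a classical solution $(\omega,\theta)$ on $[0,T^*)$ with data $(\omega_0,\theta_0)$, which is $C^\infty$ in $x$ with all spatial derivatives continuous on $\mathbb{R}\times[0,T^*)$ and has $\omega(\cdot,t)$ and $\theta_x(\cdot,t)$ supported in $[-1,1]$, such that $\int_0^t\|u_x(\cdot,\tau)\|_{L^\infty}\,d\tau$ is finite for every $t<T^*$ and $$\lim_{t\nearrow T^*}\int_0^t\|u_x(\cdot,\tau)\|_{L^\infty}\,d\tau=\infty;$$ moreover, every classical solution on an interval $[0,T)$ with the same data satisfies $T\le T^*$ and coincides with $(\omega,\theta)$ on $[0,T)$. -/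

import Mathlib

open Set Filter Topology MeasureTheory
open scoped ENNReal

namespace HouLuoLine

noncomputable section

/-- The real-line kernel
`F(x,y,a) = (y/x) [log((x-y)²/(x+y)²) + log(((x+y)²+a)/((x-y)²+a))]`. -/
def kernelF (x y a : ℝ) : ℝ :=
  y / x * (Real.log ((x - y) ^ 2 / (x + y) ^ 2)
    + Real.log (((x + y) ^ 2 + a) / ((x - y) ^ 2 + a)))

/-- The Biot-Savart law `u(x)/x = (1/π) ∫₀^∞ F(x,y,a) ω(y)/y dy`, `u(0) = 0`, of an odd
vorticity `ω`. -/
def velocity (a : ℝ) (ω : ℝ → ℝ) (x : ℝ) : ℝ :=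
  x * (1 / Real.pi * ∫ y in Ioi (0 : ℝ), kernelF x y a * (ω y / y))

/-- The class of initial data. The last field excludes the case `θ₀ = 0`. -/
structure IsInitialData (ω₀ θ₀ : ℝ → ℝ) : Prop where
  smooth_vorticity : ContDiff ℝ (⊤ : ℕ∞) ω₀
  smooth_density : ContDiff ℝ (⊤ : ℕ∞) θ₀
  odd_vorticity : Function.Odd ω₀
  odd_density_deriv : Function.Odd (deriv θ₀)
  supp_vorticity : tsupport ω₀ ⊆ Icc (-1) 1
  supp_density_deriv : tsupport (deriv θ₀) ⊆ Icc (-1) 1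
  nonneg_vorticity : ∀ x ∈ Icc (0 : ℝ) 1, 0 ≤ ω₀ x
  nonneg_density_deriv : ∀ x ∈ Icc (0 : ℝ) 1, 0 ≤ deriv θ₀ x
  density_zero : θ₀ 0 = 0
  density_nontrivial : ∃ x, deriv θ₀ x ≠ 0

/-- `f(t,·)` is of class `C^m` for every `t ∈ [0,T)`, and its spatial derivatives of order at
most `m` are jointly continuous on `[0,T) × ℝ`. -/
def SpatiallyCk (m : ℕ∞) (T : ℝ) (f : ℝ → ℝ → ℝ) : Prop :=
  (∀ t ∈ Ico (0 : ℝ) T, ContDiff ℝ m (f t)) ∧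
    ∀ k : ℕ, (k : ℕ∞) ≤ m →
      ContinuousOn (fun p : ℝ × ℝ => iteratedDeriv k (f p.1) p.2) (Ico (0 : ℝ) T ×ˢ univ)

/-- `(ω, θ)` (written as functions of `t`, then `x`) is a classical solution on `[0,T) × ℝ` of
`ω_t + u ω_x = θ_x`, `θ_t + u θ_x = 0`, with `u = velocity a ω` and initial data `(ω₀, θ₀)`:
`ω` is `C^m` and `θ` is `C^(m+1)` in space, `ω` is odd in space, and `ω`, `ω_x` are bounded on
`[0,t₀] × ℝ` for each `t₀ < T`. At `t = 0` the time derivative is one-sided. -/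
structure IsSolution (m : ℕ∞) (a T : ℝ) (ω₀ θ₀ : ℝ → ℝ) (ω θ : ℝ → ℝ → ℝ) : Prop where
  regular_vorticity : SpatiallyCk m T ω
  regular_density : SpatiallyCk (m + 1) T θ
  odd_vorticity : ∀ t ∈ Ico (0 : ℝ) T, Function.Odd (ω t)
  bounded : ∀ t₀ < T, ∃ B : ℝ, ∀ t ∈ Icc (0 : ℝ) t₀, ∀ x : ℝ,
    |ω t x| ≤ B ∧ |deriv (ω t) x| ≤ B
  vorticity_eq : ∀ t ∈ Ico (0 : ℝ) T, ∀ x : ℝ,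
    HasDerivWithinAt (fun s => ω s x)
      (deriv (θ t) x - velocity a (ω t) x * deriv (ω t) x) (Ico 0 T) t
  density_eq : ∀ t ∈ Ico (0 : ℝ) T, ∀ x : ℝ,
    HasDerivWithinAt (fun s => θ s x)
      (-(velocity a (ω t) x * deriv (θ t) x)) (Ico 0 T) t
  initial_vorticity : ω 0 = ω₀
  initial_density : θ 0 = θ₀

/-- `∫₀ᵗ ‖u_x(·,τ)‖_{L^∞} dτ`, as an extended nonnegative number. -/
def gradientIntegral (a : ℝ) (ω : ℝ → ℝ → ℝ) (t : ℝ) : ℝ≥0∞ :=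
  ∫⁻ τ in Ioo (0 : ℝ) t, eLpNorm (deriv (velocity a (ω τ))) ∞ volume

/-- The solution with initial data `(ω₀, θ₀)` blows up at the finite time `Tstar`: there is a
smooth solution on `[0,Tstar)`, with `ω` and `θ_x` supported in `[-1,1]`, for which
`∫₀ᵗ ‖u_x‖_{L^∞}` is finite for `t < Tstar` and tends to infinity as `t ↗ Tstar`; and every
classical solution with the same data is a restriction of it. -/
def BlowsUpAt (a : ℝ) (ω₀ θ₀ : ℝ → ℝ) (Tstar : ℝ) : Prop :=
  ∃ ω θ : ℝ → ℝ → ℝ,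
    IsSolution (⊤ : ℕ∞) a Tstar ω₀ θ₀ ω θ ∧
    (∀ t ∈ Ico (0 : ℝ) Tstar,
      tsupport (ω t) ⊆ Icc (-1) 1 ∧ tsupport (deriv (θ t)) ⊆ Icc (-1) 1) ∧
    (∀ t ∈ Ico (0 : ℝ) Tstar, gradientIntegral a ω t < ∞) ∧
    Tendsto (gradientIntegral a ω) (𝓝[<] Tstar) (𝓝 ∞) ∧
    ∀ (T : ℝ) (ω' θ' : ℝ → ℝ → ℝ), IsSolution 1 a T ω₀ θ₀ ω' θ' →
      T ≤ Tstar ∧ ∀ t ∈ Ico (0 : ℝ) T, ω' t = ω t ∧ θ' t = θ t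

end

end HouLuoLine

/-! For odd ω the Biot–Savart law is a convolution u = (1/π) k * ω with k(z) = log z² - log(z² + a),
which is even and integrable (`velocity_eq_conv`). Its derivative is the Hilbert kernel minus a
conjugate Poisson kernel, so ω ↦ u_x is bounded on L²(-1,1) (`nsq_conv_deriv_le`). With ρ = θ_x the
system reads ω_t + u ω_x = ρ, ρ_t + (u ρ)_x = 0. Since u has one more derivative than ω, energy
estimates close in every H^k. Successive approximation, each linear step being solved along
characteristics, gives smooth solutions on a time that depends only on the H¹ size of the data
(`local_existence`). Nonnegative vorticity on the right half-line gives u ≤ 0 there; the flow then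
contracts towards the origin and supports stay in [-1,1].

Blow-up. Put A = θ/x, I = ∫₀¹ A and J = ∫₀¹ A ω, so that I(0) > 0 and J(0) ≥ 0. Because -u(x)/x ≥ c
∫ₓ¹ ω(y)/y dy on (0,1], with c = (1/π) 4a/(1+2a), one integration by parts gives I' = -∫ (u/x) ρ ≥ c
J (`growth_first`). Next, J' = ∫ A ρ + ∫ (u/x)_x θ ω. The identity 2Aρ = (xA²)_x + A² and
Cauchy–Schwarz bound the first integral below by I²/2. The second integral is nonnegative, which is
the heart of the matter (`quadratic_form_nonneg`): it is a quadratic form in ω/x, and after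
symmetrising the kernel its positivity follows from the monotonicity of θ and two pointwise
inequalities for the logarithmic kernel, both consequences of log(1+r) ≥ 2r/(r+2) (`le_halfKern`,
`mul_halfKernDeriv_le`, `halfKernDeriv_symm_le`). The inequalities I' ≥ cJ and J' ≥ I²/2 exclude
existence up to time 8/√(c I(0)) (`lt_of_deriv_ge`).

Maximality. T* is the supremum of the existence times of smooth solutions. If ∫‖u_x‖ stayed bounded,
then ρ would stay bounded along characteristics, hence so would the H¹ energy
(`IsSmoothSolution.energy_le`), and local existence would lead past T*. For an arbitrary classical
solution, bounded ω and ω_x already give a C¹ velocity and a flow. Sign and support of ω and ρ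
follow along this flow, an L² Gronwall argument yields uniqueness, and T ≤ T* because bounded ω_x
bounds u_x. -/

namespace HouLuoLine

/-! ### The velocity as a convolution with an integrable even kernel -/

/-- The kernel `log (z² + e) - log (z² + a)`; for `e = 0` its convolution with an odd vorticity
is `π` times the velocity. -/
noncomputable def kern (e a z : ℝ) : ℝ := Real.log (z ^ 2 + e) - Real.log (z ^ 2 + a)

/-- Convolution with `kern e a / π`. -/
noncomputable def conv (e a : ℝ) (f : ℝ → ℝ) (x : ℝ) : ℝ :=
  1 / Real.pi * ∫ z, kern e a z * f (x - z)

/-- The `L¹` norm of `kern 0 a / π`. -/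
noncomputable def kernMass (a : ℝ) : ℝ := 1 / Real.pi * ∫ z, |kern 0 a z|

lemma kernMass_nonneg (a : ℝ) : 0 ≤ kernMass a :=
  mul_nonneg (by positivity) (integral_nonneg fun _ => abs_nonneg _)

lemma measurable_kern (e a : ℝ) : Measurable (kern e a) := by
  unfold kern; fun_prop

lemma kern_neg (e a z : ℝ) : kern e a (-z) = kern e a z := by simp [kern]

lemma kern_nonpos {e a z : ℝ} (hea : e ≤ a) (hz : 0 < z ^ 2 + e) :
    kern e a z ≤ 0 := by
  unfold kern
  exact sub_nonpos.2 (Real.log_le_log hz (by linarith))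

lemma kern_mono {e a z : ℝ} (he : 0 ≤ e) (hz : z ≠ 0) : kern 0 a z ≤ kern e a z := by
  unfold kern
  have : 0 < z ^ 2 := by positivity
  have := Real.log_le_log (show 0 < z ^ 2 + 0 by linarith) (show z ^ 2 + 0 ≤ z ^ 2 + e by linarith)
  linarith

/-- Both kernels are nonpositive and increase with `e`, so the kernel with `e = 0` is an integrable
majorant for all regularisations at once. -/
lemma abs_kern_le {e a z : ℝ} (he : 0 ≤ e) (hea : e ≤ a) (hz : z ≠ 0) :
    |kern e a z| ≤ |kern 0 a z| := by
  have h0 : 0 < z ^ 2 := by positivity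
  have h1 := kern_mono (a := a) he hz
  have h2 := kern_nonpos hea (show 0 < z ^ 2 + e by linarith)
  rw [abs_of_nonpos h2, abs_of_nonpos (h1.trans h2)]
  linarith

lemma ae_ne_zero : ∀ᵐ z : ℝ, z ≠ 0 := by
  rw [ae_iff]; simp

/-- Near the origin only the integrable singularity 2 log|z| matters; for |z| > 1 the modulus is
log(1 + a/z²) ≤ a/z² ≤ 2a/(1 + z²). -/
lemma integrable_kern_zero {a : ℝ} (ha : 0 < a) : Integrable (kern 0 a) := by
  rw [← integrableOn_univ, ← union_compl_self (Icc (-1 : ℝ) 1), integrableOn_union]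
  constructor
  · rw [integrableOn_Icc_iff_integrableOn_Ioc,
      ← intervalIntegrable_iff_integrableOn_Ioc_of_le (by norm_num)]
    have h1 : IntervalIntegrable (fun z => 2 * Real.log z) volume (-1) 1 :=
      intervalIntegral.intervalIntegrable_log'.const_mul 2
    have h2 : IntervalIntegrable (fun z : ℝ => Real.log (z ^ 2 + a)) volume (-1) 1 := by
      apply Continuous.intervalIntegrable
      exact Continuous.log (by fun_prop) fun z => by positivity
    refine (h1.sub h2).congr ?_
    intro z _
    simp [kern, Real.log_pow]
  · have h : IntegrableOn (fun z : ℝ => 2 * a * (1 + z ^ 2)⁻¹) (Icc (-1 : ℝ) 1)ᶜ :=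
      (integrable_inv_one_add_sq.const_mul (2 * a)).integrableOn
    refine h.mono' (measurable_kern 0 a).aestronglyMeasurable ?_
    filter_upwards [ae_restrict_mem measurableSet_Icc.compl] with z hz
    have hz1 : 1 < z ^ 2 := by
      by_contra hcon
      exact hz (abs_le.1 ((sq_le_one_iff_abs_le_one z).1 (not_lt.1 hcon)))
    rw [Real.norm_eq_abs, abs_of_nonpos (kern_nonpos ha.le (by linarith))]
    unfold kern
    rw [neg_sub, add_zero, ← Real.log_div (by positivity) (by positivity)]
    have := Real.log_le_sub_one_of_pos (show 0 < (z ^ 2 + a) / z ^ 2 by positivity)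
    refine this.trans ?_
    rw [← div_eq_mul_inv, div_sub_one (by positivity), div_le_div_iff₀ (by positivity) (by positivity)]
    nlinarith

lemma integrable_kern {e a : ℝ} (ha : 0 < a) (he : 0 ≤ e) (hea : e ≤ a) :
    Integrable (kern e a) := by
  refine (integrable_kern_zero ha).mono (measurable_kern e a).aestronglyMeasurable ?_
  filter_upwards [ae_ne_zero] with z hz
  exact abs_kern_le he hea hz

section Conv

variable {e a : ℝ}

lemma integrable_kern_mul (ha : 0 < a) (he : 0 ≤ e) (hea : e ≤ a) {f : ℝ → ℝ} {B : ℝ}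
    (hf : Continuous f) (hB : ∀ x, |f x| ≤ B) : Integrable fun z => kern e a z * f z :=
  (integrable_kern ha he hea).mul_bdd hf.aestronglyMeasurable (ae_of_all _ hB)

lemma abs_conv_le (ha : 0 < a) (he : 0 ≤ e) (hea : e ≤ a) {f : ℝ → ℝ} {B : ℝ}
    (hB : ∀ x, |f x| ≤ B) (x : ℝ) : |conv e a f x| ≤ kernMass a * B := by
  have h : |∫ z, kern e a z * f (x - z)| ≤ ∫ z, |kern 0 a z| * B := by
    rw [← Real.norm_eq_abs]
    refine norm_integral_le_of_norm_le ((integrable_kern_zero ha).abs.mul_const B) ?_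
    filter_upwards [ae_ne_zero] with z hz
    rw [norm_mul]
    exact mul_le_mul (abs_kern_le he hea hz) (hB _) (abs_nonneg _) (abs_nonneg _)
  rw [integral_mul_const] at h
  rw [conv, kernMass, abs_mul, abs_of_pos (by positivity), mul_assoc]
  exact mul_le_mul_of_nonneg_left h (by positivity)

/-- The derivative falls on the translated factor, so the singularity of the kernel is harmless and
`|kern| * B'` dominates. -/
lemma hasDerivAt_conv (ha : 0 < a) (he : 0 ≤ e) (hea : e ≤ a) {f f' : ℝ → ℝ} {B B' : ℝ}
    (hf : ∀ x, HasDerivAt f (f' x) x) (hf' : Continuous f')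
    (hB : ∀ x, |f x| ≤ B) (hB' : ∀ x, |f' x| ≤ B') (x : ℝ) :
    HasDerivAt (conv e a f) (conv e a f' x) x := by
  have hfc : Continuous f := continuous_iff_continuousAt.2 fun x => (hf x).continuousAt
  refine HasDerivAt.const_mul _ ?_
  refine (hasDerivAt_integral_of_dominated_loc_of_deriv_le (F := fun x z => kern e a z * f (x - z))
    (F' := fun x z => kern e a z * f' (x - z)) (bound := fun z => |kern e a z| * B')
    univ_mem (.of_forall fun y => ?_) ?_ ?_ (ae_of_all _ fun z y _ => ?_)
    ((integrable_kern ha he hea).abs.mul_const B') (ae_of_all _ fun z y _ => ?_)).2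
  · exact (measurable_kern e a).aestronglyMeasurable.mul (by fun_prop)
  · exact (integrable_kern ha he hea).mul_bdd (c := B)
      (hfc.comp (continuous_const.sub continuous_id)).aestronglyMeasurable
      (ae_of_all _ fun z => hB _)
  · exact (measurable_kern e a).aestronglyMeasurable.mul (by fun_prop)
  · rw [norm_mul]
    exact mul_le_mul_of_nonneg_left (hB' _) (abs_nonneg _)
  · have := ((hf (y - z)).comp y ((hasDerivAt_id y).sub_const z)).const_mul (kern e a z)
    simpa using this

lemma continuous_conv {X : Type*} [TopologicalSpace X] [FirstCountableTopology X]
    (ha : 0 < a) (he : 0 ≤ e) (hea : e ≤ a)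
    {f : X → ℝ → ℝ} {g : X → ℝ} {B : ℝ} (hf : Continuous fun p : X × ℝ => f p.1 p.2)
    (hg : Continuous g)
    (hB : ∀ t x, |f t x| ≤ B) : Continuous fun t : X => conv e a (f t) (g t) := by
  refine continuous_const.mul ?_
  refine continuous_of_dominated (bound := fun z => |kern e a z| * B) (fun p => ?_)
    (fun p => ae_of_all _ fun z => ?_) ((integrable_kern ha he hea).abs.mul_const B)
    (ae_of_all _ fun z => ?_)
  · exact (measurable_kern e a).aestronglyMeasurable.mul
      (hf.comp (by fun_prop : Continuous fun z => (p, g p - z))).aestronglyMeasurable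
  · rw [norm_mul]
    exact mul_le_mul_of_nonneg_left (hB _ _) (abs_nonneg _)
  · exact continuous_const.mul (hf.comp (by fun_prop : Continuous fun p : X => (p, g p - z)))

lemma tendsto_conv (ha : 0 < a) {f : ℝ → ℝ} {B : ℝ} (hf : Continuous f) (hB : ∀ x, |f x| ≤ B)
    (x : ℝ) : Tendsto (fun e => conv e a f x) (𝓝[>] 0) (𝓝 (conv 0 a f x)) := by
  refine Tendsto.const_mul _ ?_
  refine tendsto_integral_filter_of_dominated_convergence (fun z => |kern 0 a z| * B)
    (.of_forall fun e => ?_) ?_ ((integrable_kern_zero ha).abs.mul_const B) ?_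
  · exact (measurable_kern e a).aestronglyMeasurable.mul (by fun_prop)
  · have h1 : ∀ᶠ e in 𝓝[>] (0 : ℝ), e < a := nhdsWithin_le_nhds (gt_mem_nhds ha)
    filter_upwards [h1, self_mem_nhdsWithin] with e hea he
    filter_upwards [ae_ne_zero] with z hz
    rw [norm_mul]
    exact mul_le_mul (abs_kern_le (le_of_lt he) hea.le hz) (hB _) (abs_nonneg _) (abs_nonneg _)
  · filter_upwards [ae_ne_zero] with z hz
    refine Tendsto.mul_const _ ?_
    refine Tendsto.mono_left ?_ nhdsWithin_le_nhds
    have : ContinuousAt (fun e : ℝ => Real.log (z ^ 2 + e) - Real.log (z ^ 2 + a)) 0 := by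
      refine ContinuousAt.sub (ContinuousAt.log (by fun_prop) ?_) continuousAt_const
      simpa using hz
    exact this

lemma conv_eq_integral_sub (e a : ℝ) (f : ℝ → ℝ) (x : ℝ) :
    conv e a f x = 1 / Real.pi * ∫ y, kern e a (x - y) * f y := by
  unfold conv
  congr 1
  rw [← integral_sub_left_eq_self (fun y => kern e a (x - y) * f y) volume x]
  simp

lemma conv_odd {f : ℝ → ℝ} (hf : Function.Odd f) : Function.Odd (conv e a f) := by
  intro x
  unfold conv
  rw [← mul_neg, ← integral_neg, ← integral_neg_eq_self]
  congr 2
  ext z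
  have : -x - -z = -(x - z) := by ring
  rw [kern_neg, this, hf, mul_neg]

lemma conv_eq_Ioi (ha : 0 < a) (he : 0 ≤ e) (hea : e ≤ a) {f : ℝ → ℝ} {B : ℝ}
    (hf : Continuous f) (hB : ∀ x, |f x| ≤ B) (hodd : Function.Odd f) (x : ℝ) :
    conv e a f x
      = 1 / Real.pi * ∫ y in Ioi (0 : ℝ), (kern e a (x - y) - kern e a (x + y)) * f y := by
  rw [conv_eq_integral_sub]
  congr 1
  have hi : Integrable fun y => kern e a (x - y) * f y :=
    ((integrable_kern ha he hea).comp_sub_left x).mul_bdd hf.aestronglyMeasurable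
      (ae_of_all _ hB)
  have hi' : Integrable fun y => kern e a (x + y) * f y :=
    ((integrable_kern ha he hea).comp_add_left x).mul_bdd hf.aestronglyMeasurable
      (ae_of_all _ hB)
  rw [← intervalIntegral.integral_Iic_add_Ioi (b := 0) hi.integrableOn hi.integrableOn]
  have h1 : ∫ y in Iic (0 : ℝ), kern e a (x - y) * f y
      = ∫ y in Ioi (0 : ℝ), -(kern e a (x + y) * f y) := by
    have := integral_comp_neg_Ioi (0 : ℝ) (fun y => kern e a (x - y) * f y)
    rw [neg_zero] at this
    rw [← this]
    congr 1
    ext y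
    rw [hodd, sub_neg_eq_add, mul_neg]
  rw [h1, integral_neg, neg_add_eq_sub, ← integral_sub hi.integrableOn hi'.integrableOn]
  congr 1
  ext y
  ring

/-- The prefactors x and y/x cancel against ω(y)/y, and oddness unfolds the half-line integral.
Boundedness of ω suffices because the kernel is integrable. -/
lemma velocity_eq_conv (ha : 0 < a) {f : ℝ → ℝ} {B : ℝ} (hf : Continuous f)
    (hB : ∀ x, |f x| ≤ B) (hodd : Function.Odd f) : velocity a f = conv 0 a f := by
  ext x
  rcases eq_or_ne x 0 with rfl | hx
  · have := conv_odd (e := 0) (a := a) hodd 0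
    rw [neg_zero] at this
    have h0 : conv 0 a f 0 = 0 := by linarith
    simp [velocity, h0]
  rw [conv_eq_Ioi ha le_rfl ha.le hf hB hodd, velocity, mul_left_comm]
  congr 1
  rw [← integral_const_mul]
  refine setIntegral_congr_ae measurableSet_Ioi ?_
  -- At y = ±x the logarithm of the quotient does not split, since `Real.log 0 = 0`; these points
  -- form a null set.
  have hne : ∀ c : ℝ, ∀ᵐ y : ℝ, y ≠ c := fun c => by rw [ae_iff]; simp
  filter_upwards [hne x, hne (-x)] with y hy1 hy2 hy
  have hy0 : (y : ℝ) ≠ 0 := ne_of_gt hy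
  have e1 : (x - y) ≠ 0 := sub_ne_zero.2 hy1.symm
  have e2 : (x + y) ≠ 0 := fun h => hy2 (by linarith)
  unfold kernelF kern
  rw [Real.log_div (by positivity) (by positivity), Real.log_div (by positivity) (by positivity)]
  field_simp
  ring_nf

/-- The function p ↦ p/(p + a) is increasing and (x - y)² ≤ (x + y)² in the first quadrant. -/
lemma kern_sub_nonpos (ha : 0 < a) {x y : ℝ} (hx : 0 ≤ x) (hy : 0 ≤ y) (hxy : x ≠ y) :
    kern 0 a (x - y) - kern 0 a (x + y) ≤ 0 := by
  have e1 : 0 < (x - y) ^ 2 := by have := sub_ne_zero.2 hxy; positivity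
  have e2 : (x - y) ^ 2 ≤ (x + y) ^ 2 := by nlinarith [mul_nonneg hx hy]
  have e3 : 0 < (x + y) ^ 2 := by linarith
  unfold kern
  simp only [add_zero]
  rw [← Real.log_div (by positivity) (by positivity), ← Real.log_div (by positivity) (by positivity),
    sub_nonpos]
  apply Real.log_le_log (by positivity)
  rw [div_le_div_iff₀ (by positivity) (by positivity)]
  nlinarith

/-- The velocity points towards the origin; this sign is what keeps the supports in [-1,1]. -/
lemma conv_nonpos (ha : 0 < a) {f : ℝ → ℝ} {B : ℝ}
    (hf : Continuous f) (hB : ∀ x, |f x| ≤ B) (hodd : Function.Odd f) (hpos : ∀ x, 0 ≤ x → 0 ≤ f x)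
    {x : ℝ} (hx : 0 ≤ x) : conv 0 a f x ≤ 0 := by
  rw [conv_eq_Ioi ha le_rfl ha.le hf hB hodd]
  refine mul_nonpos_of_nonneg_of_nonpos (by positivity) ?_
  refine integral_nonpos_of_ae ?_
  have hne : ∀ᵐ y ∂(volume.restrict (Ioi (0 : ℝ))), y ≠ x := ae_restrict_of_ae (by rw [ae_iff]; simp)
  filter_upwards [hne, ae_restrict_mem measurableSet_Ioi] with y hy hy0
  exact mul_nonpos_of_nonpos_of_nonneg (kern_sub_nonpos ha hx (le_of_lt hy0) hy.symm)
    (hpos y (le_of_lt hy0))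

lemma conv_eq_interval {f : ℝ → ℝ} (hs : ∀ x, 1 < |x| → f x = 0) (x : ℝ) :
    conv e a f x = 1 / Real.pi * ∫ y in (-1 : ℝ)..1, kern e a (x - y) * f y := by
  rw [conv_eq_integral_sub]
  congr 1
  rw [intervalIntegral.integral_of_le (by norm_num), ← integral_Icc_eq_integral_Ioc]
  refine (setIntegral_eq_integral_of_forall_compl_eq_zero fun y hy => ?_).symm
  rw [hs y, mul_zero]
  by_contra hcon
  exact hy (abs_le.1 (not_lt.1 hcon))

end Conv

/-! ### L² boundedness of the truncated Hilbert transform -/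

/-- The square of the `L²(-1,1)` norm. -/
noncomputable def nsq (f : ℝ → ℝ) : ℝ := ∫ x in (-1 : ℝ)..1, f x ^ 2

/-- The conjugate Poisson kernel (up to the factor `π`). -/
noncomputable def conjPoisson (s z : ℝ) : ℝ := z / (z ^ 2 + s ^ 2)

section ConjPoisson

variable {s : ℝ}

lemma continuous_conjPoisson (hs : 0 < s) : Continuous (conjPoisson s) := by
  unfold conjPoisson
  exact continuous_id.div (by fun_prop) fun z => by positivity

lemma conjPoisson_sq_le (hs : 0 < s) (z : ℝ) : conjPoisson s z ^ 2 ≤ 1 / (z ^ 2 + s ^ 2) := by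
  unfold conjPoisson
  rw [div_pow, div_le_div_iff₀ (by positivity) (by positivity)]
  nlinarith [sq_nonneg z, sq_nonneg s, mul_nonneg (sq_nonneg s) (sq_nonneg z)]

lemma conjPoisson_shift_sq_le (hs : 0 < s) {x y : ℝ} (hy : |y| ≤ 1) :
    conjPoisson s (x - y) ^ 2 ≤ (2 + 3 / s ^ 2) * (1 + x ^ 2)⁻¹ := by
  refine (conjPoisson_sq_le hs _).trans ?_
  have hy' : y ^ 2 ≤ 1 := (sq_le_one_iff_abs_le_one y).2 hy
  rw [← div_eq_mul_inv, div_le_div_iff₀ (by positivity) (by positivity), one_mul]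
  have h1 : 1 + x ^ 2 ≤ 3 + 2 * (x - y) ^ 2 := by nlinarith [sq_nonneg (x - 2 * y)]
  have h2 : (2 + 3 / s ^ 2) * ((x - y) ^ 2 + s ^ 2)
      = 2 * (x - y) ^ 2 + 2 * s ^ 2 + 3 / s ^ 2 * (x - y) ^ 2 + 3 := by
    field_simp; ring
  rw [h2]
  have : 0 ≤ 3 / s ^ 2 * (x - y) ^ 2 := by positivity
  nlinarith [sq_nonneg s]

lemma abs_conjPoisson_mul_le (hs : 0 < s) {x y y' : ℝ} (hy : |y| ≤ 1) (hy' : |y'| ≤ 1) :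
    |conjPoisson s (x - y) * conjPoisson s (x - y')| ≤ (2 + 3 / s ^ 2) * (1 + x ^ 2)⁻¹ := by
  have h1 := conjPoisson_shift_sq_le hs (x := x) hy
  have h2 := conjPoisson_shift_sq_le hs (x := x) hy'
  rw [abs_le]
  constructor <;>
  nlinarith [sq_nonneg (conjPoisson s (x - y) - conjPoisson s (x - y')),
    sq_nonneg (conjPoisson s (x - y) + conjPoisson s (x - y'))]

/-- Stated through x⁻¹ → 0 so that it serves at both ends of the line. -/
lemma tendsto_log_ratio {l : Filter ℝ} (s d : ℝ) (hl : Tendsto (fun x : ℝ => x⁻¹) l (𝓝 0))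
    (hl' : ∀ᶠ x : ℝ in l, x ≠ 0) :
    Tendsto (fun x : ℝ => Real.log ((x ^ 2 + s ^ 2) / ((x + d) ^ 2 + s ^ 2))) l (𝓝 0) := by
  have h1 : Tendsto (fun x : ℝ => (1 + s ^ 2 * x⁻¹ ^ 2) / ((1 + d * x⁻¹) ^ 2 + s ^ 2 * x⁻¹ ^ 2)) l
      (𝓝 ((1 + s ^ 2 * 0 ^ 2) / ((1 + d * 0) ^ 2 + s ^ 2 * 0 ^ 2))) := by
    apply Tendsto.div
    · exact tendsto_const_nhds.add ((hl.pow 2).const_mul _)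
    · exact ((tendsto_const_nhds.add (hl.const_mul _)).pow 2).add ((hl.pow 2).const_mul _)
    · norm_num
  have h2 := h1.log (by norm_num)
  norm_num at h2
  refine h2.congr' ?_
  filter_upwards [hl'] with x hx
  congr 1
  rw [← mul_div_mul_left _ _ (pow_ne_zero 2 hx)]
  congr 1 <;> field_simp

/-- Partial fractions give the primitive `F`: its logarithmic part vanishes at ±∞ and its
arctangents contribute 2πB/s. The coefficient `A` has y - y' in the denominator, whence `hne`; the
diagonal is null in the application. -/
lemma integral_conjPoisson_mul (hs : 0 < s) {y y' : ℝ} (hy : |y| ≤ 1) (hy' : |y'| ≤ 1)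
    (hne : y ≠ y') :
    ∫ x, conjPoisson s (x - y) * conjPoisson s (x - y')
      = 2 * Real.pi * s / ((y - y') ^ 2 + 4 * s ^ 2) := by
  have hint : Integrable fun x => conjPoisson s (x - y) * conjPoisson s (x - y') := by
    refine (integrable_inv_one_add_sq.const_mul (2 + 3 / s ^ 2)).mono' ?_
      (ae_of_all _ fun x => abs_conjPoisson_mul_le hs hy hy')
    exact (((continuous_conjPoisson hs).comp (by fun_prop)).mul
      ((continuous_conjPoisson hs).comp (by fun_prop))).aestronglyMeasurable
  set d := y - y' with hd
  have hd0 : d ≠ 0 := sub_ne_zero.2 hne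
  set B := s ^ 2 / (d ^ 2 + 4 * s ^ 2) with hB
  set A := (d ^ 2 + 2 * s ^ 2) / (d * (d ^ 2 + 4 * s ^ 2)) with hA
  rw [← integral_add_right_eq_self _ y]
  have hint' := hint.comp_add_right y
  have e1 : ∀ x : ℝ, x + y - y = x := fun x => by ring
  have e2 : ∀ x : ℝ, x + y - y' = x + d := fun x => by rw [hd]; ring
  simp only [e1, e2] at hint' ⊢
  set F : ℝ → ℝ := fun x => A / 2 * Real.log ((x ^ 2 + s ^ 2) / ((x + d) ^ 2 + s ^ 2))
    + B / s * (Real.arctan (x / s) + Real.arctan ((x + d) / s)) with hF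
  have hder : ∀ x, HasDerivAt F (conjPoisson s x * conjPoisson s (x + d)) x := by
    intro x
    have p1 : 0 < x ^ 2 + s ^ 2 := by positivity
    have p2 : 0 < (x + d) ^ 2 + s ^ 2 := by positivity
    have n1 : HasDerivAt (fun x : ℝ => x ^ 2 + s ^ 2) (2 * x) x := by
      simpa using ((hasDerivAt_id x).pow 2).add_const (s ^ 2)
    have n2 : HasDerivAt (fun x : ℝ => (x + d) ^ 2 + s ^ 2) (2 * (x + d)) x := by
      simpa using (((hasDerivAt_id x).add_const d).pow 2).add_const (s ^ 2)
    have l1 := ((n1.div n2 p2.ne').log (div_pos p1 p2).ne').const_mul (A / 2)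
    have a1 := ((hasDerivAt_id x).div_const s).arctan
    have a2 := (((hasDerivAt_id x).add_const d).div_const s).arctan
    have := l1.add ((a1.add a2).const_mul (B / s))
    refine this.congr_deriv ?_
    have p3 : 0 < d ^ 2 + 4 * s ^ 2 := by positivity
    simp only [id, hA, hB, conjPoisson, Pi.div_apply]
    have q1 : 1 + (x / s) ^ 2 = (x ^ 2 + s ^ 2) / s ^ 2 := by field_simp; ring
    have q2 : 1 + ((x + d) / s) ^ 2 = ((x + d) ^ 2 + s ^ 2) / s ^ 2 := by field_simp; ring
    rw [q1, q2]
    field_simp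
    ring
  have tl : ∀ l : Filter ℝ, Tendsto (fun x : ℝ => x⁻¹) l (𝓝 0) → (∀ᶠ x : ℝ in l, x ≠ 0) →
      ∀ c, Tendsto (fun x : ℝ => Real.arctan (x / s) + Real.arctan ((x + d) / s)) l (𝓝 c) →
      Tendsto F l (𝓝 (A / 2 * 0 + B / s * c)) := fun l h1 h2 c h3 =>
    ((tendsto_log_ratio s d h1 h2).const_mul _).add (h3.const_mul _)
  have htop := tl atTop tendsto_inv_atTop_zero (eventually_ne_atTop 0) (Real.pi / 2 + Real.pi / 2) (by
    have h := tendsto_nhds_of_tendsto_nhdsWithin Real.tendsto_arctan_atTop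
    exact (h.comp (tendsto_id.atTop_div_const hs)).add
      (h.comp ((tendsto_atTop_add_const_right _ d tendsto_id).atTop_div_const hs)))
  have hbot := tl atBot tendsto_inv_atBot_zero (eventually_ne_atBot 0) (-(Real.pi / 2) + -(Real.pi / 2)) (by
    have h := tendsto_nhds_of_tendsto_nhdsWithin Real.tendsto_arctan_atBot
    exact (h.comp (tendsto_id.atBot_div_const hs)).add
      (h.comp ((tendsto_atBot_add_const_right _ d tendsto_id).atBot_div_const hs)))
  rw [integral_of_hasDerivAt_of_tendsto hder hint' hbot htop, hB]
  field_simp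
  ring

lemma integrable_poisson (hs : 0 < s) :
    Integrable fun x : ℝ => 2 * Real.pi * s / (x ^ 2 + 4 * s ^ 2) := by
  have h := (integrable_inv_one_add_sq.comp_div (show (2 * s) ≠ 0 by positivity)).const_mul
    (Real.pi / (2 * s))
  refine h.congr (ae_of_all _ fun x => ?_)
  field_simp
  ring

lemma integral_poisson (hs : 0 < s) :
    ∫ x : ℝ, 2 * Real.pi * s / (x ^ 2 + 4 * s ^ 2) = Real.pi ^ 2 := by
  have h := Measure.integral_comp_div (fun x : ℝ => (1 + x ^ 2)⁻¹) (2 * s)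
  rw [integral_univ_inv_one_add_sq, abs_of_pos (by positivity), smul_eq_mul] at h
  have e : ∀ x : ℝ, 2 * Real.pi * s / (x ^ 2 + 4 * s ^ 2)
      = Real.pi / (2 * s) * (1 + (x / (2 * s)) ^ 2)⁻¹ := fun x => by field_simp; ring
  simp_rw [e]
  rw [integral_const_mul, h]
  field_simp

/-- A TT* argument, uniform in s. Expanding the square and integrating over all x ∈ ℝ turns the
product of two conjugate Poisson kernels into π² times the Poisson kernel of height 2s. That kernel
has mass π², so f(y)f(y') ≤ (f(y)² + f(y')²)/2 (Schur's test) concludes. -/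
lemma nsq_conjPoisson_le (hs : 0 < s) {f : ℝ → ℝ} {B : ℝ} (hf : Continuous f)
    (hB : ∀ x, |f x| ≤ B) :
    nsq (fun x => ∫ y in (-1 : ℝ)..1, conjPoisson s (x - y) * f y) ≤ Real.pi ^ 2 * nsq f := by
  have hB0 : 0 ≤ B := (abs_nonneg _).trans (hB 0)
  unfold nsq
  simp only [intervalIntegral.integral_of_le (show (-1 : ℝ) ≤ 1 by norm_num)]
  set μ : Measure ℝ := volume.restrict (Ioc (-1 : ℝ) 1) with hμ
  have hQ := continuous_conjPoisson hs
  set Φ : ℝ → ℝ × ℝ → ℝ := fun x p =>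
    (conjPoisson s (x - p.1) * f p.1) * (conjPoisson s (x - p.2) * f p.2) with hΦ
  have hae : ∀ᵐ p ∂(μ.prod μ), |p.1| ≤ 1 ∧ |p.2| ≤ 1 := by
    rw [hμ, Measure.prod_restrict]
    filter_upwards [ae_restrict_mem (measurableSet_Ioc.prod measurableSet_Ioc)] with p hp
    exact ⟨abs_le.2 ⟨hp.1.1.le, hp.1.2⟩, abs_le.2 ⟨hp.2.1.le, hp.2.2⟩⟩
  have hΦc : Continuous fun q : ℝ × (ℝ × ℝ) => Φ q.1 q.2 := by
    simp only [hΦ]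
    fun_prop
  have hΦi : Integrable (fun q : ℝ × (ℝ × ℝ) => Φ q.1 q.2) (volume.prod (μ.prod μ)) := by
    have hdom : Integrable (fun q : ℝ × (ℝ × ℝ) =>
        ((2 + 3 / s ^ 2) * (1 + q.1 ^ 2)⁻¹) * (B * B)) (volume.prod (μ.prod μ)) :=
      Integrable.mul_prod (f := fun x : ℝ => (2 + 3 / s ^ 2) * (1 + x ^ 2)⁻¹)
        (g := fun _ : ℝ × ℝ => B * B)
        (integrable_inv_one_add_sq.const_mul (2 + 3 / s ^ 2)) (integrable_const _)
    refine hdom.mono' hΦc.aestronglyMeasurable ?_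
    have : ∀ᵐ q ∂((volume : Measure ℝ).prod (μ.prod μ)), |q.2.1| ≤ 1 ∧ |q.2.2| ≤ 1 :=
      Measure.quasiMeasurePreserving_snd.ae hae
    filter_upwards [this] with q hq
    have h1 := abs_conjPoisson_mul_le hs (x := q.1) hq.1 hq.2
    have : Φ q.1 q.2 = (conjPoisson s (q.1 - q.2.1) * conjPoisson s (q.1 - q.2.2))
        * (f q.2.1 * f q.2.2) := by simp only [hΦ]; ring
    rw [this, norm_mul]
    refine mul_le_mul h1 ?_ (norm_nonneg _) ((abs_nonneg _).trans h1)
    rw [norm_mul]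
    exact mul_le_mul (hB _) (hB _) (norm_nonneg _) hB0
  have hsq : ∀ x, (∫ y, conjPoisson s (x - y) * f y ∂μ) ^ 2 = ∫ p, Φ x p ∂(μ.prod μ) := by
    intro x
    rw [sq, ← integral_prod_mul]
  simp only [hsq]
  have step1 : ∫ x in Ioc (-1 : ℝ) 1, (∫ p, Φ x p ∂(μ.prod μ))
      ≤ ∫ x, (∫ p, Φ x p ∂(μ.prod μ)) := by
    refine setIntegral_le_integral hΦi.integral_prod_left (ae_of_all _ fun x => ?_)
    simp only [← hsq]
    exact sq_nonneg _
  refine step1.trans ?_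
  rw [integral_integral_swap hΦi]
  set k : ℝ → ℝ := fun x => 2 * Real.pi * s / (x ^ 2 + 4 * s ^ 2) with hk
  have hkc : Continuous k := by
    simp only [hk]
    exact continuous_const.div (by fun_prop) fun x => by positivity
  have hk0 : ∀ x, 0 ≤ k x := fun x => by simp only [hk]; positivity
  have hkM : ∀ x, |k x| ≤ 2 * Real.pi * s / (4 * s ^ 2) := by
    intro x
    rw [abs_of_nonneg (hk0 x)]
    simp only [hk]
    gcongr
    nlinarith [sq_nonneg x]
  have hfk : Integrable (fun p : ℝ × ℝ => f p.1 ^ 2 * k (p.1 - p.2)) (μ.prod μ) := by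
    refine Integrable.mono' (integrable_const (B ^ 2 * (2 * Real.pi * s / (4 * s ^ 2))))
      (by fun_prop : Continuous fun p : ℝ × ℝ => f p.1 ^ 2 * k (p.1 - p.2)).aestronglyMeasurable
      (ae_of_all _ fun p => ?_)
    rw [norm_mul, norm_pow]
    exact mul_le_mul (pow_le_pow_left₀ (norm_nonneg _) (hB _) 2) (hkM _) (norm_nonneg _)
      (by positivity)
  have hkeven : ∀ x, k (-x) = k x := fun x => by simp [hk]
  have hdiag : ∀ᵐ p ∂(μ.prod μ), p.1 ≠ p.2 := by
    have hm : MeasurableSet {p : ℝ × ℝ | p.1 ≠ p.2} :=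
      (measurableSet_eq_fun measurable_fst measurable_snd).compl
    rw [Measure.ae_prod_iff_ae_ae hm]
    refine ae_of_all _ fun x => ae_restrict_of_ae ?_
    rw [ae_iff]
    simp
  have hswap : ∫ p, f p.2 ^ 2 * k (p.1 - p.2) ∂(μ.prod μ)
      = ∫ p, f p.1 ^ 2 * k (p.1 - p.2) ∂(μ.prod μ) := by
    rw [← integral_prod_swap]
    congr 1
    ext p
    simp only [Prod.fst_swap, Prod.snd_swap]
    rw [← hkeven (p.2 - p.1), neg_sub]
  have hfk' : Integrable (fun p : ℝ × ℝ => f p.2 ^ 2 * k (p.1 - p.2)) (μ.prod μ) := by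
    have := hfk.swap
    refine this.congr (ae_of_all _ fun p => ?_)
    simp only [Function.comp_apply, Prod.fst_swap, Prod.snd_swap]
    rw [← hkeven (p.2 - p.1), neg_sub]
  calc ∫ p, (∫ x, Φ x p) ∂(μ.prod μ)
      ≤ ∫ p, (1 / 2 * (f p.1 ^ 2 * k (p.1 - p.2)) + 1 / 2 * (f p.2 ^ 2 * k (p.1 - p.2)))
          ∂(μ.prod μ) := by
        refine integral_mono_ae hΦi.integral_prod_right
          ((hfk.const_mul _).add (hfk'.const_mul _)) ?_
        filter_upwards [hae, hdiag] with p hp hp'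
        have : ∀ x, Φ x p = (conjPoisson s (x - p.1) * conjPoisson s (x - p.2))
          * (f p.1 * f p.2) := fun x => by simp only [hΦ]; ring
        simp only [this]
        rw [integral_mul_const, integral_conjPoisson_mul hs hp.1 hp.2 hp']
        change k (p.1 - p.2) * (f p.1 * f p.2) ≤ _
        nlinarith [mul_nonneg (hk0 (p.1 - p.2)) (sq_nonneg (f p.1 - f p.2))]
    _ = ∫ p, f p.1 ^ 2 * k (p.1 - p.2) ∂(μ.prod μ) := by
        rw [integral_add (hfk.const_mul _) (hfk'.const_mul _), integral_const_mul,
          integral_const_mul, hswap]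
        ring
    _ = ∫ y, f y ^ 2 * (∫ y', k (y - y') ∂μ) ∂μ := by
        rw [integral_prod _ hfk]
        simp only [integral_const_mul]
    _ ≤ ∫ y, f y ^ 2 * Real.pi ^ 2 ∂μ := by
        have hf2 : Integrable (fun y => f y ^ 2) μ :=
          Integrable.mono' (integrable_const (B ^ 2)) (by fun_prop) (ae_of_all _ fun y => by
            rw [norm_pow]; exact pow_le_pow_left₀ (norm_nonneg _) (hB _) 2)
        refine integral_mono ?_ (hf2.mul_const _) fun y => ?_
        · have := hfk.integral_prod_left
          simpa only [integral_const_mul] using this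
        · refine mul_le_mul_of_nonneg_left ?_ (sq_nonneg _)
          have hki : Integrable fun y' => k (y - y') := (integrable_poisson hs).comp_sub_left y
          refine (setIntegral_le_integral hki (ae_of_all _ fun _ => hk0 _)).trans ?_
          rw [integral_sub_left_eq_self k volume y, integral_poisson hs]
    _ = Real.pi ^ 2 * ∫ y, f y ^ 2 ∂μ := by rw [integral_mul_const, mul_comm]

end ConjPoisson

lemma hasDerivAt_kern {e a : ℝ} (he : 0 < e) (ha : 0 < a) (z : ℝ) :
    HasDerivAt (kern e a) (2 * conjPoisson (√e) z - 2 * conjPoisson (√a) z) z := by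
  have n : ∀ c : ℝ, HasDerivAt (fun x : ℝ => x ^ 2 + c) (2 * z) z := fun c => by
    simpa using ((hasDerivAt_id z).pow 2).add_const c
  have := ((n e).log (by positivity)).sub ((n a).log (by positivity))
  refine this.congr_deriv ?_
  simp only [conjPoisson, Real.sq_sqrt he.le, Real.sq_sqrt ha.le]
  ring

lemma nsq_nonneg (f : ℝ → ℝ) : 0 ≤ nsq f :=
  intervalIntegral.integral_nonneg (by norm_num) fun _ _ => sq_nonneg _

/-- Integration by parts moves the derivative to the regularised kernel, whose derivative is a
difference of two conjugate Poisson kernels; the boundary terms vanish with f at ±1. -/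
lemma conv_deriv_eq {e a : ℝ} (he : 0 < e) (ha : 0 < a) {f f' : ℝ → ℝ}
    (hf : ∀ x, HasDerivAt f (f' x) x) (hf' : Continuous f')
    (hs' : ∀ x, 1 < |x| → f' x = 0) (h1 : f 1 = 0) (h2 : f (-1) = 0) (x : ℝ) :
    conv e a f' x = 2 / Real.pi * (∫ y in (-1 : ℝ)..1, conjPoisson (√e) (x - y) * f y)
      - 2 / Real.pi * (∫ y in (-1 : ℝ)..1, conjPoisson (√a) (x - y) * f y) := by
  have hfc : Continuous f := continuous_iff_continuousAt.2 fun x => (hf x).continuousAt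
  have c1 := continuous_conjPoisson (Real.sqrt_pos.2 he)
  have c2 := continuous_conjPoisson (Real.sqrt_pos.2 ha)
  rw [conv_eq_interval hs']
  have hk : ∀ y, HasDerivAt (fun y => kern e a (x - y))
      (-(2 * conjPoisson (√e) (x - y) - 2 * conjPoisson (√a) (x - y))) y := fun y =>
    (hasDerivAt_kern he ha (x - y)).comp_const_sub x y
  rw [intervalIntegral.integral_mul_deriv_eq_deriv_mul (fun y _ => hk y) (fun y _ => hf y)
    (by apply Continuous.intervalIntegrable; fun_prop) (hf'.intervalIntegrable _ _), h1, h2]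
  have : ∀ y, -(2 * conjPoisson (√e) (x - y) - 2 * conjPoisson (√a) (x - y)) * f y
      = 2 * (conjPoisson (√a) (x - y) * f y) - 2 * (conjPoisson (√e) (x - y) * f y) :=
    fun y => by ring
  simp only [this]
  rw [intervalIntegral.integral_sub (by apply Continuous.intervalIntegrable; fun_prop)
    (by apply Continuous.intervalIntegrable; fun_prop), intervalIntegral.integral_const_mul,
    intervalIntegral.integral_const_mul]
  ring

lemma eq_zero_of_abs_le {f : ℝ → ℝ} (hf : Continuous f) (hs : ∀ x, 1 < |x| → f x = 0) {x : ℝ}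
    (hx : 1 ≤ |x|) : f x = 0 := by
  rcases hx.lt_or_eq with h | h
  · exact hs x h
  · have hlim : Tendsto (fun n : ℕ => f (x * (1 + 1 / ((n : ℝ) + 1)))) atTop (𝓝 (f (x * (1 + 0)))) :=
      (hf.tendsto _).comp
        ((tendsto_const_nhds.add tendsto_one_div_add_atTop_nhds_zero_nat).const_mul x)
    rw [add_zero, mul_one] at hlim
    refine tendsto_nhds_unique hlim (tendsto_const_nhds.congr fun n => (hs _ ?_).symm)
    rw [abs_mul, ← h, one_mul]
    have : (0 : ℝ) < 1 / ((n : ℝ) + 1) := by positivity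
    rw [abs_of_pos (by linarith)]
    linarith

lemma exists_bound_of_supp {f : ℝ → ℝ} (hf : Continuous f) (hs : ∀ x, 1 < |x| → f x = 0) :
    ∃ B, ∀ x, |f x| ≤ B := by
  obtain ⟨B, hB⟩ := (isCompact_Icc (a := (-1 : ℝ)) (b := 1)).exists_bound_of_continuousOn
    hf.continuousOn
  refine ⟨max B 0, fun x => ?_⟩
  by_cases hx : 1 < |x|
  · rw [hs x hx]; simp
  · exact (hB x (abs_le.1 (not_lt.1 hx))).trans (le_max_left _ _)

lemma deriv_eq_zero_of_supp {f : ℝ → ℝ} (hs : ∀ x, 1 < |x| → f x = 0) (x : ℝ) (hx : 1 < |x|) :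
    deriv f x = 0 := by
  have : f =ᶠ[𝓝 x] fun _ => (0 : ℝ) := by
    filter_upwards [(isOpen_lt continuous_const continuous_abs).mem_nhds hx] with y hy
    exact hs y hy
  rw [this.deriv_eq]; simp

/-- `L²` boundedness of the truncated Hilbert transform `f ↦ (conv 0 a f)'`. -/
theorem nsq_conv_deriv_le {a : ℝ} (ha : 0 < a) {f : ℝ → ℝ} (hf : ContDiff ℝ 1 f)
    (hs : ∀ x, 1 < |x| → f x = 0) : nsq (conv 0 a (deriv f)) ≤ 16 * nsq f := by
  have hf' : Continuous (deriv f) := hf.continuous_deriv le_rfl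
  have hs' := deriv_eq_zero_of_supp hs
  obtain ⟨B, hB⟩ := exists_bound_of_supp hf.continuous hs
  obtain ⟨B', hB'⟩ := exists_bound_of_supp hf' hs'
  have key : ∀ e, 0 < e → e ≤ a → nsq (conv e a (deriv f)) ≤ 16 * nsq f := by
    intro e he hea
    have k1 := nsq_conjPoisson_le (Real.sqrt_pos.2 he) hf.continuous hB
    have k2 := nsq_conjPoisson_le (Real.sqrt_pos.2 ha) hf.continuous hB
    set p := fun x => ∫ y in (-1 : ℝ)..1, conjPoisson (√e) (x - y) * f y with hp
    set q := fun x => ∫ y in (-1 : ℝ)..1, conjPoisson (√a) (x - y) * f y with hq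
    have c1 := continuous_conjPoisson (Real.sqrt_pos.2 he)
    have c2 := continuous_conjPoisson (Real.sqrt_pos.2 ha)
    have hfc := hf.continuous
    have hpc : Continuous p := by
      apply intervalIntegral.continuous_parametric_intervalIntegral_of_continuous'
      fun_prop
    have hqc : Continuous q := by
      apply intervalIntegral.continuous_parametric_intervalIntegral_of_continuous'
      fun_prop
    -- (α - β)² ≤ 2α² + 2β² with α = 2p/π and β = 2q/π; since p and q each cost a factor π², the
    -- total constant is 8 + 8 = 16.
    have hle : nsq (conv e a (deriv f)) ≤ 8 / Real.pi ^ 2 * nsq p + 8 / Real.pi ^ 2 * nsq q := by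
      unfold nsq
      rw [← intervalIntegral.integral_const_mul, ← intervalIntegral.integral_const_mul,
        ← intervalIntegral.integral_add (by apply Continuous.intervalIntegrable; fun_prop)
          (by apply Continuous.intervalIntegrable; fun_prop)]
      refine intervalIntegral.integral_mono_on (by norm_num) ?_
        (by apply Continuous.intervalIntegrable; fun_prop) fun x _ => ?_
      · apply Continuous.intervalIntegrable
        exact (continuous_conv (X := ℝ) (f := fun _ => deriv f) ha he.le hea (by fun_prop)
          continuous_id (fun _ => hB')).pow 2
      · rw [conv_deriv_eq he ha (fun x => (hf.differentiable (by norm_num) x).hasDerivAt) hf' hs'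
          (eq_zero_of_abs_le hf.continuous hs (by simp))
          (eq_zero_of_abs_le hf.continuous hs (by simp))]
        change (2 / Real.pi * p x - 2 / Real.pi * q x) ^ 2 ≤ _
        have : 8 / Real.pi ^ 2 * p x ^ 2 + 8 / Real.pi ^ 2 * q x ^ 2
          - (2 / Real.pi * p x - 2 / Real.pi * q x) ^ 2 = (2 / Real.pi * p x + 2 / Real.pi * q x) ^ 2 := by
          field_simp; ring
        nlinarith [sq_nonneg (2 / Real.pi * p x + 2 / Real.pi * q x)]
    have e1 : 8 / Real.pi ^ 2 * (Real.pi ^ 2 * nsq f) = 8 * nsq f := by field_simp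
    have h8 : 0 ≤ 8 / Real.pi ^ 2 := by positivity
    have := mul_le_mul_of_nonneg_left k1 h8
    have := mul_le_mul_of_nonneg_left k2 h8
    linarith
  have hlim : Tendsto (fun e => nsq (conv e a (deriv f))) (𝓝[>] 0) (𝓝 (nsq (conv 0 a (deriv f)))) := by
    unfold nsq
    have hev : ∀ᶠ e in 𝓝[>] (0 : ℝ), 0 < e ∧ e < a :=
      Filter.Eventually.and self_mem_nhdsWithin (nhdsWithin_le_nhds (gt_mem_nhds ha))
    refine intervalIntegral.tendsto_integral_filter_of_dominated_convergence
      (fun _ => (kernMass a * B') ^ 2) ?_ ?_ (by simp) ?_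
    · filter_upwards [hev] with e he
      have : Continuous (conv e a (deriv f)) :=
        continuous_conv (X := ℝ) (f := fun _ => deriv f) ha he.1.le he.2.le (by fun_prop)
          continuous_id (fun _ => hB')
      exact (this.pow 2).aestronglyMeasurable
    · filter_upwards [hev] with e he
      refine ae_of_all _ fun x _ => ?_
      rw [norm_pow]
      exact pow_le_pow_left₀ (norm_nonneg _) (abs_conv_le ha he.1.le he.2.le hB' x) 2
    · exact ae_of_all _ fun x _ => (tendsto_conv ha hf' hB' x).pow 2
  refine le_of_tendsto hlim ?_
  filter_upwards [self_mem_nhdsWithin, nhdsWithin_le_nhds (gt_mem_nhds ha)] with e he hea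
  exact key e he (le_of_lt hea)

/-! ### Time-dependent families, smooth in space and jointly continuous -/

/-- `f` is `n` times differentiable in its second variable, with jointly continuous derivatives. -/
def Sm : ℕ → (ℝ → ℝ → ℝ) → Prop
  | 0, f => Continuous fun p : ℝ × ℝ => f p.1 p.2
  | n + 1, f => (∀ t, Differentiable ℝ (f t)) ∧ (Continuous fun p : ℝ × ℝ => f p.1 p.2) ∧
      Sm n fun t => deriv (f t)

namespace Sm

variable {n : ℕ} {f g : ℝ → ℝ → ℝ}

lemma continuous (h : Sm n f) : Continuous fun p : ℝ × ℝ => f p.1 p.2 := by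
  cases n with
  | zero => exact h
  | succ n => exact h.2.1

lemma continuous_space (h : Sm n f) (t : ℝ) : Continuous (f t) :=
  h.continuous.comp (by fun_prop : Continuous fun x : ℝ => (t, x))

lemma continuous_time (h : Sm n f) (x : ℝ) : Continuous fun t => f t x :=
  h.continuous.comp (by fun_prop : Continuous fun t : ℝ => (t, x))

lemma deriv (h : Sm (n + 1) f) : Sm n fun t => deriv (f t) := h.2.2

lemma hasDerivAt (h : Sm (n + 1) f) (t x : ℝ) : HasDerivAt (f t) (_root_.deriv (f t) x) x :=
  (h.1 t x).hasDerivAt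

lemma of_succ (h : Sm (n + 1) f) : Sm n f := by
  induction n generalizing f with
  | zero => exact h.continuous
  | succ n ih => exact ⟨h.1, h.2.1, ih h.2.2⟩

lemma mono {m : ℕ} (h : Sm n f) (hm : m ≤ n) : Sm m f := by
  induction n, hm using Nat.le_induction with
  | base => exact h
  | succ n _ ih => exact ih h.of_succ

lemma of_hasDerivAt {f' : ℝ → ℝ → ℝ} (hc : Continuous fun p : ℝ × ℝ => f p.1 p.2)
    (hd : ∀ t x, HasDerivAt (f t) (f' t x) x) (h : Sm n f') : Sm (n + 1) f := by
  refine ⟨fun t x => (hd t x).differentiableAt, hc, ?_⟩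
  have : (fun t => _root_.deriv (f t)) = f' := by
    ext t x; exact (hd t x).deriv
  rwa [this]

lemma add (hf : Sm n f) (hg : Sm n g) : Sm n fun t x => f t x + g t x := by
  induction n generalizing f g with
  | zero => exact Continuous.add hf hg
  | succ n ih =>
    exact of_hasDerivAt (hf.continuous.add hg.continuous)
      (fun t x => (hf.hasDerivAt t x).add (hg.hasDerivAt t x)) (ih hf.deriv hg.deriv)

lemma mul (hf : Sm n f) (hg : Sm n g) : Sm n fun t x => f t x * g t x := by
  induction n generalizing f g with
  | zero => exact Continuous.mul hf hg
  | succ n ih =>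
    exact of_hasDerivAt (hf.continuous.mul hg.continuous)
      (fun t x => (hf.hasDerivAt t x).mul (hg.hasDerivAt t x))
      ((ih hf.deriv hg.of_succ).add (ih hf.of_succ hg.deriv))

lemma const (c : ℝ) : Sm n fun _ _ => c := by
  induction n generalizing c with
  | zero => exact continuous_const
  | succ n ih => exact of_hasDerivAt continuous_const (fun t x => hasDerivAt_const x c) (ih 0)

lemma neg (hf : Sm n f) : Sm n fun t x => -f t x := by
  simpa using (const (-1)).mul hf

lemma sub (hf : Sm n f) (hg : Sm n g) : Sm n fun t x => f t x - g t x := by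
  simpa [sub_eq_add_neg] using hf.add hg.neg

lemma of_contDiff {g : ℝ → ℝ} (hg : ContDiff ℝ n g) : Sm n fun _ => g := by
  induction n generalizing g with
  | zero => exact hg.continuous.comp continuous_snd
  | succ n ih =>
    have h := (contDiff_succ_iff_deriv (n := n)).1 (by exact_mod_cast hg)
    exact ⟨fun _ => h.1, hg.continuous.comp continuous_snd, ih h.2.2⟩

lemma contDiff (hf : Sm n f) (t : ℝ) : ContDiff ℝ n (f t) := by
  induction n generalizing f with
  | zero => exact contDiff_zero.2 (hf.continuous_space t)
  | succ n ih =>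
    have := (contDiff_succ_iff_deriv (n := n) (f := f t)).2 ⟨hf.1 t, by simp, ih hf.deriv⟩
    exact_mod_cast this

lemma reparam (hf : Sm n f) {c : ℝ → ℝ} (hc : Continuous c) : Sm n fun t => f (c t) := by
  induction n generalizing f with
  | zero => exact Continuous.comp hf (by fun_prop : Continuous fun p : ℝ × ℝ => (c p.1, p.2))
  | succ n ih =>
    exact ⟨fun t => hf.1 _, hf.continuous.comp
      (by fun_prop : Continuous fun p : ℝ × ℝ => (c p.1, p.2)), ih hf.deriv⟩

lemma comp (hf : Sm n f) (hg : Sm n g) : Sm n fun t x => f t (g t x) := by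
  induction n generalizing f g with
  | zero =>
    have hg' : Continuous fun p : ℝ × ℝ => g p.1 p.2 := hg
    exact Continuous.comp hf (by fun_prop : Continuous fun p : ℝ × ℝ => (p.1, g p.1 p.2))
  | succ n ih =>
    have hg' := hg.continuous
    exact of_hasDerivAt
      (hf.continuous.comp (by fun_prop : Continuous fun p : ℝ × ℝ => (p.1, g p.1 p.2)))
      (fun t x => (hf.hasDerivAt t (g t x)).comp x (hg.hasDerivAt t x))
      ((ih hf.deriv hg.of_succ).mul hg.deriv)

lemma iteratedDeriv {k : ℕ} (hf : Sm (n + k) f) : Sm n fun t => iteratedDeriv k (f t) := by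
  induction k generalizing f with
  | zero => simpa using hf
  | succ k ih =>
    have := ih (f := fun t => _root_.deriv (f t)) hf.deriv
    simpa only [iteratedDeriv_succ'] using this

lemma of_iteratedDeriv (h1 : ∀ t, ContDiff ℝ n (f t))
    (h2 : ∀ k ≤ n, Continuous fun p : ℝ × ℝ => _root_.iteratedDeriv k (f p.1) p.2) : Sm n f := by
  induction n generalizing f with
  | zero => exact (by simpa using h2 0 le_rfl : Continuous fun p : ℝ × ℝ => f p.1 p.2)
  | succ n ih =>
    have h (t : ℝ) := (contDiff_succ_iff_deriv (n := n) (f := f t)).1 (by exact_mod_cast h1 t)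
    refine ⟨fun t => (h t).1, by simpa using h2 0 (by omega), ih (fun t => (h t).2.2) fun k hk => ?_⟩
    have := h2 (k + 1) (by omega)
    simpa only [iteratedDeriv_succ'] using this

end Sm

lemma hasDerivAt_integral_param {f f' : ℝ → ℝ → ℝ} (hf : Continuous fun p : ℝ × ℝ => f p.1 p.2)
    (hf' : Continuous fun p : ℝ × ℝ => f' p.1 p.2) (hd : ∀ t x, HasDerivAt (f t) (f' t x) x)
    (a b x : ℝ) : HasDerivAt (fun x => ∫ s in a..b, f s x) (∫ s in a..b, f' s x) x := by
  obtain ⟨C, hC⟩ := (isCompact_uIcc (a := a) (b := b)).prod (isCompact_closedBall x 1)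
    |>.exists_bound_of_continuousOn hf'.continuousOn
  have ct : ∀ y, Continuous fun s => f s y := fun y =>
    hf.comp (by fun_prop : Continuous fun s : ℝ => (s, y))
  have ct' : ∀ y, Continuous fun s => f' s y := fun y =>
    hf'.comp (by fun_prop : Continuous fun s : ℝ => (s, y))
  refine (intervalIntegral.hasDerivAt_integral_of_dominated_loc_of_deriv_le
    (F := fun x s => f s x) (F' := fun x s => f' s x) (bound := fun _ => C)
    (Metric.closedBall_mem_nhds x one_pos) (.of_forall fun y => ?_) ?_ ?_
    (ae_of_all _ fun s hs y hy => ?_) (by simp) (ae_of_all _ fun s _ y _ => hd s y)).2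
  · exact (ct y).aestronglyMeasurable
  · exact (ct x).intervalIntegrable _ _
  · exact (ct' x).aestronglyMeasurable
  · exact hC (s, y) ⟨uIoc_subset_uIcc hs, hy⟩

lemma continuous_time_integral {f : ℝ → ℝ → ℝ} (hf : Continuous fun p : ℝ × ℝ => f p.1 p.2)
    {c : ℝ → ℝ} (hc : Continuous c) :
    Continuous fun p : ℝ × ℝ => ∫ s in (0 : ℝ)..c p.1, f s p.2 := by
  refine intervalIntegral.continuous_parametric_intervalIntegral_of_continuous
    (f := fun (p : ℝ × ℝ) s => f s p.2) ?_ (hc.comp continuous_fst)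
  exact hf.comp (by fun_prop : Continuous fun q : (ℝ × ℝ) × ℝ => (q.2, q.1.2))

lemma Sm.integral {n : ℕ} {f : ℝ → ℝ → ℝ} (hf : Sm n f) {c : ℝ → ℝ} (hc : Continuous c) :
    Sm n fun t x => ∫ s in (0 : ℝ)..c t, f s x := by
  induction n generalizing f with
  | zero => exact continuous_time_integral hf hc
  | succ n ih =>
    exact Sm.of_hasDerivAt (continuous_time_integral hf.continuous hc)
      (fun t x => hasDerivAt_integral_param hf.continuous hf.deriv.continuous hf.hasDerivAt _ _ _)
      (ih hf.deriv)

/-- The spatial derivatives of `f` up to order `n` are bounded. -/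
def Bd (n : ℕ) (f : ℝ → ℝ → ℝ) : Prop :=
  ∀ k ≤ n, ∃ B, ∀ t x, |iteratedDeriv k (f t) x| ≤ B

lemma Bd.bound {n : ℕ} {f : ℝ → ℝ → ℝ} (h : Bd n f) : ∃ B, ∀ t x, |f t x| ≤ B := by
  simpa using h 0 (Nat.zero_le _)

lemma Bd.deriv {n : ℕ} {f : ℝ → ℝ → ℝ} (h : Bd (n + 1) f) : Bd n fun t => deriv (f t) := by
  intro k hk
  simpa only [iteratedDeriv_succ'] using h (k + 1) (by omega)

lemma Bd.mono {m n : ℕ} {f : ℝ → ℝ → ℝ} (h : Bd n f) (hm : m ≤ n) : Bd m f :=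
  fun k hk => h k (hk.trans hm)

section Conv

variable {e a : ℝ}

lemma deriv_conv (ha : 0 < a) (he : 0 ≤ e) (hea : e ≤ a) {n : ℕ} {f : ℝ → ℝ → ℝ}
    (hf : Sm (n + 1) f) (hb : Bd (n + 1) f) (t : ℝ) :
    deriv (conv e a (f t)) = conv e a (deriv (f t)) := by
  obtain ⟨B, hB⟩ := hb.bound
  obtain ⟨B', hB'⟩ := hb.deriv.bound
  ext x
  exact (hasDerivAt_conv ha he hea (hf.hasDerivAt t) (hf.deriv.continuous_space t) (hB t) (hB' t)
    x).deriv

lemma Sm.conv (ha : 0 < a) (he : 0 ≤ e) (hea : e ≤ a) {n : ℕ} {f : ℝ → ℝ → ℝ}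
    (hf : Sm n f) (hb : Bd n f) : Sm n fun t => conv e a (f t) := by
  obtain ⟨B, hB⟩ := hb.bound
  have hc : Continuous fun p : ℝ × ℝ => HouLuoLine.conv e a (f p.1) p.2 :=
    continuous_conv (X := ℝ × ℝ) (f := fun p => f p.1) ha he hea
      (hf.continuous.comp (by fun_prop : Continuous fun q : (ℝ × ℝ) × ℝ => (q.1.1, q.2)))
      continuous_snd fun p => hB p.1
  induction n generalizing f B with
  | zero => exact hc
  | succ n ih =>
    obtain ⟨B', hB'⟩ := hb.deriv.bound
    refine Sm.of_hasDerivAt hc (fun t x => hasDerivAt_conv ha he hea (hf.hasDerivAt t)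
      (hf.deriv.continuous_space t) (hB t) (hB' t) x) (ih hf.deriv hb.deriv B' hB' ?_)
    exact continuous_conv (X := ℝ × ℝ) (f := fun p => _root_.deriv (f p.1)) ha he hea
      (hf.deriv.continuous.comp (by fun_prop : Continuous fun q : (ℝ × ℝ) × ℝ => (q.1.1, q.2)))
      continuous_snd fun p => hB' p.1

lemma iteratedDeriv_conv (ha : 0 < a) (he : 0 ≤ e) (hea : e ≤ a) {k : ℕ} {f : ℝ → ℝ → ℝ}
    (hf : Sm k f) (hb : Bd k f) (t : ℝ) :
    iteratedDeriv k (HouLuoLine.conv e a (f t)) = HouLuoLine.conv e a (iteratedDeriv k (f t)) := by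
  induction k generalizing f with
  | zero => simp
  | succ k ih =>
    rw [iteratedDeriv_succ', deriv_conv ha he hea hf hb, ih hf.deriv hb.deriv, iteratedDeriv_succ']

lemma Bd.conv (ha : 0 < a) (he : 0 ≤ e) (hea : e ≤ a) {n : ℕ} {f : ℝ → ℝ → ℝ}
    (hf : Sm n f) (hb : Bd n f) : Bd n fun t => conv e a (f t) := by
  intro k hk
  obtain ⟨B, hB⟩ := hb k hk
  refine ⟨kernMass a * B, fun t x => ?_⟩
  rw [iteratedDeriv_conv ha he hea (hf.mono hk) (hb.mono hk)]
  exact abs_conv_le ha he hea (hB t) x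

end Conv

/-! ### Families frozen outside a time interval, and compactness bounds -/

/-- Projection of time to `[0,T]`. -/
def clamp (T t : ℝ) : ℝ := max 0 (min t T)

lemma continuous_clamp (T : ℝ) : Continuous (clamp T) := by unfold clamp; fun_prop

lemma clamp_of_mem {T t : ℝ} (ht : t ∈ Icc 0 T) : clamp T t = t := by
  simp [clamp, ht.1, ht.2]

lemma clamp_mem {T : ℝ} (hT : 0 ≤ T) (t : ℝ) : clamp T t ∈ Icc 0 T := by
  simp [clamp, hT]

lemma clamp_clamp {T : ℝ} (hT : 0 ≤ T) (t : ℝ) : clamp T (clamp T t) = clamp T t :=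
  clamp_of_mem (clamp_mem hT t)

lemma iteratedDeriv_eq_zero_of_supp {f : ℝ → ℝ} (hs : ∀ x, 1 < |x| → f x = 0) (k : ℕ) (x : ℝ)
    (hx : 1 < |x|) : iteratedDeriv k f x = 0 := by
  induction k generalizing x with
  | zero => simpa using hs x hx
  | succ k ih => rw [iteratedDeriv_succ]; exact deriv_eq_zero_of_supp ih x hx

/-- All nonzero values of such a family are already taken on the compact set [0,T] × [-1,1]. -/
lemma exists_bound_clamp {T : ℝ} (hT : 0 ≤ T) {f : ℝ → ℝ → ℝ}
    (hf : Continuous fun p : ℝ × ℝ => f p.1 p.2) (hc : ∀ t, f (clamp T t) = f t)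
    (hs : ∀ t x, 1 < |x| → f t x = 0) : ∃ B, ∀ t x, |f t x| ≤ B := by
  obtain ⟨B, hB⟩ := (isCompact_Icc (a := (0 : ℝ)) (b := T)).prod
    (isCompact_Icc (a := (-1 : ℝ)) (b := 1)) |>.exists_bound_of_continuousOn hf.continuousOn
  refine ⟨max B 0, fun t x => ?_⟩
  by_cases hx : 1 < |x|
  · rw [hs t x hx]; simp
  · rw [← hc]
    exact (hB (clamp T t, x) ⟨clamp_mem hT t, abs_le.1 (not_lt.1 hx)⟩).trans (le_max_left _ _)

lemma Bd.of_clamp {T : ℝ} (hT : 0 ≤ T) {n : ℕ} {f : ℝ → ℝ → ℝ} (hf : Sm n f)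
    (hc : ∀ t, f (clamp T t) = f t) (hs : ∀ t x, 1 < |x| → f t x = 0) : Bd n f := by
  intro k hk
  exact exists_bound_clamp hT (f := fun t => iteratedDeriv k (f t))
    (Sm.iteratedDeriv (n := 0) (hf.mono (by omega))) (fun t => by rw [hc])
    fun t => iteratedDeriv_eq_zero_of_supp (hs t) k

/-! ### Integral and differential equations in time -/

section TimeCalculus

variable {T : ℝ} {f g : ℝ → ℝ}

lemma hasDerivWithinAt_of_eq_integral (hg : Continuous g)
    (h : ∀ t ∈ Icc 0 T, f t = f 0 + ∫ s in (0 : ℝ)..t, g s) {t : ℝ} (ht : t ∈ Icc 0 T) :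
    HasDerivWithinAt f (g t) (Icc 0 T) t := by
  have h1 : HasDerivAt (fun t => f 0 + ∫ s in (0 : ℝ)..t, g s) (g t) t :=
    (intervalIntegral.integral_hasDerivAt_right (hg.intervalIntegrable _ _)
      hg.stronglyMeasurable.stronglyMeasurableAtFilter hg.continuousAt).const_add _
  exact h1.hasDerivWithinAt.congr h (h t ht)

lemma hasDerivWithinAt_Ici {f' t : ℝ} (h : HasDerivWithinAt f f' (Icc 0 T) t) (ht : t ∈ Ico 0 T) :
    HasDerivWithinAt f f' (Ici t) t :=
  h.mono_of_mem_nhdsWithin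
    (mem_of_superset (Icc_mem_nhdsGE_of_mem ⟨le_rfl, ht.2⟩) (Icc_subset_Icc_left ht.1))

lemma eq_integral_of_hasDerivWithinAt (hg : ContinuousOn g (Icc 0 T))
    (h : ∀ t ∈ Icc 0 T, HasDerivWithinAt f (g t) (Icc 0 T) t) {t : ℝ} (ht : t ∈ Icc 0 T) :
    f t = f 0 + ∫ s in (0 : ℝ)..t, g s := by
  have hsub : Icc 0 t ⊆ Icc 0 T := Icc_subset_Icc_right ht.2
  rw [intervalIntegral.integral_eq_sub_of_hasDeriv_right_of_le ht.1 (f := f) (f' := g)]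
  · ring
  · exact fun s hs => ((h s (hsub hs)).continuousWithinAt).mono hsub
  · exact fun s hs => (hasDerivWithinAt_Ici (h s (hsub (Ioo_subset_Icc_self hs)))
      ⟨hs.1.le, hs.2.trans_le ht.2⟩).mono Ioi_subset_Ici_self
  · apply ContinuousOn.intervalIntegrable
    rw [uIcc_of_le ht.1]
    exact hg.mono hsub

lemma hasDerivAt_primitive (hg : Continuous g) (t : ℝ) :
    HasDerivAt (fun t => ∫ s in (0 : ℝ)..t, g s) (g t) t :=
  intervalIntegral.integral_hasDerivAt_right (hg.intervalIntegrable _ _)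
    hg.stronglyMeasurable.stronglyMeasurableAtFilter hg.continuousAt

lemma eq_mul_exp_of_hasDerivWithinAt {q : ℝ → ℝ} (hq : Continuous q)
    (h : ∀ t ∈ Icc 0 T, HasDerivWithinAt f (q t * f t) (Icc 0 T) t) {t : ℝ} (ht : t ∈ Icc 0 T) :
    f t = f 0 * Real.exp (∫ s in (0 : ℝ)..t, q s) := by
  set Q : ℝ → ℝ := fun t => ∫ s in (0 : ℝ)..t, q s with hQ
  have hd : ∀ t ∈ Icc 0 T, HasDerivWithinAt (fun t => f t * Real.exp (-Q t)) 0 (Icc 0 T) t := by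
    intro t ht
    have := (h t ht).mul ((hasDerivAt_primitive hq t).neg.exp.hasDerivWithinAt)
    refine this.congr_deriv ?_
    simp only [Pi.neg_apply]
    ring
  have := constant_of_has_deriv_right_zero (fun s hs => (hd s hs).continuousWithinAt)
    (fun s hs => hasDerivWithinAt_Ici (hd s (Ico_subset_Icc_self hs)) hs) t ht
  simp only [hQ, intervalIntegral.integral_same, neg_zero, Real.exp_zero, mul_one] at this
  rw [← this, mul_assoc, ← Real.exp_add]
  simp

/-- Continuity of `m` is enough because the other factor vanishes at t. -/
lemma hasDerivAt_mul_of_continuousAt {m : ℝ → ℝ} {t : ℝ} (hm : ContinuousAt m t) :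
    HasDerivAt (fun s => (s - t) * m s) (m t) t := by
  rw [hasDerivAt_iff_tendsto_slope]
  refine (hm.tendsto.mono_left nhdsWithin_le_nhds).congr' ?_
  filter_upwards [self_mem_nhdsWithin] with s hs
  have : s - t ≠ 0 := sub_ne_zero.2 hs
  rw [slope_def_field]
  field_simp
  ring

/-- The integral is (r - t) times an average that is continuous in r, so no derivative of `h` in its
second variable is needed. This is the tool for differentiating along characteristics when only
continuity in time is known. -/
lemma hasDerivAt_diagonal_integral {h : ℝ → ℝ → ℝ} (hh : Continuous fun p : ℝ × ℝ => h p.1 p.2)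
    (t : ℝ) : HasDerivAt (fun r => ∫ s in t..r, h s r) (h t t) t := by
  have hm : Continuous fun r => ∫ σ in (0 : ℝ)..1, h (t + σ * (r - t)) r := by
    apply intervalIntegral.continuous_parametric_intervalIntegral_of_continuous'
    exact hh.comp (by fun_prop : Continuous fun q : ℝ × ℝ => (t + q.2 * (q.1 - t), q.1))
  have := hasDerivAt_mul_of_continuousAt (t := t) hm.continuousAt
  simp only [sub_self, mul_zero, add_zero, intervalIntegral.integral_const, sub_zero,
    one_smul] at this
  refine this.congr_of_eventuallyEq (.of_forall fun r => ?_)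
  rcases eq_or_ne r t with rfl | hr
  · simp
  · have hr' : r - t ≠ 0 := sub_ne_zero.2 hr
    have := intervalIntegral.integral_comp_add_mul (a := 0) (b := 1) (fun s => h s r) hr' t
    simp only [mul_zero, add_zero, mul_one, add_sub_cancel, smul_eq_mul] at this
    have e : ∀ σ, t + σ * (r - t) = t + (r - t) * σ := fun σ => by ring
    simp only [e, this]
    field_simp

end TimeCalculus

lemma sub_eq_integral_deriv_mul {v : ℝ → ℝ} (hv : Differentiable ℝ v) (hv' : Continuous (deriv v))
    (x y : ℝ) : v x - v y = (∫ σ in (0 : ℝ)..1, deriv v (y + σ * (x - y))) * (x - y) := by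
  have hd : ∀ σ, HasDerivAt (fun σ => v (y + σ * (x - y))) (deriv v (y + σ * (x - y)) * (x - y)) σ := by
    intro σ
    have h1 : HasDerivAt (fun σ => y + σ * (x - y)) (x - y) σ := by
      simpa using ((hasDerivAt_id σ).mul_const (x - y)).const_add y
    exact (hv _).hasDerivAt.comp σ h1
  rw [← intervalIntegral.integral_mul_const,
    intervalIntegral.integral_eq_sub_of_hasDerivAt (fun σ _ => hd σ)]
  · simp
  · apply Continuous.intervalIntegrable; fun_prop

/-! ### The flow of a bounded C¹ velocity field and its inverse -/

/-- `Φ` is the flow of the time dependent vector field `v` on `[0,T]`, extended to all times by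
constants. -/
structure IsFlow (T : ℝ) (v Φ : ℝ → ℝ → ℝ) : Prop where
  zero : ∀ x, Φ 0 x = x
  ode : ∀ x, ∀ t ∈ Icc 0 T, HasDerivWithinAt (fun s => Φ s x) (v t (Φ t x)) (Icc 0 T) t
  clamp : ∀ t, Φ (clamp T t) = Φ t

/-- Since v is globally bounded and globally Lipschitz, a single application of Picard–Lindelöf, on
a ball of radius B·T, covers the whole of [0,T]. -/
theorem exists_isFlow {T B K : ℝ} (hT : 0 ≤ T) {v : ℝ → ℝ → ℝ} (hv : Sm 1 v)
    (hB : ∀ t x, |v t x| ≤ B) (hK : ∀ t x, |deriv (v t) x| ≤ K) : ∃ Φ, IsFlow T v Φ := by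
  have hB0 : 0 ≤ B := (abs_nonneg _).trans (hB 0 0)
  have hK0 : 0 ≤ K := (abs_nonneg _).trans (hK 0 0)
  have hPL : ∀ x : ℝ, IsPicardLindelof v (⟨0, le_rfl, hT⟩ : Icc 0 T) x
      (⟨B * T, by positivity⟩) 0 ⟨B, hB0⟩ ⟨K, hK0⟩ := by
    intro x
    refine ⟨fun t _ => ?_, fun y _ => (hv.continuous_time y).continuousOn,
      fun t _ y _ => hB t y, ?_⟩
    · exact (lipschitzWith_of_nnnorm_deriv_le (hv.1 t) fun y => hK t y).lipschitzOnWith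
    · simp only [sub_zero, sub_self, NNReal.coe_zero, max_eq_left hT]; exact le_rfl
  choose α hα using fun x => (hPL x).exists_eq_forall_mem_Icc_hasDerivWithinAt₀
  refine ⟨fun t x => α x (clamp T t), fun x => ?_, fun x t ht => ?_, fun t => ?_⟩
  · rw [clamp_of_mem ⟨le_rfl, hT⟩]; exact (hα x).1
  · have := (hα x).2 t ht
    simp only [clamp_of_mem ht]
    exact this.congr (fun s hs => by rw [clamp_of_mem hs]) (by rw [clamp_of_mem ht])
  · simp only [clamp_clamp hT]

namespace IsFlow

variable {T B K : ℝ} {v Φ : ℝ → ℝ → ℝ}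

lemma continuous_time (hT : 0 ≤ T) (h : IsFlow T v Φ) (x : ℝ) : Continuous fun t => Φ t x := by
  have h1 : ContinuousOn (fun t => Φ t x) (Icc 0 T) := fun t ht =>
    (h.ode x t ht).continuousWithinAt
  have h2 := h1.comp_continuous (continuous_clamp T) fun t => clamp_mem hT t
  simpa only [Function.comp_def, h.clamp] using h2

/-- The averaged derivative of the vector field between two trajectories. -/
noncomputable def avg (v Φ : ℝ → ℝ → ℝ) (x y s : ℝ) : ℝ :=
  ∫ σ in (0 : ℝ)..1, deriv (v s) (Φ s y + σ * (Φ s x - Φ s y))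

lemma continuous_avg (hT : 0 ≤ T) (h : IsFlow T v Φ) (hv : Sm 1 v) (x y : ℝ) :
    Continuous (avg v Φ x y) := by
  apply intervalIntegral.continuous_parametric_intervalIntegral_of_continuous'
  have c1 := h.continuous_time hT x
  have c2 := h.continuous_time hT y
  exact hv.deriv.continuous.comp
    (by fun_prop : Continuous fun q : ℝ × ℝ => (q.1, Φ q.1 y + q.2 * (Φ q.1 x - Φ q.1 y)))

/-- The difference of two trajectories solves a scalar linear equation with the averaged derivative
as coefficient. Monotonicity, two-sided Lipschitz bounds and spatial differentiability of the flow
are all read off this formula. -/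
lemma sub_eq (hT : 0 ≤ T) (h : IsFlow T v Φ) (hv : Sm 1 v) (t x y : ℝ) :
    Φ t x - Φ t y = (x - y) * Real.exp (∫ s in (0 : ℝ)..HouLuoLine.clamp T t, avg v Φ x y s) := by
  rw [← h.clamp t]
  have := eq_mul_exp_of_hasDerivWithinAt (T := T) (f := fun t => Φ t x - Φ t y)
    (h.continuous_avg hT hv x y) (fun t ht => ?_) (clamp_mem hT t)
  · simpa only [h.zero] using this
  · refine ((h.ode x t ht).sub (h.ode y t ht)).congr_deriv ?_
    exact sub_eq_integral_deriv_mul (hv.1 t) (hv.deriv.continuous_space t) _ _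

lemma abs_avg_le (hK : ∀ t x, |deriv (v t) x| ≤ K) (x y s : ℝ) : |avg v Φ x y s| ≤ K := by
  have := intervalIntegral.norm_integral_le_of_norm_le_const (a := (0 : ℝ)) (b := 1)
    (f := fun σ => deriv (v s) (Φ s y + σ * (Φ s x - Φ s y))) (C := K) fun σ _ => hK s _
  simpa [avg] using this

lemma abs_integral_avg_le (hT : 0 ≤ T) (hK : ∀ t x, |deriv (v t) x| ≤ K) (t x y : ℝ) :
    |∫ s in (0 : ℝ)..HouLuoLine.clamp T t, avg v Φ x y s| ≤ K * T := by
  have hK0 : 0 ≤ K := (abs_nonneg _).trans (hK 0 0)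
  have := intervalIntegral.norm_integral_le_of_norm_le_const (a := (0 : ℝ))
    (b := HouLuoLine.clamp T t) (f := avg v Φ x y) (C := K) fun s _ => abs_avg_le hK x y s
  refine this.trans ?_
  have hc := clamp_mem hT t
  rw [sub_zero, abs_of_nonneg hc.1]
  exact mul_le_mul_of_nonneg_left hc.2 hK0

lemma abs_sub_le (hT : 0 ≤ T) (h : IsFlow T v Φ) (hv : Sm 1 v)
    (hK : ∀ t x, |deriv (v t) x| ≤ K) (t x y : ℝ) :
    |Φ t x - Φ t y| ≤ Real.exp (K * T) * |x - y| := by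
  rw [h.sub_eq hT hv, abs_mul, Real.abs_exp, mul_comm]
  exact mul_le_mul_of_nonneg_right
    (Real.exp_le_exp.2 ((le_abs_self _).trans (abs_integral_avg_le hT hK t x y))) (abs_nonneg _)

lemma le_abs_sub (hT : 0 ≤ T) (h : IsFlow T v Φ) (hv : Sm 1 v)
    (hK : ∀ t x, |deriv (v t) x| ≤ K) (t x y : ℝ) :
    |x - y| ≤ Real.exp (K * T) * |Φ t x - Φ t y| := by
  rw [h.sub_eq hT hv, abs_mul, Real.abs_exp, mul_left_comm, ← Real.exp_add]
  have := neg_le_of_abs_le (abs_integral_avg_le (Φ := Φ) hT hK t x y)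
  have h1 : 1 ≤ Real.exp (K * T + ∫ s in (0 : ℝ)..HouLuoLine.clamp T t, avg v Φ x y s) :=
    Real.one_le_exp (by linarith)
  nlinarith [abs_nonneg (x - y)]

lemma strictMono (hT : 0 ≤ T) (h : IsFlow T v Φ) (hv : Sm 1 v) (t : ℝ) : StrictMono (Φ t) := by
  intro y x hxy
  have := h.sub_eq hT hv t x y
  have h1 : 0 < x - y := sub_pos.2 hxy
  have : 0 < Φ t x - Φ t y := by rw [this]; positivity
  linarith

lemma continuous (hT : 0 ≤ T) (h : IsFlow T v Φ) (hv : Sm 1 v)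
    (hK : ∀ t x, |deriv (v t) x| ≤ K) : Continuous fun p : ℝ × ℝ => Φ p.1 p.2 := by
  refine continuous_prod_of_continuous_lipschitzWith' (fun p : ℝ × ℝ => Φ p.1 p.2)
    (Real.toNNReal (Real.exp (K * T))) (fun t => ?_) (h.continuous_time hT)
  refine LipschitzWith.of_dist_le_mul fun x y => ?_
  rw [Real.coe_toNNReal _ (Real.exp_pos _).le]
  exact h.abs_sub_le hT hv hK t x y

/-- The logarithm of the Jacobian of the flow. -/
noncomputable def logJac (T : ℝ) (v Φ : ℝ → ℝ → ℝ) (t x : ℝ) : ℝ :=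
  ∫ s in (0 : ℝ)..HouLuoLine.clamp T t, deriv (v s) (Φ s x)

/-- By `sub_eq`, Φ(t,y) - Φ(t,x) is y - x times a function of y that is continuous at x, with the
Jacobian as its value there. -/
lemma hasDerivAt_space (hT : 0 ≤ T) (h : IsFlow T v Φ) (hv : Sm 1 v)
    (hK : ∀ t x, |deriv (v t) x| ≤ K) (t x : ℝ) :
    HasDerivAt (Φ t) (Real.exp (logJac T v Φ t x)) x := by
  have hΦ := h.continuous hT hv hK
  have hm : Continuous fun y => Real.exp (∫ s in (0 : ℝ)..HouLuoLine.clamp T t, avg v Φ y x s) := by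
    refine Real.continuous_exp.comp ?_
    apply intervalIntegral.continuous_parametric_intervalIntegral_of_continuous'
    unfold avg Function.uncurry
    apply intervalIntegral.continuous_parametric_intervalIntegral_of_continuous'
    have e1 : Continuous fun q : (ℝ × ℝ) × ℝ => Φ q.1.2 x :=
      (h.continuous_time hT x).comp (by fun_prop)
    have e2 : Continuous fun q : (ℝ × ℝ) × ℝ => Φ q.1.2 q.1.1 :=
      hΦ.comp (by fun_prop : Continuous fun q : (ℝ × ℝ) × ℝ => (q.1.2, q.1.1))
    exact hv.deriv.continuous.comp (by fun_prop : Continuous fun q : (ℝ × ℝ) × ℝ =>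
      (q.1.2, Φ q.1.2 x + q.2 * (Φ q.1.2 q.1.1 - Φ q.1.2 x)))
  have := hasDerivAt_mul_of_continuousAt (t := x) hm.continuousAt
  have e : Real.exp (∫ s in (0 : ℝ)..HouLuoLine.clamp T t, avg v Φ x x s)
      = Real.exp (logJac T v Φ t x) := by simp [avg, logJac]
  rw [e] at this
  refine (this.add_const (Φ t x)).congr_of_eventuallyEq (.of_forall fun y => ?_)
  simp only [← h.sub_eq hT hv]
  ring

lemma sm_logJac (n : ℕ) (hv : Sm (n + 1) v) (hΦ : Sm n Φ) : Sm n (logJac T v Φ) :=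
  (hv.deriv.comp hΦ).integral (continuous_clamp T)

/-- Bootstrap: the spatial derivative is the exponential of `logJac`, which is as smooth as Φ
itself, so each round gains one derivative. -/
lemma sm (hT : 0 ≤ T) (h : IsFlow T v Φ) {n : ℕ} (hv : Sm (n + 1) v)
    (hK : ∀ t x, |deriv (v t) x| ≤ K) : Sm (n + 1) Φ := by
  induction n with
  | zero =>
    have hc := h.continuous hT hv hK
    exact Sm.of_hasDerivAt hc (h.hasDerivAt_space hT hv hK)
      ((Sm.of_contDiff (Real.contDiff_exp)).comp (sm_logJac 0 hv hc))
  | succ n ih =>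
    have hc := h.continuous hT (hv.mono (by omega)) hK
    exact Sm.of_hasDerivAt hc (h.hasDerivAt_space hT (hv.mono (by omega)) hK)
      ((Sm.of_contDiff (Real.contDiff_exp)).comp (sm_logJac (n + 1) hv (ih hv.of_succ)))

lemma abs_sub_self_le (hT : 0 ≤ T) (h : IsFlow T v Φ) (hv : Sm 1 v) (hB : ∀ t x, |v t x| ≤ B)
    (t x : ℝ) : |Φ t x - x| ≤ B * T := by
  have hB0 : 0 ≤ B := (abs_nonneg _).trans (hB 0 0)
  rw [← h.clamp t]
  have hc := clamp_mem hT t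
  have hcont : Continuous fun s => v s (Φ s x) := by
    have := h.continuous_time hT x
    exact hv.continuous.comp (by fun_prop : Continuous fun s : ℝ => (s, Φ s x))
  have := eq_integral_of_hasDerivWithinAt (T := T) (f := fun s => Φ s x)
    (g := fun s => v s (Φ s x)) hcont.continuousOn (h.ode x) hc
  rw [this, h.zero, add_sub_cancel_left]
  have := intervalIntegral.norm_integral_le_of_norm_le_const (a := (0 : ℝ))
    (b := HouLuoLine.clamp T t) (f := fun s => v s (Φ s x)) (C := B) fun s _ => hB s _
  refine this.trans ?_
  rw [sub_zero, abs_of_nonneg hc.1]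
  exact mul_le_mul_of_nonneg_left hc.2 hB0

lemma surjective (hT : 0 ≤ T) (h : IsFlow T v Φ) (hv : Sm 1 v) (hB : ∀ t x, |v t x| ≤ B)
    (hK : ∀ t x, |deriv (v t) x| ≤ K) (t : ℝ) : Function.Surjective (Φ t) := by
  have hc : Continuous (Φ t) := (h.continuous hT hv hK).comp
    (by fun_prop : Continuous fun x : ℝ => (t, x))
  have hb := fun x => abs_le.1 (h.abs_sub_self_le hT hv hB t x)
  refine hc.surjective ?_ ?_
  · exact tendsto_atTop_mono (fun x => by simp only [id]; linarith [(hb x).1])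
      (tendsto_atTop_add_const_right _ (-(B * T)) tendsto_id)
  · exact tendsto_atBot_mono (fun x => by simp only [id]; linarith [(hb x).2])
      (tendsto_atBot_add_const_right _ (B * T) tendsto_id)

/-- The inverse of the flow map. -/
noncomputable def inv (Φ : ℝ → ℝ → ℝ) (t : ℝ) : ℝ → ℝ := Function.invFun (Φ t)

lemma inv_apply (hT : 0 ≤ T) (h : IsFlow T v Φ) (hv : Sm 1 v) (t x : ℝ) : inv Φ t (Φ t x) = x :=
  Function.leftInverse_invFun (h.strictMono hT hv t).injective x

lemma apply_inv (hT : 0 ≤ T) (h : IsFlow T v Φ) (hv : Sm 1 v) (hB : ∀ t x, |v t x| ≤ B)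
    (hK : ∀ t x, |deriv (v t) x| ≤ K) (t z : ℝ) : Φ t (inv Φ t z) = z :=
  Function.rightInverse_invFun (h.surjective hT hv hB hK t) z

lemma continuous_inv (hT : 0 ≤ T) (h : IsFlow T v Φ) (hv : Sm 1 v) (hB : ∀ t x, |v t x| ≤ B)
    (hK : ∀ t x, |deriv (v t) x| ≤ K) : Continuous fun p : ℝ × ℝ => inv Φ p.1 p.2 := by
  have ha := h.apply_inv hT hv hB hK
  refine continuous_prod_of_continuous_lipschitzWith' (fun p : ℝ × ℝ => inv Φ p.1 p.2)
    (Real.toNNReal (Real.exp (K * T))) (fun t => ?_) fun z => ?_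
  · refine LipschitzWith.of_dist_le_mul fun x y => ?_
    rw [Real.coe_toNNReal _ (Real.exp_pos _).le]
    have := h.le_abs_sub hT hv hK t (inv Φ t x) (inv Φ t y)
    rwa [ha, ha] at this
  · refine continuous_iff_continuousAt.2 fun t₀ => ?_
    rw [ContinuousAt, tendsto_iff_dist_tendsto_zero]
    have hlim : Tendsto (fun t => Real.exp (K * T) * |z - Φ t (inv Φ t₀ z)|) (𝓝 t₀)
        (𝓝 (Real.exp (K * T) * |z - Φ t₀ (inv Φ t₀ z)|)) := by
      have := h.continuous_time hT (inv Φ t₀ z)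
      exact Continuous.tendsto (by fun_prop) _
    rw [ha, sub_self, abs_zero, mul_zero] at hlim
    refine squeeze_zero (fun _ => dist_nonneg) (fun t => ?_) hlim
    have := h.le_abs_sub hT hv hK t (inv Φ t z) (inv Φ t₀ z)
    rwa [ha] at this

lemma hasDerivAt_inv (hT : 0 ≤ T) (h : IsFlow T v Φ) (hv : Sm 1 v) (hB : ∀ t x, |v t x| ≤ B)
    (hK : ∀ t x, |deriv (v t) x| ≤ K) (t z : ℝ) :
    HasDerivAt (inv Φ t) (Real.exp (-logJac T v Φ t (inv Φ t z))) z := by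
  have hc : Continuous (inv Φ t) := (h.continuous_inv hT hv hB hK).comp
    (by fun_prop : Continuous fun x : ℝ => (t, x))
  rw [Real.exp_neg]
  exact (h.hasDerivAt_space hT hv hK t (inv Φ t z)).of_local_left_inverse hc.continuousAt
    (Real.exp_pos _).ne' (.of_forall fun y => h.apply_inv hT hv hB hK t y)

lemma sm_inv (hT : 0 ≤ T) (h : IsFlow T v Φ) {n : ℕ} (hv : Sm (n + 1) v)
    (hB : ∀ t x, |v t x| ≤ B) (hK : ∀ t x, |deriv (v t) x| ≤ K) : Sm (n + 1) (inv Φ) := by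
  have hΦ := h.sm hT hv hK
  induction n with
  | zero =>
    have hc := h.continuous_inv hT hv hB hK
    exact Sm.of_hasDerivAt hc (h.hasDerivAt_inv hT hv hB hK)
      ((Sm.of_contDiff (Real.contDiff_exp)).comp
        (Sm.neg ((sm_logJac 0 hv hΦ.of_succ).comp (g := inv Φ) hc)))
  | succ n ih =>
    have hc := h.continuous_inv hT (hv.mono (by omega)) hB hK
    exact Sm.of_hasDerivAt hc (h.hasDerivAt_inv hT (hv.mono (by omega)) hB hK)
      ((Sm.of_contDiff (Real.contDiff_exp)).comp
        (Sm.neg ((sm_logJac (n + 1) hv hΦ.of_succ).comp (ih hv.of_succ hΦ.of_succ))))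

/-- Following the trajectory that reaches z at time r back to time t gives A(r,z) = A(t, z - ∫ₜʳ
v(s, Φ(s, A(r,z))) ds), where A is the inverse flow. The right side is differentiable in r at t by
the chain rule and `hasDerivAt_diagonal_integral`, although A(r,z) inside the integral is only known
to be continuous in r. -/
lemma hasDerivWithinAt_inv (hT : 0 ≤ T) (h : IsFlow T v Φ) (hv : Sm 1 v)
    (hB : ∀ t x, |v t x| ≤ B) (hK : ∀ t x, |deriv (v t) x| ≤ K) {t : ℝ} (ht : t ∈ Icc 0 T)
    (z : ℝ) :
    HasDerivWithinAt (fun s => inv Φ s z) (-(v t z * deriv (inv Φ t) z)) (Icc 0 T) t := by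
  have hΦ := h.continuous hT hv hK
  have hA := h.continuous_inv hT hv hB hK
  set k : ℝ → ℝ → ℝ := fun s r => v s (Φ s (inv Φ r z)) with hk
  have hkc : Continuous fun p : ℝ × ℝ => k p.1 p.2 := by
    have c1 : Continuous fun p : ℝ × ℝ => inv Φ p.2 z :=
      hA.comp (by fun_prop : Continuous fun p : ℝ × ℝ => (p.2, z))
    have c2 : Continuous fun p : ℝ × ℝ => Φ p.1 (inv Φ p.2 z) :=
      hΦ.comp (by fun_prop : Continuous fun p : ℝ × ℝ => (p.1, inv Φ p.2 z))
    exact hv.continuous.comp (by fun_prop : Continuous fun p : ℝ × ℝ => (p.1, Φ p.1 (inv Φ p.2 z)))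
  have hδ := hasDerivAt_diagonal_integral hkc t
  have hkt : k t t = v t z := by simp only [hk, h.apply_inv hT hv hB hK]
  rw [hkt] at hδ
  have hcomp : HasDerivAt (fun r => inv Φ t (z - ∫ s in t..r, k s r))
      (deriv (inv Φ t) z * -(v t z)) t := by
    have h1 : HasDerivAt (fun r => z - ∫ s in t..r, k s r) (-(v t z)) t := by
      simpa using hδ.const_sub z
    have h2 : HasDerivAt (inv Φ t) (deriv (inv Φ t) z) (z - ∫ s in t..t, k s t) := by
      rw [intervalIntegral.integral_same, sub_zero]
      exact (h.hasDerivAt_inv hT hv hB hK t z).differentiableAt.hasDerivAt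
    exact h2.comp t h1
  have heq : ∀ r ∈ Icc 0 T, inv Φ r z = inv Φ t (z - ∫ s in t..r, k s r) := by
    intro r hr
    set x := inv Φ r z with hx
    have hcont : Continuous fun s => v s (Φ s x) := by
      have := h.continuous_time hT x
      exact hv.continuous.comp (by fun_prop : Continuous fun s : ℝ => (s, Φ s x))
    have f1 := eq_integral_of_hasDerivWithinAt (T := T) (f := fun s => Φ s x)
      (g := fun s => v s (Φ s x)) hcont.continuousOn (h.ode x) hr
    have f2 := eq_integral_of_hasDerivWithinAt (T := T) (f := fun s => Φ s x)
      (g := fun s => v s (Φ s x)) hcont.continuousOn (h.ode x) ht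
    have f3 := intervalIntegral.integral_add_adjacent_intervals
      (hcont.intervalIntegrable 0 t) (hcont.intervalIntegrable (μ := volume) t r)
    have f4 : Φ r x = z := h.apply_inv hT hv hB hK r z
    have : z - ∫ s in t..r, k s r = Φ t x := by
      simp only [hk, ← hx]
      linarith
    rw [this, h.inv_apply hT hv]
  have := hcomp.hasDerivWithinAt (s := Icc 0 T)
  refine (this.congr heq (heq t ht)).congr_deriv ?_
  ring

end IsFlow

/-! ### Symmetric flows and the linear transport problem -/

lemma deriv_even_of_odd {f : ℝ → ℝ} (hf : Function.Odd f) : Function.Even (deriv f) := by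
  intro x
  have h : (fun y => f (-y)) = fun y => -f y := funext hf
  have h1 := deriv_comp_neg f x
  rw [h, deriv.fun_neg] at h1
  linarith

lemma odd_zero {f : ℝ → ℝ} (hf : Function.Odd f) : f 0 = 0 := by
  have := hf 0
  rw [neg_zero] at this
  linarith

/-- `ω_t + v ω_x = ρ` and `ρ_t + (v ρ)_x = 0` on `[0,T]`, in integrated form. -/
structure IsTransported (T : ℝ) (v ω ρ : ℝ → ℝ → ℝ) : Prop where
  vorticity : ∀ t ∈ Icc 0 T, ∀ x,
    ω t x = ω 0 x + ∫ s in (0 : ℝ)..t, (ρ s x - v s x * deriv (ω s) x)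
  density : ∀ t ∈ Icc 0 T, ∀ x,
    ρ t x = ρ 0 x + ∫ s in (0 : ℝ)..t, -deriv (fun y => v s y * ρ s y) x

/-- Smooth odd functions supported in `[-1,1]` and nonnegative on the right half-line. -/
structure IsProfile (f : ℝ → ℝ) : Prop where
  smooth : ContDiff ℝ (⊤ : ℕ∞) f
  odd : Function.Odd f
  supp : ∀ x, 1 < |x| → f x = 0
  nonneg : ∀ x, 0 ≤ x → 0 ≤ f x

/-- Families of profiles, smooth in space, constant outside the time interval `[0,T]`. -/
structure IsEvolution (T : ℝ) (f : ℝ → ℝ → ℝ) : Prop where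
  sm : ∀ n, Sm n f
  clamp : ∀ t, f (clamp T t) = f t
  odd : ∀ t, Function.Odd (f t)
  supp : ∀ t x, 1 < |x| → f t x = 0
  nonneg : ∀ t x, 0 ≤ x → 0 ≤ f t x

lemma IsEvolution.bd {T : ℝ} (hT : 0 ≤ T) {f : ℝ → ℝ → ℝ} (h : IsEvolution T f) (n : ℕ) : Bd n f :=
  Bd.of_clamp hT (h.sm n) h.clamp h.supp

lemma IsProfile.contDiff {f : ℝ → ℝ} (h : IsProfile f) (n : ℕ) : ContDiff ℝ n f :=
  h.smooth.of_le (by exact_mod_cast le_top)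

namespace IsFlow

variable {T B K : ℝ} {v Φ Ψ : ℝ → ℝ → ℝ}

lemma unique (hT : 0 ≤ T) (h : IsFlow T v Φ) (h' : IsFlow T v Ψ) (hv : Sm 1 v) : Φ = Ψ := by
  ext t x
  rw [← h.clamp, ← h'.clamp]
  have c1 := h.continuous_time hT x
  have c2 := h'.continuous_time hT x
  have hq : Continuous fun s => ∫ σ in (0 : ℝ)..1, deriv (v s) (Ψ s x + σ * (Φ s x - Ψ s x)) := by
    apply intervalIntegral.continuous_parametric_intervalIntegral_of_continuous'
    exact hv.deriv.continuous.comp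
      (by fun_prop : Continuous fun q : ℝ × ℝ => (q.1, Ψ q.1 x + q.2 * (Φ q.1 x - Ψ q.1 x)))
  have := eq_mul_exp_of_hasDerivWithinAt (T := T) (f := fun t => Φ t x - Ψ t x) hq
    (fun t ht => ?_) (clamp_mem hT t)
  · simp only [h.zero, h'.zero, sub_self, zero_mul] at this
    linarith
  · refine ((h.ode x t ht).sub (h'.ode x t ht)).congr_deriv ?_
    exact sub_eq_integral_deriv_mul (hv.1 t) (hv.deriv.continuous_space t) _ _

/-- The reflected map (t,x) ↦ -Φ(t,-x) is a flow of the same field, so uniqueness applies. -/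
lemma odd (hT : 0 ≤ T) (h : IsFlow T v Φ) (hv : Sm 1 v) (hodd : ∀ t, Function.Odd (v t)) (t : ℝ) :
    Function.Odd (Φ t) := by
  have h' : IsFlow T v fun t x => -Φ t (-x) := by
    refine ⟨fun x => by simp [h.zero], fun x t ht => ?_, fun t => by rw [h.clamp]⟩
    refine ((h.ode (-x) t ht).neg).congr_deriv ?_
    rw [hodd]
  have := h.unique hT h' hv
  intro x
  have := congrFun (congrFun this t) x
  rw [this, neg_neg]

lemma inv_odd (hT : 0 ≤ T) (h : IsFlow T v Φ) (hv : Sm 1 v) (hB : ∀ t x, |v t x| ≤ B)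
    (hK : ∀ t x, |deriv (v t) x| ≤ K) (hodd : ∀ t, Function.Odd (v t)) (t : ℝ) :
    Function.Odd (inv Φ t) := by
  intro z
  have h1 := h.odd hT hv hodd t (inv Φ t z)
  rw [h.apply_inv hT hv hB hK] at h1
  rw [← h1, h.inv_apply hT hv]

lemma nonneg (hT : 0 ≤ T) (h : IsFlow T v Φ) (hv : Sm 1 v) (hodd : ∀ t, Function.Odd (v t))
    (t : ℝ) {x : ℝ} (hx : 0 ≤ x) : 0 ≤ Φ t x := by
  have := (h.strictMono hT hv t).monotone hx
  rwa [odd_zero (h.odd hT hv hodd t)] at this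

lemma inv_nonneg (hT : 0 ≤ T) (h : IsFlow T v Φ) (hv : Sm 1 v) (hB : ∀ t x, |v t x| ≤ B)
    (hK : ∀ t x, |deriv (v t) x| ≤ K) (hodd : ∀ t, Function.Odd (v t))
    (t : ℝ) {z : ℝ} (hz : 0 ≤ z) : 0 ≤ inv Φ t z := by
  by_contra hcon
  have := h.strictMono hT hv t (not_le.1 hcon)
  rw [h.apply_inv hT hv hB hK, odd_zero (h.odd hT hv hodd t)] at this
  linarith

lemma eq_add_integral (hT : 0 ≤ T) (h : IsFlow T v Φ) (hv : Sm 1 v) {t : ℝ} (ht : t ∈ Icc 0 T)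
    (x : ℝ) : Φ t x = x + ∫ s in (0 : ℝ)..t, v s (Φ s x) := by
  have hcont : Continuous fun s => v s (Φ s x) := by
    have := h.continuous_time hT x
    exact hv.continuous.comp (by fun_prop : Continuous fun s : ℝ => (s, Φ s x))
  have := eq_integral_of_hasDerivWithinAt (T := T) (f := fun s => Φ s x)
    (g := fun s => v s (Φ s x)) hcont.continuousOn (h.ode x) ht
  rwa [h.zero] at this

lemma apply_le (hT : 0 ≤ T) (h : IsFlow T v Φ) (hv : Sm 1 v) (hodd : ∀ t, Function.Odd (v t))
    (hneg : ∀ t x, 0 ≤ x → v t x ≤ 0) (t : ℝ) {x : ℝ} (hx : 0 ≤ x) : Φ t x ≤ x := by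
  rw [← h.clamp, h.eq_add_integral hT hv (clamp_mem hT t)]
  have : ∫ s in (0 : ℝ)..HouLuoLine.clamp T t, v s (Φ s x) ≤ 0 :=
    by
    have := intervalIntegral.integral_nonneg (f := fun s => -v s (Φ s x)) (μ := volume)
      (clamp_mem hT t).1 fun s _ => neg_nonneg.2 (hneg _ _ (h.nonneg hT hv hodd s hx))
    rw [intervalIntegral.integral_neg] at this
    linarith
  linarith

/-- Trajectories approach the origin, so the starting point of whatever is carried to z lies at
least as far out as z. Functions transported by the flow therefore keep their support in [-1,1]. -/
lemma abs_le_abs_inv (hT : 0 ≤ T) (h : IsFlow T v Φ) (hv : Sm 1 v) (hB : ∀ t x, |v t x| ≤ B)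
    (hK : ∀ t x, |deriv (v t) x| ≤ K) (hodd : ∀ t, Function.Odd (v t))
    (hneg : ∀ t x, 0 ≤ x → v t x ≤ 0) (t z : ℝ) : |z| ≤ |inv Φ t z| := by
  have key : ∀ z, 0 ≤ z → |z| ≤ |inv Φ t z| := fun z hz => by
    have h0 := h.inv_nonneg hT hv hB hK hodd t hz
    have := h.apply_le hT hv hodd hneg t h0
    rw [h.apply_inv hT hv hB hK] at this
    rwa [abs_of_nonneg hz, abs_of_nonneg h0]
  rcases le_total 0 z with hz | hz
  · exact key z hz
  · have := key (-z) (by linarith)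
    rwa [h.inv_odd hT hv hB hK hodd, abs_neg, abs_neg] at this

end IsFlow

/-- Solvability of the linear transport problem with a given smooth velocity field. -/
theorem exists_isTransported {T B K : ℝ} (hT : 0 ≤ T) {v : ℝ → ℝ → ℝ} (hv : ∀ n, Sm n v)
    (hB : ∀ t x, |v t x| ≤ B) (hK : ∀ t x, |deriv (v t) x| ≤ K)
    (hodd : ∀ t, Function.Odd (v t)) (hneg : ∀ t x, 0 ≤ x → v t x ≤ 0) {ω₀ ρ₀ : ℝ → ℝ}
    (hω : IsProfile ω₀) (hρ : IsProfile ρ₀) :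
    ∃ ω ρ, IsEvolution T ω ∧ IsEvolution T ρ ∧ ω 0 = ω₀ ∧ ρ 0 = ρ₀ ∧ IsTransported T v ω ρ := by
  have hv1 := hv 1
  obtain ⟨Φ, h⟩ := exists_isFlow hT hv1 hB hK
  set A := IsFlow.inv Φ with hA
  set L := IsFlow.logJac T v Φ with hL
  have sΦ : ∀ n, Sm n Φ := fun n => (h.sm hT (hv (n + 1)) hK).of_succ
  have sA : ∀ n, Sm n A := fun n => (h.sm_inv hT (hv (n + 1)) hB hK).of_succ
  have sL : ∀ n, Sm n L := fun n => IsFlow.sm_logJac n (hv (n + 1)) (sΦ n)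
  have sE : ∀ n, Sm n fun t x => Real.exp (-L t x) := fun n =>
    (Sm.of_contDiff Real.contDiff_exp).comp (sL n).neg
  have hAx : ∀ t z, HasDerivAt (A t) (Real.exp (-L t (A t z))) z := h.hasDerivAt_inv hT hv1 hB hK
  have hA0 : ∀ z, A 0 z = z := fun z => by
    have := h.inv_apply hT hv1 0 z
    rwa [h.zero] at this
  have hc0 : clamp T 0 = 0 := clamp_of_mem ⟨le_rfl, hT⟩
  have hL0 : ∀ z, L 0 z = 0 := fun z => by simp [hL, IsFlow.logJac, hc0]
  have hAc : ∀ t, A (clamp T t) = A t := fun t => by simp only [hA, IsFlow.inv, h.clamp]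
  have hLc : ∀ t, L (clamp T t) = L t := fun t => by
    ext x; simp only [hL, IsFlow.logJac, clamp_clamp hT]
  have hAodd : ∀ t, Function.Odd (A t) := h.inv_odd hT hv1 hB hK hodd
  have hApos : ∀ t z, 0 ≤ z → 0 ≤ A t z := fun t z hz => h.inv_nonneg hT hv1 hB hK hodd t hz
  have hAabs : ∀ t z, |z| ≤ |A t z| := h.abs_le_abs_inv hT hv1 hB hK hodd hneg
  have hLeven : ∀ t, Function.Even (L t) := fun t x => by
    simp only [hL, IsFlow.logJac]
    congr 1
    ext s
    rw [h.odd hT hv1 hodd s x, deriv_even_of_odd (hodd s)]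
  -- Along the characteristic from x the density is ρ₀(x) exp(-L) and the vorticity grows at that
  -- rate; `W` is the vorticity as a function of the starting point.
  set P : ℝ → ℝ → ℝ := fun t x => ∫ s in (0 : ℝ)..clamp T t, Real.exp (-L s x) with hP
  have sP : ∀ n, Sm n P := fun n => (sE n).integral (continuous_clamp T)
  set W : ℝ → ℝ → ℝ := fun t x => ω₀ x + ρ₀ x * P t x with hW
  have sW : ∀ n, Sm n W := fun n =>
    (Sm.of_contDiff (hω.contDiff n)).add ((Sm.of_contDiff (hρ.contDiff n)).mul (sP n))
  set ω : ℝ → ℝ → ℝ := fun t z => W t (A t z) with hωd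
  set ρ : ℝ → ℝ → ℝ := fun t z => ρ₀ (A t z) * Real.exp (-L t (A t z)) with hρd
  have sω : ∀ n, Sm n ω := fun n => (sW n).comp (sA n)
  have sρ : ∀ n, Sm n ρ := fun n =>
    ((Sm.of_contDiff (hρ.contDiff n)).comp (sA n)).mul ((sE n).comp (sA n))
  have hsA : ∀ t z, 1 < |z| → 1 < |A t z| := fun t z hz => hz.trans_le (hAabs t z)
  have hPpos : ∀ t x, 0 ≤ P t x := fun t x =>
    intervalIntegral.integral_nonneg (clamp_mem hT t).1 fun _ _ => (Real.exp_pos _).le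
  have eω : IsEvolution T ω := by
    refine ⟨sω, fun t => ?_, fun t z => ?_, fun t z hz => ?_, fun t z hz => ?_⟩
    · ext z; simp only [hωd, hW, hP, hAc, clamp_clamp hT]
    · simp only [hωd, hW, hP]
      rw [hAodd, hω.odd, hρ.odd]
      simp only [hLeven _ _]
      ring
    · simp only [hωd, hW, hω.supp _ (hsA t z hz), hρ.supp _ (hsA t z hz)]; ring
    · exact add_nonneg (hω.nonneg _ (hApos t z hz))
        (mul_nonneg (hρ.nonneg _ (hApos t z hz)) (hPpos _ _))
  have eρ : IsEvolution T ρ := by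
    refine ⟨sρ, fun t => ?_, fun t z => ?_, fun t z hz => ?_, fun t z hz => ?_⟩
    · ext z; simp only [hρd, hAc, hLc]
    · simp only [hρd]
      rw [hAodd, hρ.odd, hLeven]
      ring
    · simp only [hρd, hρ.supp _ (hsA t z hz)]; ring
    · exact mul_nonneg (hρ.nonneg _ (hApos t z hz)) (Real.exp_pos _).le
  have hω0 : ω 0 = ω₀ := by ext z; simp [hωd, hW, hP, hA0, hc0]
  have hρ0 : ρ 0 = ρ₀ := by ext z; simp [hρd, hA0, hL0]
  have hAt : ∀ t ∈ Icc 0 T, ∀ z, HasDerivWithinAt (fun s => A s z)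
      (-(v t z * Real.exp (-L t (A t z)))) (Icc 0 T) t := fun t ht z => by
    have := h.hasDerivWithinAt_inv hT hv1 hB hK ht z
    rwa [(hAx t z).deriv] at this
  refine ⟨ω, ρ, eω, eρ, hω0, hρ0, ?_, ?_⟩
  · intro t ht z
    have hd : ∀ t ∈ Icc 0 T, HasDerivWithinAt (fun s => ω s z) (ρ t z - v t z * deriv (ω t) z)
        (Icc 0 T) t := by
      intro t ht
      have hWx : HasDerivAt (W t) (deriv (W t) (A t z)) (A t z) := (sW 1).hasDerivAt t (A t z)
      have hωx : deriv (ω t) z = deriv (W t) (A t z) * Real.exp (-L t (A t z)) :=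
        (hWx.comp z (hAx t z)).deriv
      have h1 : HasDerivWithinAt (fun r => W t (A r z)) (deriv (W t) (A t z) *
          -(v t z * Real.exp (-L t (A t z)))) (Icc 0 T) t :=
        HasDerivAt.comp_hasDerivWithinAt (h₂ := W t) (h := fun r => A r z) t hWx (hAt t ht z)
      have hkc : Continuous fun p : ℝ × ℝ => ρ₀ (A p.2 z) * Real.exp (-L p.1 (A p.2 z)) := by
        have c1 : Continuous fun p : ℝ × ℝ => A p.2 z :=
          ((sA 0).continuous_time z).comp continuous_snd
        have c2 : Continuous fun p : ℝ × ℝ => Real.exp (-L p.1 (A p.2 z)) :=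
          (sE 0).continuous.comp (continuous_fst.prodMk c1)
        exact (hρ.smooth.continuous.comp c1).mul c2
      have h2 := (hasDerivAt_diagonal_integral (h := fun s r => ρ₀ (A r z) * Real.exp (-L s (A r z)))
        hkc t).hasDerivWithinAt (s := Icc 0 T)
      have h3 := h1.add h2
      have heq : ∀ r ∈ Icc 0 T, ω r z
          = W t (A r z) + ∫ s in t..r, ρ₀ (A r z) * Real.exp (-L s (A r z)) := by
        intro r hr
        simp only [hωd, hW, hP, clamp_of_mem hr, clamp_of_mem ht,
          intervalIntegral.integral_const_mul]
        have hec : Continuous fun s => Real.exp (-L s (A r z)) := (sE 0).continuous_time _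
        rw [← intervalIntegral.integral_add_adjacent_intervals
          (hec.intervalIntegrable 0 t) (hec.intervalIntegrable (μ := volume) t r)]
        ring
      refine (h3.congr heq (heq t ht)).congr_deriv ?_
      rw [hωx]
      simp only [hρd]
      ring
    refine eq_integral_of_hasDerivWithinAt (f := fun s => ω s z) ?_ hd ht
    exact (((sρ 0).continuous_time z).sub
      (((hv 0).continuous_time z).mul ((sω 1).deriv.continuous_time z))).continuousOn
  · intro t ht z
    -- The conservation law for ρ is obtained by differentiating θ_t = -vρ in space, where θ is the
    -- transported primitive of ρ₀. This avoids a time derivative of the Jacobian at the moving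
    -- starting point.
    set θ : ℝ → ℝ → ℝ := fun t z => ∫ y in (0 : ℝ)..A t z, ρ₀ y with hθ
    have hθd : ∀ y, HasDerivAt (fun x => ∫ y in (0 : ℝ)..x, ρ₀ y) (ρ₀ y) y :=
      hasDerivAt_primitive hρ.smooth.continuous
    have hθx : ∀ t z, HasDerivAt (θ t) (ρ t z) z := fun t z => (hθd (A t z)).comp z (hAx t z)
    have svρ : ∀ n, Sm n fun s y => v s y * ρ s y := fun n => (hv n).mul (sρ n)
    have hθt : ∀ z, θ t z = θ 0 z + ∫ s in (0 : ℝ)..t, -(v s z * ρ s z) := by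
      intro z
      refine eq_integral_of_hasDerivWithinAt (f := fun s => θ s z) (T := T) ?_ (fun r hr => ?_) ht
      · exact ((svρ 0).continuous_time z).neg.continuousOn
      · refine ((hθd (A r z)).comp_hasDerivWithinAt r (hAt r hr z)).congr_deriv ?_
        simp only [hρd]
        ring
    have h1 := hθx t z
    have h2 := (hθx 0 z).add (hasDerivAt_integral_param (f := fun s y => -(v s y * ρ s y))
      (svρ 1).neg.continuous (svρ 1).neg.deriv.continuous
      (fun s y => (svρ 1).neg.hasDerivAt s y) 0 t z)
    have h3 : θ t = fun z => θ 0 z + ∫ s in (0 : ℝ)..t, -(v s z * ρ s z) := funext hθt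
    rw [h3] at h1
    have := h1.unique h2
    simpa only [deriv.fun_neg] using this

/-! ### Cauchy–Schwarz, Poincaré and Sobolev inequalities on [-1,1] -/

section Nsq

variable {f g h : ℝ → ℝ}

/-- The discriminant of the nonnegative quadratic l ↦ ∫ (l f + g)² is nonpositive. -/
lemma sq_integral_mul_le {a b : ℝ} (hab : a ≤ b) (hf : Continuous f) (hg : Continuous g) :
    (∫ x in a..b, f x * g x) ^ 2 ≤ (∫ x in a..b, f x ^ 2) * ∫ x in a..b, g x ^ 2 := by
  have h : ∀ l : ℝ, 0 ≤ (∫ x in a..b, f x ^ 2) * (l * l) + (2 * ∫ x in a..b, f x * g x) * l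
      + ∫ x in a..b, g x ^ 2 := by
    intro l
    have h0 : 0 ≤ ∫ x in a..b, (l * f x + g x) ^ 2 :=
      intervalIntegral.integral_nonneg hab fun _ _ => sq_nonneg _
    have e : ∀ x, (l * f x + g x) ^ 2 = l * l * f x ^ 2 + (2 * l) * (f x * g x) + g x ^ 2 :=
      fun x => by ring
    simp only [e] at h0
    rw [intervalIntegral.integral_add (by apply Continuous.intervalIntegrable; fun_prop)
      (by apply Continuous.intervalIntegrable; fun_prop),
      intervalIntegral.integral_add (by apply Continuous.intervalIntegrable; fun_prop)
      (by apply Continuous.intervalIntegrable; fun_prop), intervalIntegral.integral_const_mul,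
      intervalIntegral.integral_const_mul] at h0
    linarith
  have := discrim_le_zero h
  rw [discrim] at this
  nlinarith

lemma nsq_le_of_sq_le (hf : Continuous f) {C : ℝ} (h : ∀ x ∈ Icc (-1 : ℝ) 1, f x ^ 2 ≤ C) :
    nsq f ≤ 2 * C := by
  have := intervalIntegral.integral_mono_on (μ := volume) (show (-1 : ℝ) ≤ 1 by norm_num)
    ((hf.pow 2).intervalIntegrable _ _) (intervalIntegrable_const (c := C)) h
  rw [intervalIntegral.integral_const] at this
  norm_num at this
  exact this

lemma nsq_mul_le (hf : Continuous f) (hg : Continuous g) {C : ℝ}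
    (h : ∀ x ∈ Icc (-1 : ℝ) 1, f x ^ 2 ≤ C) : nsq (fun x => f x * g x) ≤ C * nsq g := by
  unfold nsq
  rw [← intervalIntegral.integral_const_mul]
  refine intervalIntegral.integral_mono_on (by norm_num) ?_ ?_ fun x hx => ?_
  · apply Continuous.intervalIntegrable; fun_prop
  · apply Continuous.intervalIntegrable; fun_prop
  · rw [mul_pow]; exact mul_le_mul_of_nonneg_right (h x hx) (sq_nonneg _)

lemma two_integral_mul_le (hf : Continuous f) (hg : Continuous g) :
    |2 * ∫ x in (-1 : ℝ)..1, f x * g x| ≤ nsq f + nsq g := by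
  have h1 : 0 ≤ ∫ x in (-1 : ℝ)..1, (f x - g x) ^ 2 :=
    intervalIntegral.integral_nonneg (by norm_num) fun _ _ => sq_nonneg _
  have h2 : 0 ≤ ∫ x in (-1 : ℝ)..1, (f x + g x) ^ 2 :=
    intervalIntegral.integral_nonneg (by norm_num) fun _ _ => sq_nonneg _
  have e1 : ∀ x, (f x - g x) ^ 2 = f x ^ 2 + g x ^ 2 - 2 * (f x * g x) := fun x => by ring
  have e2 : ∀ x, (f x + g x) ^ 2 = f x ^ 2 + g x ^ 2 + 2 * (f x * g x) := fun x => by ring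
  simp only [e1] at h1
  simp only [e2] at h2
  rw [intervalIntegral.integral_sub (by apply Continuous.intervalIntegrable; fun_prop)
    (by apply Continuous.intervalIntegrable; fun_prop),
    intervalIntegral.integral_add (by apply Continuous.intervalIntegrable; fun_prop)
    (by apply Continuous.intervalIntegrable; fun_prop), intervalIntegral.integral_const_mul] at h1
  rw [intervalIntegral.integral_add (by apply Continuous.intervalIntegrable; fun_prop)
    (by apply Continuous.intervalIntegrable; fun_prop),
    intervalIntegral.integral_add (by apply Continuous.intervalIntegrable; fun_prop)
    (by apply Continuous.intervalIntegrable; fun_prop), intervalIntegral.integral_const_mul] at h2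
  unfold nsq
  rw [abs_le]
  constructor <;> linarith

lemma abs_integral_sq_mul_le (hf : Continuous f) {b : ℝ}
    (hb : ∀ x ∈ Icc (-1 : ℝ) 1, |g x| ≤ b) :
    |∫ x in (-1 : ℝ)..1, g x * f x ^ 2| ≤ b * nsq f := by
  unfold nsq
  rw [← intervalIntegral.integral_const_mul, ← Real.norm_eq_abs]
  refine intervalIntegral.norm_integral_le_of_norm_le (by norm_num) (ae_of_all _ fun x hx => ?_)
    (by apply Continuous.intervalIntegrable; fun_prop)
  rw [norm_mul, norm_pow, Real.norm_eq_abs, Real.norm_eq_abs, sq_abs]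
  exact mul_le_mul_of_nonneg_right (hb x (Ioc_subset_Icc_self hx)) (sq_nonneg _)

lemma sq_sub_le_nsq_deriv (hf : ContDiff ℝ 1 f) {x y : ℝ} (hx : x ∈ Icc (-1 : ℝ) 1)
    (hy : y ∈ Icc (-1 : ℝ) 1) : (f x - f y) ^ 2 ≤ |x - y| * nsq (deriv f) := by
  have hf' : Continuous (deriv f) := hf.continuous_deriv le_rfl
  wlog hxy : y ≤ x generalizing x y
  · have := this hy hx (le_of_not_ge hxy)
    rw [abs_sub_comm]
    nlinarith
  have h1 : f x - f y = ∫ s in y..x, 1 * deriv f s := by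
    simp only [one_mul]
    exact (intervalIntegral.integral_deriv_eq_sub
      (fun s _ => hf.differentiable (by norm_num) s) (hf'.intervalIntegrable _ _)).symm
  rw [h1]
  refine (sq_integral_mul_le hxy continuous_const hf').trans ?_
  simp only [one_pow, intervalIntegral.integral_const, smul_eq_mul, mul_one]
  rw [abs_of_nonneg (sub_nonneg.2 hxy)]
  refine mul_le_mul_of_nonneg_left ?_ (sub_nonneg.2 hxy)
  exact intervalIntegral.integral_mono_interval hy.1 hxy hx.2
    (ae_of_all _ fun _ => sq_nonneg _) ((hf'.pow 2).intervalIntegrable _ _)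

lemma sq_le_two_nsq_deriv (hf : ContDiff ℝ 1 f) (hs : ∀ x, 1 < |x| → f x = 0) (x : ℝ) :
    f x ^ 2 ≤ 2 * nsq (deriv f) := by
  by_cases hx : 1 < |x|
  · rw [hs x hx]
    have := nsq_nonneg (deriv f)
    nlinarith
  · have hx' := abs_le.1 (not_lt.1 hx)
    have h := sq_sub_le_nsq_deriv hf (x := x) (y := -1) hx' (by norm_num)
    rw [eq_zero_of_abs_le hf.continuous hs (x := -1) (by simp), sub_zero] at h
    refine h.trans (mul_le_mul_of_nonneg_right ?_ (nsq_nonneg _))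
    rw [abs_of_nonneg (by linarith [hx'.1])]
    linarith [hx'.2]

lemma nsq_le_four_nsq_deriv (hf : ContDiff ℝ 1 f) (hs : ∀ x, 1 < |x| → f x = 0) :
    nsq f ≤ 4 * nsq (deriv f) := by
  have := nsq_le_of_sq_le hf.continuous fun x _ => sq_le_two_nsq_deriv hf hs x
  linarith

lemma nsq_le_two_nsq_deriv_of_zero (hf : ContDiff ℝ 1 f) (h0 : f 0 = 0) :
    nsq f ≤ 2 * nsq (deriv f) := by
  refine nsq_le_of_sq_le hf.continuous fun x hx => ?_
  have h := sq_sub_le_nsq_deriv hf hx (y := 0) (by norm_num)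
  rw [h0, sub_zero, sub_zero] at h
  have h1 : |x| ≤ 1 := abs_le.2 hx
  nlinarith [nsq_nonneg (deriv f)]

/-- No boundary condition is imposed, since the velocity gradient need not vanish at ±1: f(x)² is
compared with f(y)² and the result averaged over y. -/
lemma sq_le_sobolev (hf : ContDiff ℝ 1 f) {x : ℝ} (hx : x ∈ Icc (-1 : ℝ) 1) :
    f x ^ 2 ≤ nsq f + 4 * nsq (deriv f) := by
  have h : ∀ y ∈ Icc (-1 : ℝ) 1, f x ^ 2 ≤ 2 * f y ^ 2 + 4 * nsq (deriv f) := by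
    intro y hy
    have h1 := sq_sub_le_nsq_deriv hf hx hy
    have h2 : |x - y| ≤ 2 := abs_le.2 ⟨by linarith [hx.1, hy.2], by linarith [hx.2, hy.1]⟩
    nlinarith [nsq_nonneg (deriv f), sq_nonneg (f x - 2 * f y)]
  have hc := hf.continuous
  have := intervalIntegral.integral_mono_on (μ := volume) (show (-1 : ℝ) ≤ 1 by norm_num)
    (intervalIntegrable_const (c := f x ^ 2)) (by apply Continuous.intervalIntegrable; fun_prop) h
  rw [intervalIntegral.integral_add (by apply Continuous.intervalIntegrable; fun_prop) (by simp),
    intervalIntegral.integral_const, intervalIntegral.integral_const,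
    intervalIntegral.integral_const_mul] at this
  norm_num at this
  unfold nsq at *
  linarith

lemma nsq_iteratedDeriv_le (hf : ContDiff ℝ (⊤ : ℕ∞) f) (hs : ∀ x, 1 < |x| → f x = 0) (j m : ℕ) :
    nsq (iteratedDeriv j f) ≤ 4 ^ m * nsq (iteratedDeriv (j + m) f) := by
  induction m with
  | zero => simp
  | succ m ih =>
    have h1 : ContDiff ℝ 1 (iteratedDeriv (j + m) f) := by
      rw [iteratedDeriv_eq_iterate]
      exact ContDiff.iterate_deriv' 1 (j + m) (hf.of_le (by exact_mod_cast le_top))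
    have h2 := nsq_le_four_nsq_deriv h1 (iteratedDeriv_eq_zero_of_supp hs (j + m))
    rw [← iteratedDeriv_succ] at h2
    refine ih.trans ?_
    rw [pow_succ, mul_assoc, ← add_assoc]
    exact mul_le_mul_of_nonneg_left h2 (by positivity)

end Nsq

/-! ### Gronwall inequalities -/

section Gronwall

variable {T : ℝ} {y y' : ℝ → ℝ}

lemma le_mul_exp_of_deriv_le {κ : ℝ → ℝ} (hκ : Continuous κ)
    (hd : ∀ t ∈ Icc 0 T, HasDerivWithinAt y (y' t) (Icc 0 T) t)
    (hle : ∀ t ∈ Icc 0 T, y' t ≤ κ t * y t) {t : ℝ} (ht : t ∈ Icc 0 T) :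
    y t ≤ y 0 * Real.exp (∫ s in (0 : ℝ)..t, κ s) := by
  set Q : ℝ → ℝ := fun t => ∫ s in (0 : ℝ)..t, κ s with hQ
  have hd' : ∀ t ∈ Icc 0 T, HasDerivWithinAt (fun t => y t * Real.exp (-Q t))
      ((y' t - κ t * y t) * Real.exp (-Q t)) (Icc 0 T) t := by
    intro t ht
    have := (hd t ht).mul ((hasDerivAt_primitive hκ t).neg.exp.hasDerivWithinAt)
    refine this.congr_deriv ?_
    simp only [Pi.neg_apply]
    ring
  have hanti := antitoneOn_of_hasDerivWithinAt_nonpos (convex_Icc 0 T)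
    (fun s hs => (hd' s hs).continuousWithinAt)
    (fun s hs => (hd' s (interior_subset hs)).mono interior_subset)
    fun s hs => mul_nonpos_of_nonpos_of_nonneg (by linarith [hle s (interior_subset hs)])
      (Real.exp_pos _).le
  have := hanti ⟨le_rfl, ht.1.trans ht.2⟩ ht ht.1
  simp only [hQ, intervalIntegral.integral_same, neg_zero, Real.exp_zero, mul_one] at this
  rw [Real.exp_neg, ← div_eq_mul_inv, div_le_iff₀ (Real.exp_pos _)] at this
  exact this

/-- A exp((1+m)Ct) solves z' = Cz + C·m·z exactly, so it is a supersolution when the source is at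
most m times it. With m = 1 a bound passes unchanged from one iterate to the next; with m = 2 it is
halved. -/
lemma le_of_deriv_le_add {C A m : ℝ} {g : ℝ → ℝ} (hC : 0 ≤ C)
    (hd : ∀ t ∈ Icc 0 T, HasDerivWithinAt y (y' t) (Icc 0 T) t)
    (hle : ∀ t ∈ Icc 0 T, y' t ≤ C * y t + C * g t)
    (hg : ∀ t ∈ Icc 0 T, g t ≤ m * A * Real.exp ((1 + m) * C * t)) (h0 : y 0 ≤ A) {t : ℝ}
    (ht : t ∈ Icc 0 T) : y t ≤ A * Real.exp ((1 + m) * C * t) := by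
  have he : ∀ t, HasDerivAt (fun t => A * Real.exp ((1 + m) * C * t))
      (A * (Real.exp ((1 + m) * C * t) * ((1 + m) * C))) t := fun t => by
    have := ((hasDerivAt_id t).const_mul ((1 + m) * C)).exp.const_mul A
    simpa using this
  have := le_mul_exp_of_deriv_le (T := T) (y := fun t => y t - A * Real.exp ((1 + m) * C * t))
    (κ := fun _ => C) continuous_const (fun t ht => (hd t ht).sub (he t).hasDerivWithinAt)
    (fun t ht => ?_) ht
  · simp only [mul_zero, Real.exp_zero, mul_one] at this
    have h2 := Real.exp_pos (∫ s in (0 : ℝ)..t, C)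
    nlinarith
  · have h1 := hle t ht
    have h2 := mul_le_mul_of_nonneg_left (hg t ht) hC
    nlinarith

end Gronwall

/-! ### Energy estimates for the transport equations -/

section Energy

variable {T : ℝ}

lemma hasDerivWithinAt_of_integral_eq {f F : ℝ → ℝ → ℝ} (hF : Sm 0 F)
    (h : ∀ t ∈ Icc 0 T, ∀ x, f t x = f 0 x + ∫ s in (0 : ℝ)..t, F s x) {t : ℝ} (ht : t ∈ Icc 0 T)
    (x : ℝ) : HasDerivWithinAt (fun s => f s x) (F t x) (Icc 0 T) t :=
  hasDerivWithinAt_of_eq_integral (hF.continuous_time x) (fun t ht => h t ht x) ht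

lemma hasDerivWithinAt_space_integral {f F : ℝ → ℝ → ℝ} (hf : Sm 0 f) (hF : Sm 0 F)
    (h : ∀ t ∈ Icc 0 T, ∀ x, f t x = f 0 x + ∫ s in (0 : ℝ)..t, F s x) (a b : ℝ) {t : ℝ}
    (ht : t ∈ Icc 0 T) :
    HasDerivWithinAt (fun s => ∫ x in a..b, f s x) (∫ x in a..b, F t x) (Icc 0 T) t := by
  have hFc : Continuous fun p : ℝ × ℝ => F p.1 p.2 := hF
  have hd := hasDerivAt_integral_param (f := fun x r => f 0 x + ∫ s in (0 : ℝ)..r, F s x)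
    (f' := fun x r => F r x) ?_ ?_ (fun x r => ?_) a b t
  · exact hd.hasDerivWithinAt.congr (fun r hr => by simp only [h r hr]) (by simp only [h t ht])
  · refine ((hf.continuous_space 0).comp continuous_fst).add ?_
    exact intervalIntegral.continuous_parametric_intervalIntegral_of_continuous
      (f := fun (p : ℝ × ℝ) s => F s p.1)
      (hFc.comp (by fun_prop : Continuous fun q : (ℝ × ℝ) × ℝ => (q.2, q.1.1))) continuous_snd
  · exact hFc.comp (by fun_prop : Continuous fun p : ℝ × ℝ => (p.2, p.1))
  · exact (hasDerivAt_primitive (hF.continuous_time x) r).const_add _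

lemma hasDerivWithinAt_nsq {f F : ℝ → ℝ → ℝ} (hf : Sm 0 f) (hF : Sm 0 F)
    (h : ∀ t ∈ Icc 0 T, ∀ x, f t x = f 0 x + ∫ s in (0 : ℝ)..t, F s x) {t : ℝ} (ht : t ∈ Icc 0 T) :
    HasDerivWithinAt (fun s => nsq (f s)) (2 * ∫ x in (-1 : ℝ)..1, f t x * F t x) (Icc 0 T) t := by
  have hfF : Sm 0 fun t x => 2 * (f t x * F t x) := (Sm.const 2).mul (hf.mul hF)
  have hsq : Sm 0 fun t x => f t x ^ 2 := by
    simpa only [sq] using hf.mul hf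
  have := hasDerivWithinAt_space_integral (T := T) hsq hfF (fun t ht x => ?_) (-1) 1 ht
  · rwa [intervalIntegral.integral_const_mul] at this
  · refine eq_integral_of_hasDerivWithinAt (f := fun s => f s x ^ 2) (T := T)
      (g := fun s => 2 * (f s x * F s x)) (hfF.continuous_time x).continuousOn (fun s hs => ?_) ht
    refine ((hasDerivWithinAt_of_integral_eq hF h hs x).pow 2).congr_deriv ?_
    simp only [Nat.cast_ofNat, Nat.add_one_sub_one, pow_one]
    ring

/-- The energy identity for `f_t + v f_x = g`. -/
lemma two_integral_transport_le {f g v : ℝ → ℝ} (hf : ContDiff ℝ 1 f) (hg : Continuous g)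
    (hv : ContDiff ℝ 1 v) (hs : ∀ x, 1 < |x| → f x = 0) {b : ℝ}
    (hb : ∀ x ∈ Icc (-1 : ℝ) 1, |deriv v x| ≤ b) :
    2 * ∫ x in (-1 : ℝ)..1, f x * (g x - v x * deriv f x)
      ≤ b * nsq f + 2 * ∫ x in (-1 : ℝ)..1, f x * g x := by
  have hf' : Continuous (deriv f) := hf.continuous_deriv le_rfl
  have hv' : Continuous (deriv v) := hv.continuous_deriv le_rfl
  have hfc := hf.continuous
  have hvc := hv.continuous
  have h1 : f 1 = 0 := eq_zero_of_abs_le hfc hs (by simp)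
  have h2 : f (-1) = 0 := eq_zero_of_abs_le hfc hs (by simp)
  have hibp := intervalIntegral.integral_mul_deriv_eq_deriv_mul (a := -1) (b := 1) (u := v)
    (v := fun x => f x ^ 2) (u' := deriv v) (v' := fun x => 2 * f x * deriv f x)
    (fun x _ => (hv.differentiable (by norm_num) x).hasDerivAt)
    (fun x _ => by
      have := ((hf.differentiable (by norm_num) x).hasDerivAt).pow 2
      exact this.congr_deriv (by simp))
    (hv'.intervalIntegrable _ _) (by apply Continuous.intervalIntegrable; fun_prop)
  rw [h1, h2] at hibp
  have hle := (le_abs_self _).trans (abs_integral_sq_mul_le hfc hb)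
  have e : ∀ x, f x * (g x - v x * deriv f x) = f x * g x - 1 / 2 * (v x * (2 * f x * deriv f x)) :=
    fun x => by ring
  simp only [e]
  rw [intervalIntegral.integral_sub (by apply Continuous.intervalIntegrable; fun_prop)
    (by apply Continuous.intervalIntegrable; fun_prop), intervalIntegral.integral_const_mul, hibp]
  linarith

/-- The integrated form of the equations is stable under spatial differentiation, so mixed
derivatives in t and x never have to be interchanged. -/
lemma iteratedDeriv_integral_eq {f F : ℝ → ℝ → ℝ} (hf : ∀ n, Sm n f) (hF : ∀ n, Sm n F)
    (h : ∀ t ∈ Icc 0 T, ∀ x, f t x = f 0 x + ∫ s in (0 : ℝ)..t, F s x) (k : ℕ) :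
    ∀ t ∈ Icc 0 T, ∀ x, iteratedDeriv k (f t) x
      = iteratedDeriv k (f 0) x + ∫ s in (0 : ℝ)..t, iteratedDeriv k (F s) x := by
  induction k generalizing f F with
  | zero => simpa using h
  | succ k ih =>
    simp only [iteratedDeriv_succ']
    refine ih (f := fun t => deriv (f t)) (F := fun t => deriv (F t)) (fun n => (hf (n + 1)).deriv)
      (fun n => (hF (n + 1)).deriv) fun t ht x => ?_
    have h1 := ((hf 1).hasDerivAt 0 x).add (hasDerivAt_integral_param (hF 1).continuous
      (hF 1).deriv.continuous (hF 1).hasDerivAt 0 t x)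
    have h2 : f t = fun x => f 0 x + ∫ s in (0 : ℝ)..t, F s x := funext (h t ht)
    rw [h2]
    exact h1.deriv

end Energy

lemma contDiff_iteratedDeriv {f : ℝ → ℝ} (hf : ContDiff ℝ (⊤ : ℕ∞) f) (k : ℕ) :
    ContDiff ℝ (⊤ : ℕ∞) (iteratedDeriv k f) := by
  rw [iteratedDeriv_eq_iterate]
  exact ContDiff.iterate_deriv (n := k) hf

lemma contDiff_top_of_sm {f : ℝ → ℝ → ℝ} (hf : ∀ n, Sm n f) (t : ℝ) : ContDiff ℝ (⊤ : ℕ∞) (f t) :=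
  contDiff_infty.2 fun n => (hf n).contDiff t

lemma contDiff_of_top {f : ℝ → ℝ} (hf : ContDiff ℝ (⊤ : ℕ∞) f) (n : ℕ) : ContDiff ℝ n f :=
  hf.of_le (by exact_mod_cast le_top)

lemma iteratedDeriv_mul_eq {w h : ℝ → ℝ} (hw : ContDiff ℝ (⊤ : ℕ∞) w)
    (hh : ContDiff ℝ (⊤ : ℕ∞) h) (k : ℕ) (x : ℝ) :
    iteratedDeriv k (fun y => w y * h y) x = w x * iteratedDeriv k h x
      + ∑ i ∈ Finset.range k, (k.choose (i + 1) : ℝ) *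
        (iteratedDeriv (i + 1) w x * iteratedDeriv (k - (i + 1)) h x) := by
  rw [iteratedDeriv_fun_mul (contDiff_of_top hw k).contDiffAt (contDiff_of_top hh k).contDiffAt,
    Finset.sum_range_succ', add_comm]
  simp [mul_assoc]

lemma iteratedDeriv_mul_deriv_eq {w h : ℝ → ℝ} (hw : ContDiff ℝ (⊤ : ℕ∞) w)
    (hh : ContDiff ℝ (⊤ : ℕ∞) h) (k : ℕ) (x : ℝ) :
    iteratedDeriv k (fun y => w y * deriv h y) x = w x * iteratedDeriv (k + 1) h x
      + ∑ i ∈ Finset.range k, (k.choose (i + 1) : ℝ) *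
        (iteratedDeriv (i + 1) w x * iteratedDeriv (k - i) h x) := by
  have hh' : ContDiff ℝ (⊤ : ℕ∞) (deriv h) := by
    simpa using contDiff_iteratedDeriv hh 1
  rw [iteratedDeriv_mul_eq hw hh', ← iteratedDeriv_succ']
  congr 1
  refine Finset.sum_congr rfl fun i hi => ?_
  rw [← iteratedDeriv_succ']
  have := Finset.mem_range.1 hi
  rw [show k - (i + 1) + 1 = k - i by omega]

/-- A middle term of the commutator. -/
lemma abs_two_integral_commutator_le {w h : ℝ → ℝ} (hw : ContDiff ℝ (⊤ : ℕ∞) w)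
    (hh : ContDiff ℝ (⊤ : ℕ∞) h) (hs : ∀ x, 1 < |x| → h x = 0) {k i : ℕ} (hi : i < k) {b S : ℝ}
    (hb0 : 0 ≤ b) (hS0 : 0 ≤ S) (hb : ∀ x ∈ Icc (-1 : ℝ) 1, |deriv w x| ≤ b)
    (hS : 1 ≤ i → nsq (iteratedDeriv (i + 1) w) ≤ S) :
    |2 * ∫ x in (-1 : ℝ)..1, iteratedDeriv k h x *
        (iteratedDeriv (i + 1) w x * iteratedDeriv (k - i) h x)|
      ≤ 2 * 4 ^ k * (1 + b + S) * nsq (iteratedDeriv k h) := by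
  have hn := nsq_nonneg (iteratedDeriv k h)
  have cw := (contDiff_iteratedDeriv hw (i + 1)).continuous
  have ch := fun j => (contDiff_iteratedDeriv hh j).continuous
  have h4 : (1 : ℝ) ≤ 4 ^ k := one_le_pow₀ (by norm_num)
  rcases Nat.eq_zero_or_pos i with rfl | hi0
  · have e : ∀ x, iteratedDeriv k h x * (iteratedDeriv (0 + 1) w x * iteratedDeriv (k - 0) h x)
        = deriv w x * iteratedDeriv k h x ^ 2 := fun x => by simp; ring
    simp only [e]
    have := abs_integral_sq_mul_le (ch k) hb
    rw [abs_mul, abs_of_pos (by norm_num : (0 : ℝ) < 2)]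
    nlinarith [mul_nonneg hb0 hn, mul_nonneg hS0 hn,
      mul_le_mul_of_nonneg_right h4 (mul_nonneg (by positivity : 0 ≤ 1 + b + S) hn)]
  · have h1 := two_integral_mul_le (ch k)
      (show Continuous fun x => iteratedDeriv (i + 1) w x * iteratedDeriv (k - i) h x from
        cw.mul (ch (k - i)))
    refine h1.trans ?_
    -- For i ≥ 1 the lower-order factor h^(k-i) is taken in the supremum norm, at the price of one
    -- more derivative, and w^(i+1) in L². For i = 0 the roles were reversed.
    have h2 : ∀ x ∈ Icc (-1 : ℝ) 1, iteratedDeriv (k - i) h x ^ 2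
        ≤ 2 * (4 ^ (i - 1) * nsq (iteratedDeriv k h)) := by
      intro x _
      refine (sq_le_two_nsq_deriv (contDiff_of_top (contDiff_iteratedDeriv hh (k - i)) 1)
        (iteratedDeriv_eq_zero_of_supp hs _) x).trans ?_
      have := nsq_iteratedDeriv_le hh hs (k - i + 1) (i - 1)
      rw [show k - i + 1 + (i - 1) = k by omega] at this
      rw [← iteratedDeriv_succ]
      linarith
    have h3 : nsq (fun x => iteratedDeriv (i + 1) w x * iteratedDeriv (k - i) h x)
        ≤ 2 * (4 ^ (i - 1) * nsq (iteratedDeriv k h)) * S := by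
      have := nsq_mul_le (ch (k - i)) cw h2
      simp only [mul_comm (iteratedDeriv (i + 1) w _)]
      exact this.trans (mul_le_mul_of_nonneg_left (hS hi0) (by positivity))
    have h5 : (4 : ℝ) ^ (i - 1) ≤ 4 ^ k := pow_le_pow_right₀ (by norm_num) (by omega)
    have h6 := mul_le_mul_of_nonneg_right h5 (mul_nonneg hS0 hn)
    nlinarith [mul_nonneg hb0 hn, mul_nonneg hS0 hn,
      mul_le_mul_of_nonneg_right h4 hn, mul_le_mul_of_nonneg_right h4 (mul_nonneg hb0 hn)]

lemma integral_mul_sub_of_continuous {f g h : ℝ → ℝ} (hf : Continuous f) (hg : Continuous g)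
    (hh : Continuous h) (a b : ℝ) :
    ∫ x in a..b, f x * (g x - h x) = (∫ x in a..b, f x * g x) - ∫ x in a..b, f x * h x := by
  rw [← intervalIntegral.integral_sub (by apply Continuous.intervalIntegrable; fun_prop)
    (by apply Continuous.intervalIntegrable; fun_prop)]
  simp only [mul_sub]

lemma two_integral_mul_sum {f : ℝ → ℝ} {N : ℕ} {c : ℕ → ℝ} {q : ℕ → ℝ → ℝ} (hf : Continuous f)
    (hq : ∀ i, Continuous (q i)) :
    2 * ∫ x in (-1 : ℝ)..1, f x * ∑ i ∈ Finset.range N, c i * q i x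
      = ∑ i ∈ Finset.range N, c i * (2 * ∫ x in (-1 : ℝ)..1, f x * q i x) := by
  have e : ∀ x, f x * ∑ i ∈ Finset.range N, c i * q i x
      = ∑ i ∈ Finset.range N, c i * (f x * q i x) := fun x => by
    rw [Finset.mul_sum]
    exact Finset.sum_congr rfl fun i _ => by ring
  simp only [e]
  rw [intervalIntegral.integral_finsetSum fun i _ => by
    apply Continuous.intervalIntegrable; have := hq i; fun_prop]
  rw [Finset.mul_sum]
  refine Finset.sum_congr rfl fun i _ => ?_
  rw [intervalIntegral.integral_const_mul]
  ring

lemma abs_sum_choose_le {k N : ℕ} (hN : N ≤ k) {a : ℕ → ℝ} {D : ℝ} (hD : 0 ≤ D)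
    (ha : ∀ i < N, |a i| ≤ D) :
    |∑ i ∈ Finset.range N, (k.choose (i + 1) : ℝ) * a i| ≤ 2 ^ k * D := by
  have h1 : ∑ i ∈ Finset.range N, (k.choose (i + 1) : ℝ) ≤ 2 ^ k := by
    have h2 : ∑ i ∈ Finset.range N, (k.choose (i + 1) : ℝ)
        ≤ ∑ i ∈ Finset.range k, (k.choose (i + 1) : ℝ) :=
      Finset.sum_le_sum_of_subset_of_nonneg (Finset.range_mono hN) fun _ _ _ => by positivity
    have h3 : (∑ i ∈ Finset.range (k + 1), (k.choose i : ℝ)) = 2 ^ k := by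
      exact_mod_cast Nat.sum_range_choose k
    rw [Finset.sum_range_succ'] at h3
    have h4 : (0 : ℝ) ≤ (k.choose 0 : ℝ) := by positivity
    linarith
  refine (Finset.abs_sum_le_sum_abs _ _).trans ?_
  calc ∑ i ∈ Finset.range N, |(k.choose (i + 1) : ℝ) * a i|
      ≤ ∑ i ∈ Finset.range N, (k.choose (i + 1) : ℝ) * D := by
        refine Finset.sum_le_sum fun i hi => ?_
        rw [abs_mul, Nat.abs_cast]
        exact mul_le_mul_of_nonneg_left (ha i (Finset.mem_range.1 hi)) (by positivity)
    _ = (∑ i ∈ Finset.range N, (k.choose (i + 1) : ℝ)) * D := by rw [Finset.sum_mul]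
    _ ≤ 2 ^ k * D := mul_le_mul_of_nonneg_right h1 hD

/-- The sum of the squared `L²` norms of the `k`-th derivatives. -/
noncomputable def energy (k : ℕ) (f g : ℝ → ℝ) : ℝ :=
  nsq (iteratedDeriv k f) + nsq (iteratedDeriv k g)

lemma energy_nonneg (k : ℕ) (f g : ℝ → ℝ) : 0 ≤ energy k f g :=
  add_nonneg (nsq_nonneg _) (nsq_nonneg _)

/-- The energy inequality for the `k`-th derivatives. -/
theorem energy_inequality (k : ℕ) {T : ℝ} {v ω ρ : ℝ → ℝ → ℝ} (hv : ∀ n, Sm n v)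
    (hω : IsEvolution T ω) (hρ : IsEvolution T ρ) (htr : IsTransported T v ω ρ) :
    ∃ Y' : ℝ → ℝ, ∀ t ∈ Icc 0 T,
      HasDerivWithinAt (fun s => energy k (ω s) (ρ s)) (Y' t) (Icc 0 T) t ∧
      ∀ b S R Z : ℝ, 0 ≤ b → 0 ≤ S → (∀ x ∈ Icc (-1 : ℝ) 1, |deriv (v t) x| ≤ b) →
        (∀ i, 1 ≤ i → i < k → nsq (iteratedDeriv (i + 1) (v t)) ≤ S) →
        nsq (iteratedDeriv (k + 1) (v t)) ≤ Z → (∀ x ∈ Icc (-1 : ℝ) 1, ρ t x ^ 2 ≤ R) →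
        (1 ≤ k) →
        Y' t ≤ (2 ^ (k + 2) * (2 * 4 ^ k) + 3) * (1 + b + S) * energy k (ω t) (ρ t) + R * Z := by
  have svω : ∀ n, Sm n fun s x => v s x * deriv (ω s) x := fun n =>
    (hv n).mul (hω.sm (n + 1)).deriv
  have svρ : ∀ n, Sm n fun s x => v s x * ρ s x := fun n => (hv n).mul (hρ.sm n)
  have sF : ∀ n, Sm n fun s x => ρ s x - v s x * deriv (ω s) x := fun n => (hρ.sm n).sub (svω n)
  have sH : ∀ n, Sm n fun s x => -deriv (fun y => v s y * ρ s y) x := fun n =>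
    (svρ (n + 1)).deriv.neg
  have smk : ∀ {f : ℝ → ℝ → ℝ}, (∀ n, Sm n f) → Sm 0 fun t => iteratedDeriv k (f t) :=
    fun h => Sm.iteratedDeriv (h (0 + k))
  have eω := iteratedDeriv_integral_eq hω.sm sF htr.vorticity k
  have eρ := iteratedDeriv_integral_eq hρ.sm sH htr.density k
  refine ⟨_, fun t ht => ⟨(hasDerivWithinAt_nsq (smk hω.sm) (smk sF) eω ht).add
    (hasDerivWithinAt_nsq (smk hρ.sm) (smk sH) eρ ht), ?_⟩⟩
  intro b S R Z hb0 hS0 hb hS hZ hR hk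
  have dv := contDiff_top_of_sm hv t
  have dω := contDiff_top_of_sm hω.sm t
  have dρ := contDiff_top_of_sm hρ.sm t
  have cv := fun j => (contDiff_iteratedDeriv dv j).continuous
  have cω := fun j => (contDiff_iteratedDeriv dω j).continuous
  have cρ := fun j => (contDiff_iteratedDeriv dρ j).continuous
  have dω' : ContDiff ℝ (⊤ : ℕ∞) (deriv (ω t)) := by simpa using contDiff_iteratedDeriv dω 1
  set nω := nsq (iteratedDeriv k (ω t)) with hnω
  set nρ := nsq (iteratedDeriv k (ρ t)) with hnρ
  have hnω0 : 0 ≤ nω := nsq_nonneg _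
  have hnρ0 : 0 ≤ nρ := nsq_nonneg _
  set D := 2 * 4 ^ k * (1 + b + S) with hD
  have hD0 : 0 ≤ D := by positivity
  have iω : 2 * ∫ x in (-1 : ℝ)..1, iteratedDeriv k (ω t) x *
      iteratedDeriv k (fun x => ρ t x - v t x * deriv (ω t) x) x
      ≤ b * nω + (nω + nρ) + 2 ^ k * (D * nω) := by
    -- The term in which all derivatives fall on ω is kept as a transport term: after integration by
    -- parts it costs only sup|v_x|.
    have e : ∀ x, iteratedDeriv k (fun x => ρ t x - v t x * deriv (ω t) x) x
        = (iteratedDeriv k (ρ t) x - ∑ i ∈ Finset.range k, (k.choose (i + 1) : ℝ) *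
          (iteratedDeriv (i + 1) (v t) x * iteratedDeriv (k - i) (ω t) x))
          - v t x * deriv (iteratedDeriv k (ω t)) x := fun x => by
      rw [iteratedDeriv_fun_sub (contDiff_of_top dρ k).contDiffAt
        (contDiff_of_top (dv.mul dω') k).contDiffAt, iteratedDeriv_mul_deriv_eq dv dω,
        ← iteratedDeriv_succ]
      ring
    simp only [e]
    have csum : Continuous fun x => ∑ i ∈ Finset.range k, (k.choose (i + 1) : ℝ) *
          (iteratedDeriv (i + 1) (v t) x * iteratedDeriv (k - i) (ω t) x) :=
      continuous_finsetSum _ fun i _ => continuous_const.mul ((cv _).mul (cω _))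
    refine (two_integral_transport_le (contDiff_of_top (contDiff_iteratedDeriv dω k) 1)
      (g := fun x => iteratedDeriv k (ρ t) x - ∑ i ∈ Finset.range k, (k.choose (i + 1) : ℝ) *
          (iteratedDeriv (i + 1) (v t) x * iteratedDeriv (k - i) (ω t) x))
      ((cρ k).sub csum) (contDiff_of_top dv 1)
      (iteratedDeriv_eq_zero_of_supp (hω.supp t) k) hb).trans ?_
    have e2 : 2 * ∫ x in (-1 : ℝ)..1, iteratedDeriv k (ω t) x *
        (iteratedDeriv k (ρ t) x - ∑ i ∈ Finset.range k, (k.choose (i + 1) : ℝ) *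
          (iteratedDeriv (i + 1) (v t) x * iteratedDeriv (k - i) (ω t) x))
        = 2 * (∫ x in (-1 : ℝ)..1, iteratedDeriv k (ω t) x * iteratedDeriv k (ρ t) x)
          - ∑ i ∈ Finset.range k, (k.choose (i + 1) : ℝ) *
            (2 * ∫ x in (-1 : ℝ)..1, iteratedDeriv k (ω t) x *
              (iteratedDeriv (i + 1) (v t) x * iteratedDeriv (k - i) (ω t) x)) := by
      have e3 := two_integral_mul_sum (N := k) (c := fun i => (k.choose (i + 1) : ℝ))
        (q := fun i x => iteratedDeriv (i + 1) (v t) x * iteratedDeriv (k - i) (ω t) x)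
        (cω k) fun i => (cv _).mul (cω _)
      beta_reduce at e3
      rw [← e3, integral_mul_sub_of_continuous (cω k) (cρ k) csum, mul_sub]
    rw [e2]
    have h1 := (le_abs_self _).trans (two_integral_mul_le (cω k) (cρ k))
    have h2 := abs_sum_choose_le (k := k) (N := k) le_rfl (mul_nonneg hD0 hnω0) fun i hi =>
      abs_two_integral_commutator_le dv dω (hω.supp t) hi hb0 hS0 hb fun h => hS i h hi
    have h3 := neg_le_of_abs_le h2
    linarith
  have iρ : 2 * ∫ x in (-1 : ℝ)..1, iteratedDeriv k (ρ t) x *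
      iteratedDeriv k (fun x => -deriv (fun y => v t y * ρ t y) x) x
      ≤ b * nρ + (nρ + R * Z) + 2 ^ (k + 1) * (D * nρ) := by
    -- Of the k + 1 derivatives on vρ, the term with all of them on ρ is transport, and the one with
    -- all of them on v is split off, to be estimated by sup|ρ| and the L² norm of v^(k+1). The
    -- remaining terms have at most k derivatives on each factor.
    have e : ∀ x, iteratedDeriv k (fun x => -deriv (fun y => v t y * ρ t y) x) x
        = (-(iteratedDeriv (k + 1) (v t) x * ρ t x) - ∑ i ∈ Finset.range k,
          ((k + 1).choose (i + 1) : ℝ) *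
          (iteratedDeriv (i + 1) (v t) x * iteratedDeriv (k - i) (ρ t) x))
          - v t x * deriv (iteratedDeriv k (ρ t)) x := fun x => by
      rw [iteratedDeriv_fun_neg, ← iteratedDeriv_succ', iteratedDeriv_mul_eq dv dρ,
        Finset.sum_range_succ, ← iteratedDeriv_succ]
      simp only [Nat.choose_self, Nat.cast_one, one_mul, Nat.add_sub_add_right, Nat.sub_self,
        iteratedDeriv_zero]
      ring
    simp only [e]
    have csum : Continuous fun x => ∑ i ∈ Finset.range k, ((k + 1).choose (i + 1) : ℝ) *
          (iteratedDeriv (i + 1) (v t) x * iteratedDeriv (k - i) (ρ t) x) :=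
      continuous_finsetSum _ fun i _ => continuous_const.mul ((cv _).mul (cρ _))
    have clast : Continuous fun x => iteratedDeriv (k + 1) (v t) x * ρ t x :=
      (cv _).mul dρ.continuous
    refine (two_integral_transport_le (contDiff_of_top (contDiff_iteratedDeriv dρ k) 1)
      (g := fun x => -(iteratedDeriv (k + 1) (v t) x * ρ t x) - ∑ i ∈ Finset.range k,
          ((k + 1).choose (i + 1) : ℝ) *
          (iteratedDeriv (i + 1) (v t) x * iteratedDeriv (k - i) (ρ t) x))
      (clast.neg.sub csum) (contDiff_of_top dv 1)
      (iteratedDeriv_eq_zero_of_supp (hρ.supp t) k) hb).trans ?_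
    have e2 : 2 * ∫ x in (-1 : ℝ)..1, iteratedDeriv k (ρ t) x *
        (-(iteratedDeriv (k + 1) (v t) x * ρ t x) - ∑ i ∈ Finset.range k,
          ((k + 1).choose (i + 1) : ℝ) *
          (iteratedDeriv (i + 1) (v t) x * iteratedDeriv (k - i) (ρ t) x))
        = -(2 * ∫ x in (-1 : ℝ)..1, iteratedDeriv k (ρ t) x *
            (iteratedDeriv (k + 1) (v t) x * ρ t x))
          - ∑ i ∈ Finset.range k, ((k + 1).choose (i + 1) : ℝ) *
            (2 * ∫ x in (-1 : ℝ)..1, iteratedDeriv k (ρ t) x *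
              (iteratedDeriv (i + 1) (v t) x * iteratedDeriv (k - i) (ρ t) x)) := by
      have e3 := two_integral_mul_sum (N := k) (c := fun i => ((k + 1).choose (i + 1) : ℝ))
        (q := fun i x => iteratedDeriv (i + 1) (v t) x * iteratedDeriv (k - i) (ρ t) x)
        (cρ k) fun i => (cv _).mul (cρ _)
      beta_reduce at e3
      have clast' : Continuous fun x => -(iteratedDeriv (k + 1) (v t) x * ρ t x) := clast.neg
      rw [← e3, integral_mul_sub_of_continuous (cρ k) clast' csum, mul_sub]
      simp only [mul_neg, intervalIntegral.integral_neg]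
    rw [e2]
    have h1 := neg_le_of_abs_le (two_integral_mul_le (cρ k) clast)
    have h2 := abs_sum_choose_le (k := k + 1) (N := k) (by omega) (mul_nonneg hD0 hnρ0) fun i hi =>
      abs_two_integral_commutator_le dv dρ (hρ.supp t) hi hb0 hS0 hb fun h => hS i h hi
    have h3 := neg_le_of_abs_le h2
    have h4 : nsq (fun x => iteratedDeriv (k + 1) (v t) x * ρ t x) ≤ R * Z := by
      have hR0 : 0 ≤ R := (sq_nonneg _).trans (hR 0 (by norm_num))
      have := nsq_mul_le dρ.continuous (cv (k + 1)) hR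
      simp only [mul_comm (iteratedDeriv (k + 1) (v t) _)]
      exact this.trans (mul_le_mul_of_nonneg_left hZ hR0)
    linarith
  have hE : energy k (ω t) (ρ t) = nω + nρ := rfl
  rw [hE]
  have hp : (0 : ℝ) ≤ 2 ^ k := by positivity
  have p1 : 0 ≤ 2 ^ k * (D * nω) := by positivity
  have p2 : 0 ≤ 2 ^ k * (D * nρ) := by positivity
  have q : (2 ^ (k + 2) * (2 * 4 ^ k) + 3) * (1 + b + S) * (nω + nρ)
      = 4 * (2 ^ k * (D * nω)) + 4 * (2 ^ k * (D * nρ)) + 3 * (1 + b + S) * (nω + nρ) := by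
    rw [hD]; ring
  have q1 : (2 : ℝ) ^ (k + 1) * (D * nρ) = 2 * (2 ^ k * (D * nρ)) := by ring
  have q2 : 0 ≤ b * nω := mul_nonneg hb0 hnω0
  have q3 : 0 ≤ b * nρ := mul_nonneg hb0 hnρ0
  have q4 : 0 ≤ S * nω := mul_nonneg hS0 hnω0
  have q5 : 0 ≤ S * nρ := mul_nonneg hS0 hnρ0
  rw [q]
  rw [q1] at iρ
  nlinarith

/-! ### L² stability for differences of solutions -/

lemma nsq_add_le {f g : ℝ → ℝ} (hf : Continuous f) (hg : Continuous g) :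
    nsq (fun x => f x - g x) ≤ 2 * nsq f + 2 * nsq g := by
  unfold nsq
  rw [← intervalIntegral.integral_const_mul, ← intervalIntegral.integral_const_mul,
    ← intervalIntegral.integral_add (by apply Continuous.intervalIntegrable; fun_prop)
      (by apply Continuous.intervalIntegrable; fun_prop)]
  refine intervalIntegral.integral_mono_on (by norm_num)
    (by apply Continuous.intervalIntegrable; fun_prop)
    (by apply Continuous.intervalIntegrable; fun_prop) fun x _ => ?_
  nlinarith [sq_nonneg (f x + g x)]

lemma integral_mul_add_of_continuous {f g h : ℝ → ℝ} (hf : Continuous f) (hg : Continuous g)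
    (hh : Continuous h) (a b : ℝ) :
    ∫ x in a..b, f x * (g x + h x) = (∫ x in a..b, f x * g x) + ∫ x in a..b, f x * h x := by
  rw [← intervalIntegral.integral_add (by apply Continuous.intervalIntegrable; fun_prop)
    (by apply Continuous.intervalIntegrable; fun_prop)]
  simp only [mul_add]

/-- The squared `L²` distance of two states. -/
noncomputable def gap (f₁ g₁ f₂ g₂ : ℝ → ℝ) : ℝ :=
  nsq (fun x => f₁ x - f₂ x) + nsq (fun x => g₁ x - g₂ x)

lemma gap_nonneg (f₁ g₁ f₂ g₂ : ℝ → ℝ) : 0 ≤ gap f₁ g₁ f₂ g₂ :=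
  add_nonneg (nsq_nonneg _) (nsq_nonneg _)

/-- `L²` stability of the transport problem. -/
theorem gap_inequality {T : ℝ} {v₁ ω₁ ρ₁ v₂ ω₂ ρ₂ : ℝ → ℝ → ℝ} (hv₁ : Sm 1 v₁) (hv₂ : Sm 1 v₂)
    (hω₁ : Sm 1 ω₁) (hω₂ : Sm 1 ω₂) (hρ₁ : Sm 1 ρ₁) (hρ₂ : Sm 1 ρ₂)
    (sω₁ : ∀ t x, 1 < |x| → ω₁ t x = 0) (sω₂ : ∀ t x, 1 < |x| → ω₂ t x = 0)
    (sρ₁ : ∀ t x, 1 < |x| → ρ₁ t x = 0) (sρ₂ : ∀ t x, 1 < |x| → ρ₂ t x = 0)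
    (zv₁ : ∀ t, v₁ t 0 = 0) (zv₂ : ∀ t, v₂ t 0 = 0)
    (tr₁ : IsTransported T v₁ ω₁ ρ₁) (tr₂ : IsTransported T v₂ ω₂ ρ₂) :
    ∃ Y' : ℝ → ℝ, ∀ t ∈ Icc 0 T,
      HasDerivWithinAt (fun s => gap (ω₁ s) (ρ₁ s) (ω₂ s) (ρ₂ s)) (Y' t) (Icc 0 T) t ∧
      ∀ b R V : ℝ, (∀ x ∈ Icc (-1 : ℝ) 1, |deriv (v₁ t) x| ≤ b) →
        (∀ x ∈ Icc (-1 : ℝ) 1, deriv (ω₂ t) x ^ 2 ≤ R) →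
        (∀ x ∈ Icc (-1 : ℝ) 1, deriv (ρ₂ t) x ^ 2 ≤ R) → (∀ x ∈ Icc (-1 : ℝ) 1, ρ₂ t x ^ 2 ≤ R) →
        nsq (fun x => deriv (v₁ t) x - deriv (v₂ t) x) ≤ V →
        Y' t ≤ (3 * b + 3) * gap (ω₁ t) (ρ₁ t) (ω₂ t) (ρ₂ t) + 5 * R * V := by
  have sδ : Sm 1 fun t x => ω₁ t x - ω₂ t x := hω₁.sub hω₂
  have sσ : Sm 1 fun t x => ρ₁ t x - ρ₂ t x := hρ₁.sub hρ₂
  have sF : ∀ {v ω ρ : ℝ → ℝ → ℝ}, Sm 1 v → Sm 1 ω → Sm 1 ρ →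
      Sm 0 fun s x => ρ s x - v s x * deriv (ω s) x := fun h1 h2 h3 =>
    h3.of_succ.sub (h1.of_succ.mul h2.deriv)
  have sH : ∀ {v ρ : ℝ → ℝ → ℝ}, Sm 1 v → Sm 1 ρ →
      Sm 0 fun s x => -deriv (fun y => v s y * ρ s y) x := fun h1 h2 => (h1.mul h2).deriv.neg
  have eδ : ∀ t ∈ Icc 0 T, ∀ x, ω₁ t x - ω₂ t x = (ω₁ 0 x - ω₂ 0 x) + ∫ s in (0 : ℝ)..t,
      ((ρ₁ s x - v₁ s x * deriv (ω₁ s) x) - (ρ₂ s x - v₂ s x * deriv (ω₂ s) x)) := by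
    intro t ht x
    rw [tr₁.vorticity t ht, tr₂.vorticity t ht, intervalIntegral.integral_sub
      (((sF hv₁ hω₁ hρ₁).continuous_time x).intervalIntegrable _ _)
      (((sF hv₂ hω₂ hρ₂).continuous_time x).intervalIntegrable _ _)]
    ring
  have eσ : ∀ t ∈ Icc 0 T, ∀ x, ρ₁ t x - ρ₂ t x = (ρ₁ 0 x - ρ₂ 0 x) + ∫ s in (0 : ℝ)..t,
      ((-deriv (fun y => v₁ s y * ρ₁ s y) x) - (-deriv (fun y => v₂ s y * ρ₂ s y) x)) := by
    intro t ht x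
    rw [tr₁.density t ht, tr₂.density t ht, intervalIntegral.integral_sub
      (((sH hv₁ hρ₁).continuous_time x).intervalIntegrable _ _)
      (((sH hv₂ hρ₂).continuous_time x).intervalIntegrable _ _)]
    ring
  refine ⟨_, fun t ht => ⟨(hasDerivWithinAt_nsq sδ.of_succ ((sF hv₁ hω₁ hρ₁).sub (sF hv₂ hω₂ hρ₂))
    eδ ht).add (hasDerivWithinAt_nsq sσ.of_succ ((sH hv₁ hρ₁).sub (sH hv₂ hρ₂)) eσ ht), ?_⟩⟩
  intro b R V hb hR1 hR2 hR3 hV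
  have cd : ∀ {f : ℝ → ℝ → ℝ}, Sm 1 f → ContDiff ℝ 1 (f t) := fun h => by
    have := h.contDiff t
    exact_mod_cast this
  have dd : ∀ {f : ℝ → ℝ → ℝ}, Sm 1 f → ∀ x, HasDerivAt (f t) (deriv (f t) x) x :=
    fun h x => h.hasDerivAt t x
  have cc : ∀ {f : ℝ → ℝ → ℝ}, Sm 1 f → Continuous (f t) := fun h => h.continuous_space t
  have cc' : ∀ {f : ℝ → ℝ → ℝ}, Sm 1 f → Continuous (deriv (f t)) :=
    fun h => h.deriv.continuous_space t
  set δ : ℝ → ℝ := fun x => ω₁ t x - ω₂ t x with hδ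
  set σ : ℝ → ℝ := fun x => ρ₁ t x - ρ₂ t x with hσ
  set w : ℝ → ℝ := fun x => v₁ t x - v₂ t x with hw
  have dδ : ∀ x, deriv δ x = deriv (ω₁ t) x - deriv (ω₂ t) x := fun x =>
    ((dd hω₁ x).sub (dd hω₂ x)).deriv
  have dσ : ∀ x, deriv σ x = deriv (ρ₁ t) x - deriv (ρ₂ t) x := fun x =>
    ((dd hρ₁ x).sub (dd hρ₂ x)).deriv
  have dw : deriv w = fun x => deriv (v₁ t) x - deriv (v₂ t) x := funext fun x =>
    ((dd hv₁ x).sub (dd hv₂ x)).deriv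
  have cδ : Continuous δ := (cc hω₁).sub (cc hω₂)
  have cσ : Continuous σ := (cc hρ₁).sub (cc hρ₂)
  have cw : Continuous w := (cc hv₁).sub (cc hv₂)
  have cw' : Continuous (deriv w) := by rw [dw]; exact (cc' hv₁).sub (cc' hv₂)
  have hV' : nsq (deriv w) ≤ V := by rw [dw]; exact hV
  -- The velocity difference vanishes at the origin, so Poincaré's inequality reduces it to its
  -- gradient.
  have hwV : nsq w ≤ 2 * V := by
    have h := nsq_le_two_nsq_deriv_of_zero (f := w) ((cd hv₁).sub (cd hv₂))
      (by simp [hw, zv₁, zv₂])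
    linarith
  have hR0 : 0 ≤ R := (sq_nonneg _).trans (hR3 0 (by norm_num))
  have b1 : 2 * ∫ x in (-1 : ℝ)..1, δ x * ((ρ₁ t x - v₁ t x * deriv (ω₁ t) x)
      - (ρ₂ t x - v₂ t x * deriv (ω₂ t) x)) ≤ b * nsq δ + (nsq δ + nsq σ) + (nsq δ + R * (2 * V)) := by
    -- The difference is transported by v₁, and derivatives of the solution itself enter only
    -- through the second pair; hence the hypotheses on ω₂ and ρ₂ alone.
    have e : ∀ x, (ρ₁ t x - v₁ t x * deriv (ω₁ t) x) - (ρ₂ t x - v₂ t x * deriv (ω₂ t) x)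
        = (σ x - deriv (ω₂ t) x * w x) - v₁ t x * deriv δ x := fun x => by
      rw [dδ]; simp only [hσ, hw]; ring
    simp only [e]
    have cq : Continuous fun x => deriv (ω₂ t) x * w x := (cc' hω₂).mul cw
    refine (two_integral_transport_le (f := δ) (g := fun x => σ x - deriv (ω₂ t) x * w x)
      ((cd hω₁).sub (cd hω₂)) (cσ.sub cq) (cd hv₁)
      (fun x hx => by simp [hδ, sω₁ t x hx, sω₂ t x hx]) hb).trans ?_
    rw [integral_mul_sub_of_continuous cδ cσ cq]
    have h1 := (le_abs_self _).trans (two_integral_mul_le cδ cσ)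
    have h2 := neg_le_of_abs_le (two_integral_mul_le cδ cq)
    have h3 := nsq_mul_le (cc' hω₂) cw hR1
    have h4 := mul_le_mul_of_nonneg_left hwV hR0
    linarith
  have b2 : 2 * ∫ x in (-1 : ℝ)..1, σ x * ((-deriv (fun y => v₁ t y * ρ₁ t y) x)
      - (-deriv (fun y => v₂ t y * ρ₂ t y) x)) ≤ b * nsq σ + 2 * (b * nsq σ)
        + (nsq σ + R * (2 * V)) + (nsq σ + R * V) := by
    have e : ∀ x, (-deriv (fun y => v₁ t y * ρ₁ t y) x) - (-deriv (fun y => v₂ t y * ρ₂ t y) x)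
        = (-(deriv (v₁ t) x * σ x) - (deriv (ρ₂ t) x * w x + ρ₂ t x * deriv w x))
          - v₁ t x * deriv σ x := fun x => by
      have e1 := ((dd hv₁ x).mul (dd hρ₁ x)).deriv
      have e2 := ((dd hv₂ x).mul (dd hρ₂ x)).deriv
      have e1' : deriv (fun y => v₁ t y * ρ₁ t y) x = _ := e1
      have e2' : deriv (fun y => v₂ t y * ρ₂ t y) x = _ := e2
      rw [e1', e2', dσ, dw]; simp only [hσ, hw]; ring
    simp only [e]
    have cρ₂ := cc hρ₂
    have cp : Continuous fun x => deriv (ρ₂ t) x * w x := (cc' hρ₂).mul cw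
    have cq : Continuous fun x => ρ₂ t x * deriv w x := cρ₂.mul cw'
    have cr : Continuous fun x => deriv (v₁ t) x * σ x := (cc' hv₁).mul cσ
    have cr' : Continuous fun x => -(deriv (v₁ t) x * σ x) := cr.neg
    refine (two_integral_transport_le (f := σ) (g := fun x => -(deriv (v₁ t) x * σ x)
        - (deriv (ρ₂ t) x * w x + ρ₂ t x * deriv w x))
      ((cd hρ₁).sub (cd hρ₂)) (cr'.sub (cp.add cq)) (cd hv₁)
      (fun x hx => by simp [hσ, sρ₁ t x hx, sρ₂ t x hx]) hb).trans ?_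
    have cpq : Continuous fun x => deriv (ρ₂ t) x * w x + ρ₂ t x * deriv w x := cp.add cq
    rw [integral_mul_sub_of_continuous cσ cr' cpq]
    have e3 := integral_mul_add_of_continuous cσ cp cq (-1) 1
    have e4 : ∫ x in (-1 : ℝ)..1, σ x * -(deriv (v₁ t) x * σ x)
        = -∫ x in (-1 : ℝ)..1, deriv (v₁ t) x * σ x ^ 2 := by
      rw [← intervalIntegral.integral_neg]
      congr 1
      ext x
      ring
    rw [e3, e4]
    have h0 := neg_le_of_abs_le (abs_integral_sq_mul_le cσ hb)
    have h1 := neg_le_of_abs_le (two_integral_mul_le cσ cp)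
    have h2 := neg_le_of_abs_le (two_integral_mul_le cσ cq)
    have h3 := nsq_mul_le (cc' hρ₂) cw hR2
    have h4 := nsq_mul_le cρ₂ cw' hR3
    have h5 := mul_le_mul_of_nonneg_left hwV hR0
    have h6 := mul_le_mul_of_nonneg_left hV' hR0
    linarith
  have hg : gap (ω₁ t) (ρ₁ t) (ω₂ t) (ρ₂ t) = nsq δ + nsq σ := rfl
  rw [hg]
  have hb0 : 0 ≤ b := (abs_nonneg _).trans (hb 0 (by norm_num))
  have n1 := mul_nonneg hb0 (nsq_nonneg δ)
  have n2 := nsq_nonneg δ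
  have n3 := nsq_nonneg σ
  nlinarith

/-! ### The velocity of an evolution and the successive approximations -/

section Velocity

variable {a T : ℝ} {ω : ℝ → ℝ → ℝ}

lemma sm_velocity (ha : 0 < a) (hT : 0 ≤ T) (hω : IsEvolution T ω) (n : ℕ) :
    Sm n fun t => conv 0 a (ω t) := (hω.sm n).conv ha le_rfl ha.le (hω.bd hT n)

/-- The gain of one derivative: the truncated Hilbert transform commutes with d/dx, so its L² bound
applies at every order. -/
lemma nsq_iteratedDeriv_velocity_le (ha : 0 < a) (hT : 0 ≤ T) (hω : IsEvolution T ω) (k : ℕ)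
    (t : ℝ) :
    nsq (iteratedDeriv (k + 1) (conv 0 a (ω t))) ≤ 16 * nsq (iteratedDeriv k (ω t)) := by
  rw [iteratedDeriv_conv ha le_rfl ha.le (hω.sm _) (hω.bd hT _), iteratedDeriv_succ]
  exact nsq_conv_deriv_le ha (contDiff_of_top (contDiff_iteratedDeriv
    (contDiff_top_of_sm hω.sm t) k) 1) (iteratedDeriv_eq_zero_of_supp (hω.supp t) k)

/-- Sobolev for u_x, the L² bounds for u_x and u_xx, and Poincaré for ω give u_x² ≤ (16·4 +
4·16)‖ω_x‖² = 128‖ω_x‖²; then |s| ≤ 1 + s². -/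
lemma abs_deriv_velocity_le (ha : 0 < a) (hT : 0 ≤ T) (hω : IsEvolution T ω) (t : ℝ) {x : ℝ}
    (hx : x ∈ Icc (-1 : ℝ) 1) :
    |deriv (conv 0 a (ω t)) x| ≤ 1 + 128 * nsq (iteratedDeriv 1 (ω t)) := by
  have hd := contDiff_top_of_sm hω.sm t
  have h0 := nsq_iteratedDeriv_velocity_le ha hT hω 0 t
  have h1 := nsq_iteratedDeriv_velocity_le ha hT hω 1 t
  have h2 := nsq_iteratedDeriv_le hd (hω.supp t) 0 1
  have hv := contDiff_top_of_sm (sm_velocity ha hT hω) t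
  have h3 := sq_le_sobolev (contDiff_of_top (contDiff_iteratedDeriv hv 1) 1) hx
  rw [← iteratedDeriv_succ] at h3
  rw [iteratedDeriv_one] at h3
  norm_num at h0 h1 h2 h3
  have h4 : deriv (conv 0 a (ω t)) x ^ 2 ≤ 128 * nsq (deriv (ω t)) := by linarith
  rw [iteratedDeriv_one]
  rw [← sq_abs] at h4
  nlinarith [sq_nonneg (|deriv (conv 0 a (ω t)) x| - 1), abs_nonneg (deriv (conv 0 a (ω t)) x),
    nsq_nonneg (deriv (ω t))]

lemma velocity_nonpos (ha : 0 < a) (hT : 0 ≤ T) (hω : IsEvolution T ω) (t : ℝ) {x : ℝ}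
    (hx : 0 ≤ x) : conv 0 a (ω t) x ≤ 0 := by
  obtain ⟨B, hB⟩ := (hω.bd hT 0).bound
  exact conv_nonpos ha ((hω.sm 0).continuous_space t) (hB t) (hω.odd t) (hω.nonneg t) hx

lemma exists_next (ha : 0 < a) (hT : 0 ≤ T) (hω : IsEvolution T ω) {ω₀ ρ₀ : ℝ → ℝ}
    (hω₀ : IsProfile ω₀) (hρ₀ : IsProfile ρ₀) :
    ∃ ω' ρ', IsEvolution T ω' ∧ IsEvolution T ρ' ∧ ω' 0 = ω₀ ∧ ρ' 0 = ρ₀ ∧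
      IsTransported T (fun t => conv 0 a (ω t)) ω' ρ' := by
  have hs := sm_velocity ha hT hω
  obtain ⟨B, hB⟩ := (Bd.conv ha le_rfl ha.le (hω.sm 0) (hω.bd hT 0)).bound
  obtain ⟨K, hK⟩ := (Bd.conv ha le_rfl ha.le (hω.sm 1) (hω.bd hT 1)).deriv.bound
  exact exists_isTransported hT hs hB hK (fun t => conv_odd (hω.odd t))
    (fun t x hx => velocity_nonpos ha hT hω t hx) hω₀ hρ₀

end Velocity

lemma IsProfile.isEvolution {T : ℝ} {f : ℝ → ℝ} (hf : IsProfile f) : IsEvolution T fun _ => f :=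
  ⟨fun n => Sm.of_contDiff (hf.contDiff n), fun _ => rfl, fun _ => hf.odd, fun _ => hf.supp,
    fun _ => hf.nonneg⟩

/-- The successive approximations to the solution. -/
structure IsIteration (a T : ℝ) (ω₀ ρ₀ : ℝ → ℝ) (W R : ℕ → ℝ → ℝ → ℝ) : Prop where
  vorticity : ∀ n, IsEvolution T (W n)
  density : ∀ n, IsEvolution T (R n)
  zero_vorticity : ∀ t, W 0 t = ω₀
  zero_density : ∀ t, R 0 t = ρ₀
  initial_vorticity : ∀ n, W n 0 = ω₀
  initial_density : ∀ n, R n 0 = ρ₀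
  transported : ∀ n, IsTransported T (fun t => conv 0 a (W n t)) (W (n + 1)) (R (n + 1))

lemma exists_isIteration {a T : ℝ} (ha : 0 < a) (hT : 0 ≤ T) {ω₀ ρ₀ : ℝ → ℝ} (hω : IsProfile ω₀)
    (hρ : IsProfile ρ₀) : ∃ W R, IsIteration a T ω₀ ρ₀ W R := by
  choose F G h1 h2 h3 h4 h5 using fun p : {f : ℝ → ℝ → ℝ // IsEvolution T f} =>
    exists_next (a := a) ha hT p.2 hω hρ
  -- The recursion runs over pairs of a family and its `IsEvolution` proof, because the next linear
  -- problem is solvable only for such families. The densities are read off afterwards, shifted by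
  -- one index.
  let P : ℕ → {f : ℝ → ℝ → ℝ // IsEvolution T f} :=
    fun n => Nat.rec ⟨fun _ => ω₀, hω.isEvolution⟩ (fun _ p => ⟨F p, h1 p⟩) n
  let R : ℕ → ℝ → ℝ → ℝ := fun n => Nat.casesOn n (fun _ => ρ₀) fun n => G (P n)
  refine ⟨fun n => (P n).1, R, fun n => (P n).2, fun n => ?_, fun _ => rfl, fun _ => rfl,
    fun n => ?_, fun n => ?_, fun n => h5 (P n)⟩
  · cases n with
    | zero => exact hρ.isEvolution
    | succ n => exact h2 (P n)
  · cases n with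
    | zero => rfl
    | succ n => exact h3 (P n)
  · cases n with
    | zero => rfl
    | succ n => exact h4 (P n)

/-! ### Uniform bounds for the approximations -/

section Bounds

variable {a T : ℝ} {w ω ρ : ℝ → ℝ → ℝ}

lemma IsEvolution.contDiff (h : IsEvolution T ω) (t : ℝ) : ContDiff ℝ (⊤ : ℕ∞) (ω t) :=
  contDiff_top_of_sm h.sm t

lemma IsEvolution.sq_le (h : IsEvolution T ω) (j : ℕ) (t x : ℝ) :
    iteratedDeriv j (ω t) x ^ 2 ≤ 2 * nsq (iteratedDeriv (j + 1) (ω t)) := by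
  rw [iteratedDeriv_succ]
  exact sq_le_two_nsq_deriv (contDiff_of_top (contDiff_iteratedDeriv (h.contDiff t) j) 1)
    (iteratedDeriv_eq_zero_of_supp (h.supp t) j) x

/-- At first order the commutator has no middle terms, so `S = 0`, and the coefficient of the energy
inequality is 67. The choices b = 1 + 128p and R·Z = 2r·16p, with p = ‖w_x‖² and r = ‖ρ_x‖², give a
total below 10000(1 + p). -/
lemma energy_one_deriv_le (ha : 0 < a) (hT : 0 ≤ T) (hw : IsEvolution T w) (hω : IsEvolution T ω)
    (hρ : IsEvolution T ρ) (htr : IsTransported T (fun t => conv 0 a (w t)) ω ρ) :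
    ∃ Y' : ℝ → ℝ, ∀ t ∈ Icc 0 T,
      HasDerivWithinAt (fun s => energy 1 (ω s) (ρ s)) (Y' t) (Icc 0 T) t ∧
      Y' t ≤ 10000 * (1 + nsq (iteratedDeriv 1 (w t))) * energy 1 (ω t) (ρ t) := by
  obtain ⟨Y', hY⟩ := energy_inequality 1 (sm_velocity ha hT hw) hω hρ htr
  refine ⟨Y', fun t ht => ⟨(hY t ht).1, ?_⟩⟩
  have hn := nsq_nonneg (iteratedDeriv 1 (w t))
  have hE := nsq_nonneg (iteratedDeriv 1 (ω t))
  have hE' := nsq_nonneg (iteratedDeriv 1 (ρ t))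
  have h := (hY t ht).2 (1 + 128 * nsq (iteratedDeriv 1 (w t))) 0
    (2 * nsq (iteratedDeriv 1 (ρ t))) (16 * nsq (iteratedDeriv 1 (w t))) (by positivity) le_rfl
    (fun x hx => abs_deriv_velocity_le ha hT hw t hx) (fun i h1 h2 => by omega)
    (nsq_iteratedDeriv_velocity_le ha hT hw 1 t) (fun x _ => by simpa using hρ.sq_le 0 t x) le_rfl
  refine h.trans ?_
  have h1 := mul_nonneg hn hE
  have h2 := mul_nonneg hn hE'
  unfold energy
  generalize nsq (iteratedDeriv 1 (w t)) = p at *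
  generalize nsq (iteratedDeriv 1 (ω t)) = q at *
  generalize nsq (iteratedDeriv 1 (ρ t)) = r at *
  norm_num
  linarith

/-- Once the norms of order 1 and k are bounded, the inequality of order k + 1 is linear in the
energies of that order, with a constant independent of the families. Higher norms thus never shorten
the time interval. -/
lemma energy_succ_deriv_le (ha : 0 < a) (hT : 0 ≤ T) {k : ℕ} (hk : 1 ≤ k) (B : ℝ) :
    ∃ C : ℝ, 0 ≤ C ∧ ∀ w ω ρ : ℝ → ℝ → ℝ, IsEvolution T w → IsEvolution T ω → IsEvolution T ρ →
      IsTransported T (fun t => conv 0 a (w t)) ω ρ →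
      (∀ t, nsq (iteratedDeriv 1 (w t)) ≤ B) → (∀ t, nsq (iteratedDeriv k (w t)) ≤ B) →
      (∀ t, nsq (iteratedDeriv 1 (ρ t)) ≤ B) → ∃ Y' : ℝ → ℝ, ∀ t ∈ Icc 0 T,
        HasDerivWithinAt (fun s => energy (k + 1) (ω s) (ρ s)) (Y' t) (Icc 0 T) t ∧
        Y' t ≤ C * energy (k + 1) (ω t) (ρ t) + C * nsq (iteratedDeriv (k + 1) (w t)) := by
  set C₁ : ℝ := (2 ^ (k + 1 + 2) * (2 * 4 ^ (k + 1)) + 3) * (1 + (1 + 128 * |B|) + 16 * 4 ^ k * |B|)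
  refine ⟨C₁ + 32 * |B|, by positivity, fun w ω ρ hw hω hρ htr h1 h2 h3 => ?_⟩
  obtain ⟨Y', hY⟩ := energy_inequality (k + 1) (sm_velocity ha hT hw) hω hρ htr
  refine ⟨Y', fun t ht => ⟨(hY t ht).1, ?_⟩⟩
  have hB := le_abs_self B
  have h := (hY t ht).2 (1 + 128 * |B|) (16 * 4 ^ k * |B|) (2 * |B|)
    (16 * nsq (iteratedDeriv (k + 1) (w t))) (by positivity) (by positivity)
    (fun x hx => (abs_deriv_velocity_le ha hT hw t hx).trans (by linarith [h1 t]))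
    (fun i hi hik => ?_) (nsq_iteratedDeriv_velocity_le ha hT hw (k + 1) t)
    (fun x _ => (by simpa using hρ.sq_le 0 t x : ρ t x ^ 2 ≤ 2 * nsq (iteratedDeriv 1 (ρ t))).trans
      (by linarith [h3 t])) (by omega)
  · refine h.trans ?_
    have e1 := mul_nonneg (abs_nonneg B) (energy_nonneg (k + 1) (ω t) (ρ t))
    have e2 : 0 ≤ C₁ * nsq (iteratedDeriv (k + 1) (w t)) :=
      mul_nonneg (by positivity) (nsq_nonneg _)
    nlinarith
  · refine (nsq_iteratedDeriv_velocity_le ha hT hw i t).trans ?_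
    have e1 := nsq_iteratedDeriv_le (hw.contDiff t) (hw.supp t) i (k - i)
    rw [show i + (k - i) = k by omega] at e1
    have e2 : (4 : ℝ) ^ (k - i) ≤ 4 ^ k := pow_le_pow_right₀ (by norm_num) (by omega)
    have e3 : (4 : ℝ) ^ (k - i) * nsq (iteratedDeriv k (w t)) ≤ 4 ^ k * |B| :=
      mul_le_mul e2 ((h2 t).trans hB) (nsq_nonneg _) (by positivity)
    linarith

end Bounds

section Iteration

variable {a T : ℝ} {ω₀ ρ₀ : ℝ → ℝ} {W R : ℕ → ℝ → ℝ → ℝ}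

namespace IsIteration

lemma energy_clamp (h : IsIteration a T ω₀ ρ₀ W R) (k n : ℕ) (t : ℝ) :
    energy k (W n (clamp T t)) (R n (clamp T t)) = energy k (W n t) (R n t) := by
  rw [(h.vorticity n).clamp, (h.density n).clamp]

/-- If the preceding iterate has energy at most 2M, the next grows at rate at most 10000(1 + 2M); on
an interval this short that amounts to at most a doubling. -/
lemma energy_one_le (h : IsIteration a T ω₀ ρ₀ W R) (ha : 0 < a) (hT : 0 ≤ T) {M : ℝ}
    (hM : energy 1 ω₀ ρ₀ ≤ M) (hT' : 10000 * (1 + 2 * M) * T ≤ Real.log 2) (n : ℕ) (t : ℝ) :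
    energy 1 (W n t) (R n t) ≤ 2 * M := by
  have hM0 : 0 ≤ M := (energy_nonneg _ _ _).trans hM
  induction n generalizing t with
  | zero => rw [h.zero_vorticity, h.zero_density]; linarith
  | succ n ih =>
    rw [← h.energy_clamp]
    obtain ⟨Y', hY⟩ := energy_one_deriv_le ha hT (h.vorticity n) (h.vorticity (n + 1))
      (h.density (n + 1)) (h.transported n)
    have ht := clamp_mem hT t
    refine (le_mul_exp_of_deriv_le (κ := fun _ => 10000 * (1 + 2 * M)) continuous_const
      (fun t ht => (hY t ht).1) (fun t ht => (hY t ht).2.trans ?_) ht).trans ?_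
    · refine mul_le_mul_of_nonneg_right ?_ (energy_nonneg _ _ _)
      have := ih t
      unfold energy at this
      linarith [nsq_nonneg (iteratedDeriv 1 (R n t))]
    · rw [h.initial_vorticity, h.initial_density, intervalIntegral.integral_const]
      have h2 : (clamp T t - 0) • (10000 * (1 + 2 * M)) ≤ Real.log 2 := by
        refine le_trans ?_ hT'
        rw [sub_zero, smul_eq_mul, mul_comm]
        exact mul_le_mul_of_nonneg_left ht.2 (by positivity)
      have h3 := Real.exp_le_exp.2 h2
      rw [Real.exp_log (by norm_num)] at h3
      have := mul_le_mul hM h3 (Real.exp_pos _).le hM0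
      linarith

/-- Induction on the order of differentiation and, inside it, on the iterate: each order is
propagated by the linear Gronwall bound with m = 1. -/
lemma exists_energy_le (h : IsIteration a T ω₀ ρ₀ W R) (ha : 0 < a) (hT : 0 ≤ T)
    {B₁ : ℝ} (h1 : ∀ n t, energy 1 (W n t) (R n t) ≤ B₁) (k : ℕ) :
    ∃ B, ∀ n t, energy (k + 1) (W n t) (R n t) ≤ B := by
  induction k with
  | zero => exact ⟨B₁, h1⟩
  | succ k ih =>
    obtain ⟨B₂, h2⟩ := ih
    have b1 : ∀ k n t, nsq (iteratedDeriv k (W n t)) ≤ energy k (W n t) (R n t) := fun k n t =>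
      le_add_of_nonneg_right (nsq_nonneg _)
    have b2 : ∀ k n t, nsq (iteratedDeriv k (R n t)) ≤ energy k (W n t) (R n t) := fun k n t =>
      le_add_of_nonneg_left (nsq_nonneg _)
    obtain ⟨C, hC, hstep⟩ := energy_succ_deriv_le ha hT (k := k + 1) (by omega) (max B₁ B₂)
    set A := energy (k + 1 + 1) ω₀ ρ₀ with hA
    have hA0 : 0 ≤ A := energy_nonneg _ _ _
    have key : ∀ n, ∀ t ∈ Icc 0 T,
        energy (k + 1 + 1) (W n t) (R n t) ≤ A * Real.exp ((1 + 1) * C * t) := by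
      intro n
      induction n with
      | zero =>
        intro t ht
        rw [h.zero_vorticity, h.zero_density]
        have : 1 ≤ Real.exp ((1 + 1) * C * t) := Real.one_le_exp (by have := ht.1; positivity)
        exact le_mul_of_one_le_right hA0 this
      | succ n ih =>
        intro t ht
        obtain ⟨Y', hY⟩ := hstep (W n) (W (n + 1)) (R (n + 1)) (h.vorticity n)
          (h.vorticity (n + 1)) (h.density (n + 1)) (h.transported n)
          (fun t => (b1 1 n t).trans ((h1 n t).trans (le_max_left _ _)))
          (fun t => (b1 _ n t).trans ((h2 n t).trans (le_max_right _ _)))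
          (fun t => (b2 1 _ t).trans ((h1 _ t).trans (le_max_left _ _)))
        refine le_of_deriv_le_add hC (fun t ht => (hY t ht).1) (fun t ht => (hY t ht).2)
          (fun t ht => ?_) ?_ ht
        · rw [one_mul]
          exact (b1 _ n t).trans (ih t ht)
        · rw [h.initial_vorticity, h.initial_density]
    refine ⟨A * Real.exp ((1 + 1) * C * T), fun n t => ?_⟩
    rw [← h.energy_clamp]
    have ht := clamp_mem hT t
    refine (key n _ ht).trans (mul_le_mul_of_nonneg_left (Real.exp_le_exp.2 ?_) hA0)
    exact mul_le_mul_of_nonneg_left ht.2 (by positivity)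

end IsIteration

end Iteration

/-! ### Convergence of the approximations and local existence -/

lemma conv_sub {e a : ℝ} (ha : 0 < a) (he : 0 ≤ e) (hea : e ≤ a) {f g : ℝ → ℝ} {B B' : ℝ}
    (hf : Continuous f) (hg : Continuous g) (hB : ∀ x, |f x| ≤ B) (hB' : ∀ x, |g x| ≤ B') (x : ℝ) :
    conv e a (fun y => f y - g y) x = conv e a f x - conv e a g x := by
  have h1 : Integrable fun z => kern e a z * f (x - z) :=
    integrable_kern_mul ha he hea (hf.comp (continuous_sub_left x)) fun z => hB _
  have h2 : Integrable fun z => kern e a z * g (x - z) :=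
    integrable_kern_mul ha he hea (hg.comp (continuous_sub_left x)) fun z => hB' _
  unfold conv
  rw [← mul_sub, ← integral_sub h1 h2]
  simp only [mul_sub]

lemma deriv_conv_of_contDiff {a : ℝ} (ha : 0 < a) {f : ℝ → ℝ} (hf : ContDiff ℝ 1 f)
    (hs : ∀ x, 1 < |x| → f x = 0) : deriv (conv 0 a f) = conv 0 a (deriv f) := by
  have hf' := hf.continuous_deriv le_rfl
  obtain ⟨B, hB⟩ := exists_bound_of_supp hf.continuous hs
  obtain ⟨B', hB'⟩ := exists_bound_of_supp hf' (deriv_eq_zero_of_supp hs)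
  ext x
  exact (hasDerivAt_conv ha le_rfl ha.le (fun x => (hf.differentiable (by norm_num) x).hasDerivAt)
    hf' hB hB' x).deriv

/-- The map `f ↦ conv 0 a f` gains a derivative in `L²`, for differences. -/
lemma nsq_deriv_velocity_sub_le {a : ℝ} (ha : 0 < a) {f g : ℝ → ℝ} (hf : ContDiff ℝ 1 f)
    (hg : ContDiff ℝ 1 g) (sf : ∀ x, 1 < |x| → f x = 0) (sg : ∀ x, 1 < |x| → g x = 0) :
    nsq (fun x => deriv (conv 0 a f) x - deriv (conv 0 a g) x) ≤ 16 * nsq (fun x => f x - g x) := by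
  have hf' := hf.continuous_deriv le_rfl
  have hg' := hg.continuous_deriv le_rfl
  obtain ⟨B, hB⟩ := exists_bound_of_supp hf' (deriv_eq_zero_of_supp sf)
  obtain ⟨B', hB'⟩ := exists_bound_of_supp hg' (deriv_eq_zero_of_supp sg)
  have e : (fun x => deriv (conv 0 a f) x - deriv (conv 0 a g) x)
      = conv 0 a (deriv fun x => f x - g x) := by
    ext x
    rw [deriv_conv_of_contDiff ha hf sf, deriv_conv_of_contDiff ha hg sg,
      ← conv_sub ha le_rfl ha.le hf' hg' hB hB']
    congr 1
    ext y
    exact (((hf.differentiable (by norm_num) y).hasDerivAt.sub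
      (hg.differentiable (by norm_num) y).hasDerivAt).deriv).symm
  rw [e]
  exact nsq_conv_deriv_le ha (hf.sub hg) fun x hx => by rw [sf x hx, sg x hx, sub_zero]

/-- Interpolation between `L²` and `H²`. -/
lemma nsq_deriv_sq_le {f : ℝ → ℝ} (hf : ContDiff ℝ 2 f) (hs : ∀ x, 1 < |x| → f x = 0) :
    nsq (deriv f) ^ 2 ≤ nsq f * nsq (deriv (deriv f)) := by
  have hf1 : ContDiff ℝ 1 (deriv f) := ((contDiff_succ_iff_deriv (n := 1)).1 hf).2.2
  have c := hf.continuous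
  have c1 := hf1.continuous
  have c2 := hf1.continuous_deriv le_rfl
  have h1 : f 1 = 0 := eq_zero_of_abs_le c hs (by simp)
  have h2 : f (-1) = 0 := eq_zero_of_abs_le c hs (by simp)
  have hibp := intervalIntegral.integral_mul_deriv_eq_deriv_mul (a := -1) (b := 1) (u := deriv f)
    (v := f) (u' := deriv (deriv f)) (v' := deriv f)
    (fun x _ => (hf1.differentiable (by norm_num) x).hasDerivAt)
    (fun x _ => (hf.differentiable (by norm_num) x).hasDerivAt)
    (c2.intervalIntegrable _ _) (c1.intervalIntegrable _ _)
  rw [h1, h2] at hibp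
  have e : nsq (deriv f) = -∫ x in (-1 : ℝ)..1, f x * deriv (deriv f) x := by
    unfold nsq
    simp only [sq]
    rw [hibp]
    simp only [mul_comm (f _)]
    ring
  rw [e, neg_sq]
  exact sq_integral_mul_le (by norm_num) c c2

/-- A sequence bounded in every `H^k` and geometrically small in `L²` is geometrically small in
every `H^k`. -/
lemma exists_geometric_nsq {ι : Type*} {h : ℕ → ι → ℝ → ℝ}
    (hd : ∀ n i, ContDiff ℝ (⊤ : ℕ∞) (h n i)) (hs : ∀ n i x, 1 < |x| → h n i x = 0)
    (hb : ∀ k, ∃ B, ∀ n i, nsq (iteratedDeriv k (h n i)) ≤ B) {C q : ℝ} (hC : 0 ≤ C) (hq : 0 ≤ q)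
    (hq1 : q < 1) (h0 : ∀ n i, nsq (h n i) ≤ C * q ^ n) (k : ℕ) :
    ∃ C q : ℝ, 0 ≤ C ∧ 0 ≤ q ∧ q < 1 ∧ ∀ n i, nsq (iteratedDeriv k (h n i)) ≤ C * q ^ n := by
  induction k with
  | zero => exact ⟨C, q, hC, hq, hq1, by simpa using h0⟩
  | succ k ih =>
    obtain ⟨C, q, hC, hq, hq1, hk⟩ := ih
    obtain ⟨B, hB⟩ := hb (k + 2)
    -- Interpolation with the bounded norm of order k + 2 replaces the ratio q by √q, which is still
    -- below 1.
    refine ⟨√(C * |B|), √q, Real.sqrt_nonneg _, Real.sqrt_nonneg _, ?_, fun n i => ?_⟩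
    · rw [Real.sqrt_lt' one_pos]; simpa using hq1
    have hd' := contDiff_iteratedDeriv (hd n i) k
    have h1 := nsq_deriv_sq_le (contDiff_of_top hd' 2) (iteratedDeriv_eq_zero_of_supp (hs n i) k)
    rw [← iteratedDeriv_succ, ← iteratedDeriv_succ] at h1
    refine abs_le_of_sq_le_sq' ?_ (by positivity) |>.2
    have h2 : (√(C * |B|) * √q ^ n) ^ 2 = C * q ^ n * |B| := by
      rw [mul_pow, ← pow_mul, mul_comm n 2, pow_mul, Real.sq_sqrt hq, Real.sq_sqrt (by positivity)]
      ring
    rw [h2]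
    exact h1.trans (mul_le_mul (hk n i) ((hB n i).trans (le_abs_self B)) (nsq_nonneg _)
      (by positivity))

lemma exists_geometric_sup {ι : Type*} {h : ℕ → ι → ℝ → ℝ}
    (hd : ∀ n i, ContDiff ℝ (⊤ : ℕ∞) (h n i)) (hs : ∀ n i x, 1 < |x| → h n i x = 0)
    (hb : ∀ k, ∃ B, ∀ n i, nsq (iteratedDeriv k (h n i)) ≤ B) {C q : ℝ} (hC : 0 ≤ C) (hq : 0 ≤ q)
    (hq1 : q < 1) (h0 : ∀ n i, nsq (h n i) ≤ C * q ^ n) (k : ℕ) :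
    ∃ C q : ℝ, 0 ≤ C ∧ 0 ≤ q ∧ q < 1 ∧ ∀ n i x, |iteratedDeriv k (h n i) x| ≤ C * q ^ n := by
  obtain ⟨C, q, hC, hq, hq1, hk⟩ := exists_geometric_nsq hd hs hb hC hq hq1 h0 (k + 1)
  refine ⟨√(2 * C), √q, Real.sqrt_nonneg _, Real.sqrt_nonneg _, ?_, fun n i x => ?_⟩
  · rw [Real.sqrt_lt' one_pos]; simpa using hq1
  have h1 := sq_le_two_nsq_deriv (contDiff_of_top (contDiff_iteratedDeriv (hd n i) k) 1)
    (iteratedDeriv_eq_zero_of_supp (hs n i) k) x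
  rw [← iteratedDeriv_succ] at h1
  refine abs_le_of_sq_le_sq ?_ (by positivity)
  have h2 : (√(2 * C) * √q ^ n) ^ 2 = 2 * (C * q ^ n) := by
    rw [mul_pow, ← pow_mul, mul_comm n 2, pow_mul, Real.sq_sqrt hq, Real.sq_sqrt (by positivity)]
    ring
  rw [h2]
  linarith [hk n i]

/-- A sequence of families all of whose spatial derivatives converge geometrically has a smooth
limit. -/
lemma exists_limit_of_geometric {F : ℕ → ℝ → ℝ → ℝ} (hF : ∀ n m, Sm m (F n))
    (hg : ∀ k, ∃ C q : ℝ, 0 ≤ C ∧ 0 ≤ q ∧ q < 1 ∧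
      ∀ n t x, |iteratedDeriv k (F (n + 1) t) x - iteratedDeriv k (F n t) x| ≤ C * q ^ n) :
    ∃ f : ℝ → ℝ → ℝ, (∀ m, Sm m f) ∧ ∀ k, TendstoUniformly
      (fun n (p : ℝ × ℝ) => iteratedDeriv k (F n p.1) p.2) (fun p => iteratedDeriv k (f p.1) p.2)
      atTop := by
  have hlim : ∀ k, ∃ G : ℝ → ℝ → ℝ, TendstoUniformly
      (fun n (p : ℝ × ℝ) => iteratedDeriv k (F n p.1) p.2) (fun p => G p.1 p.2) atTop := by
    intro k
    obtain ⟨C, q, hC, hq, hq1, hk⟩ := hg k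
    have hd : ∀ t x n, dist (iteratedDeriv k (F n t) x) (iteratedDeriv k (F (n + 1) t) x)
        ≤ C * q ^ n := fun t x n => by
      rw [dist_comm, Real.dist_eq]; exact hk n t x
    choose G hG using fun t x => cauchySeq_tendsto_of_complete
      (cauchySeq_of_le_geometric q C hq1 (hd t x))
    refine ⟨G, Metric.tendstoUniformly_iff.2 fun ε hε => ?_⟩
    have h0 : Tendsto (fun n : ℕ => C * q ^ n / (1 - q)) atTop (𝓝 0) := by
      simpa using ((tendsto_pow_atTop_nhds_zero_of_lt_one hq hq1).const_mul C).div_const (1 - q)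
    filter_upwards [h0.eventually (gt_mem_nhds hε)] with n hn p
    rw [dist_comm]
    exact (dist_le_of_le_geometric_of_tendsto q C hq1 (hd p.1 p.2) (hG p.1 p.2) n).trans_lt hn
  choose G hG using hlim
  have hsec : ∀ k t, TendstoUniformly (fun n x => iteratedDeriv k (F n t) x) (G k t) atTop :=
    fun k t => (hG k).comp fun x => (t, x)
  have hder : ∀ k t x, HasDerivAt (G k t) (G (k + 1) t x) x := fun k t x => by
    refine hasDerivAt_of_tendstoUniformly (hsec (k + 1) t) (.of_forall fun n y => ?_)
      (fun y => (hsec k t).tendsto_at y) x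
    have := ((Sm.iteratedDeriv (n := 1) (k := k) (hF n (1 + k))).hasDerivAt t y)
    rwa [← iteratedDeriv_succ] at this
  have hcont : ∀ k, Continuous fun p : ℝ × ℝ => G k p.1 p.2 := fun k =>
    (hG k).continuous (Frequently.of_forall fun n =>
      (Sm.iteratedDeriv (n := 0) (k := k) (hF n (0 + k))).continuous)
  have hsm : ∀ m k, Sm m (G k) := fun m => by
    induction m with
    | zero => exact hcont
    | succ m ih => exact fun k => Sm.of_hasDerivAt (hcont k) (hder k) (ih (k + 1))
  have hit : ∀ k t, iteratedDeriv k (G 0 t) = G k t := fun k t => by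
    induction k with
    | zero => simp
    | succ k ih => rw [iteratedDeriv_succ, ih]; ext x; exact (hder k t x).deriv
  exact ⟨G 0, fun m => hsm m 0, fun k => by simpa only [hit] using hG k⟩

lemma IsEvolution.of_tendsto {T : ℝ} {F : ℕ → ℝ → ℝ → ℝ} {f : ℝ → ℝ → ℝ}
    (hF : ∀ n, IsEvolution T (F n)) (hf : ∀ m, Sm m f)
    (h : ∀ t x, Tendsto (fun n => F n t x) atTop (𝓝 (f t x))) : IsEvolution T f where
  sm := hf
  clamp t := funext fun x => tendsto_nhds_unique (h _ x) (by simpa only [(hF _).clamp] using h t x)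
  odd t x := tendsto_nhds_unique (h t (-x)) (by simpa only [(hF _).odd t x] using (h t x).neg)
  supp t x hx := tendsto_nhds_unique (h t x) (by
    simpa only [(hF _).supp t x hx] using tendsto_const_nhds)
  nonneg t x hx := ge_of_tendsto' (h t x) fun n => (hF n).nonneg t x hx

lemma tendsto_conv_of_tendstoUniformly {e a : ℝ} (ha : 0 < a) (he : 0 ≤ e) (hea : e ≤ a)
    {F : ℕ → ℝ → ℝ} {f : ℝ → ℝ} (hF : ∀ n, Continuous (F n)) {B : ℝ} (hB : ∀ n x, |F n x| ≤ B)
    (h : TendstoUniformly F f atTop) (x : ℝ) :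
    Tendsto (fun n => conv e a (F n) x) atTop (𝓝 (conv e a f x)) := by
  refine Tendsto.const_mul _ ?_
  refine tendsto_integral_of_dominated_convergence (fun z => |kern e a z| * B)
    (fun n => ?_) ((integrable_kern ha he hea).abs.mul_const B) (fun n => ae_of_all _ fun z => ?_)
    (ae_of_all _ fun z => (h.tendsto_at _).const_mul _)
  · exact (measurable_kern e a).aestronglyMeasurable.mul
      ((hF n).comp (continuous_sub_left x)).aestronglyMeasurable
  · rw [norm_mul]
    exact mul_le_mul_of_nonneg_left (hB n _) (abs_nonneg _)

section Convergence

variable {a T : ℝ} {ω₀ ρ₀ : ℝ → ℝ} {W R : ℕ → ℝ → ℝ → ℝ}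

lemma IsEvolution.abs_le_of_nsq_le {T : ℝ} {ω : ℝ → ℝ → ℝ} (h : IsEvolution T ω) {j : ℕ} {t B : ℝ}
    (hB : nsq (iteratedDeriv (j + 1) (ω t)) ≤ B) (x : ℝ) :
    |iteratedDeriv j (ω t) x| ≤ 1 + 2 * B := by
  have := (h.sq_le j t x).trans (mul_le_mul_of_nonneg_left hB zero_le_two)
  rw [← sq_abs] at this
  nlinarith [sq_nonneg (|iteratedDeriv j (ω t) x| - 1)]

namespace IsIteration

/-- The difference of consecutive iterates contracts by 1/2 in a norm weighted by an exponential in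
time, so the interval need not be shortened again. -/
lemma gap_le (h : IsIteration a T ω₀ ρ₀ W R) (ha : 0 < a) (hT : 0 ≤ T)
    (hB : ∀ k, ∃ B, ∀ n t, energy (k + 1) (W n t) (R n t) ≤ B) :
    ∃ C : ℝ, 0 ≤ C ∧ ∀ n t, gap (W (n + 1) t) (R (n + 1) t) (W n t) (R n t) ≤ C * (1 / 2) ^ n := by
  obtain ⟨B₁, hB₁⟩ := hB 0
  obtain ⟨B₂, hB₂⟩ := hB 1
  have b1 : ∀ k n t, nsq (iteratedDeriv k (W n t)) ≤ energy k (W n t) (R n t) := fun k n t =>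
    le_add_of_nonneg_right (nsq_nonneg _)
  have b2 : ∀ k n t, nsq (iteratedDeriv k (R n t)) ≤ energy k (W n t) (R n t) := fun k n t =>
    le_add_of_nonneg_left (nsq_nonneg _)
  have hB₁0 : 0 ≤ B₁ := (energy_nonneg _ _ _).trans (hB₁ 0 0)
  have hB₂0 : 0 ≤ B₂ := (energy_nonneg _ _ _).trans (hB₂ 0 0)
  set C₁ : ℝ := (3 * (1 + 128 * B₁) + 3) + 5 * (2 * (B₁ + B₂)) * 16
  have hC₁ : 0 ≤ C₁ := by positivity
  have key : ∀ n, ∀ t ∈ Icc 0 T, gap (W (n + 1) t) (R (n + 1) t) (W n t) (R n t)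
      ≤ (16 * B₁ * (1 / 2) ^ n) * Real.exp ((1 + 2) * C₁ * t) := by
    intro n
    induction n with
    | zero =>
      intro t ht
      have e1 : 1 ≤ Real.exp ((1 + 2) * C₁ * t) := Real.one_le_exp (by have := ht.1; positivity)
      have e2 : gap (W (0 + 1) t) (R (0 + 1) t) (W 0 t) (R 0 t) ≤ 16 * B₁ := by
        have i1 := nsq_add_le ((h.vorticity 1).contDiff t).continuous
          ((h.vorticity 0).contDiff t).continuous
        have i2 := nsq_add_le ((h.density 1).contDiff t).continuous
          ((h.density 0).contDiff t).continuous
        have j1 := fun n => nsq_iteratedDeriv_le ((h.vorticity n).contDiff t)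
          ((h.vorticity n).supp t) 0 1
        have j2 := fun n => nsq_iteratedDeriv_le ((h.density n).contDiff t)
          ((h.density n).supp t) 0 1
        simp only [iteratedDeriv_zero, pow_one, zero_add] at j1 j2
        have k1 := hB₁ 1 t
        have k0 := hB₁ 0 t
        unfold energy at k1 k0
        simp only [zero_add] at k1 k0
        unfold gap
        simp only [zero_add]
        linarith [j1 0, j1 1, j2 0, j2 1]
      have := mul_le_mul e2 e1 zero_le_one (by positivity)
      simpa using this
    | succ n ih =>
      intro t ht
      obtain ⟨Y', hY⟩ := gap_inequality (sm_velocity ha hT (h.vorticity (n + 1)) 1)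
        (sm_velocity ha hT (h.vorticity n) 1) ((h.vorticity (n + 1 + 1)).sm 1)
        ((h.vorticity (n + 1)).sm 1) ((h.density (n + 1 + 1)).sm 1) ((h.density (n + 1)).sm 1)
        (h.vorticity _).supp (h.vorticity _).supp (h.density _).supp (h.density _).supp
        (fun t => odd_zero (conv_odd ((h.vorticity _).odd t)))
        (fun t => odd_zero (conv_odd ((h.vorticity _).odd t)))
        (h.transported (n + 1)) (h.transported n)
      -- With m = 2 the previous bound is twice the new one. The new difference vanishes at t = 0
      -- since all iterates share the same data.
      refine le_of_deriv_le_add (m := 2) (g := fun t => gap (W (n + 1) t) (R (n + 1) t) (W n t) (R n t))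
        hC₁ (fun t ht => (hY t ht).1) (fun t ht => ?_) (fun t ht => ?_) ?_ ht
      · have hR : ∀ x, deriv (W (n + 1) t) x ^ 2 ≤ 2 * (B₁ + B₂) := fun x => by
          have := (h.vorticity (n + 1)).sq_le 1 t x
          rw [iteratedDeriv_one] at this
          linarith [b1 2 (n + 1) t, hB₂ (n + 1) t]
        have hR' : ∀ x, deriv (R (n + 1) t) x ^ 2 ≤ 2 * (B₁ + B₂) := fun x => by
          have := (h.density (n + 1)).sq_le 1 t x
          rw [iteratedDeriv_one] at this
          linarith [b2 2 (n + 1) t, hB₂ (n + 1) t]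
        have hR'' : ∀ x, R (n + 1) t x ^ 2 ≤ 2 * (B₁ + B₂) := fun x => by
          have := (h.density (n + 1)).sq_le 0 t x
          rw [iteratedDeriv_zero] at this
          linarith [b2 1 (n + 1) t, hB₁ (n + 1) t]
        have := (hY t ht).2 (1 + 128 * B₁) (2 * (B₁ + B₂)) _
          (fun x hx => (abs_deriv_velocity_le ha hT (h.vorticity (n + 1)) t hx).trans
            (by linarith [b1 1 (n + 1) t, hB₁ (n + 1) t]))
          (fun x _ => hR x) (fun x _ => hR' x) (fun x _ => hR'' x)
          (nsq_deriv_velocity_sub_le ha (contDiff_of_top ((h.vorticity (n + 1)).contDiff t) 1)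
            (contDiff_of_top ((h.vorticity n).contDiff t) 1) ((h.vorticity (n + 1)).supp t)
            ((h.vorticity n).supp t))
        refine this.trans ?_
        have g1 : nsq (fun x => W (n + 1) t x - W n t x)
            ≤ gap (W (n + 1) t) (R (n + 1) t) (W n t) (R n t) :=
          le_add_of_nonneg_right (nsq_nonneg _)
        have g2 := gap_nonneg (W (n + 1) t) (R (n + 1) t) (W n t) (R n t)
        have g3 := gap_nonneg (W (n + 1 + 1) t) (R (n + 1 + 1) t) (W (n + 1) t) (R (n + 1) t)
        refine add_le_add (mul_le_mul_of_nonneg_right ?_ g3) ?_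
        · exact le_add_of_nonneg_right (by positivity)
        · rw [← mul_assoc]
          refine mul_le_mul ?_ g1 (nsq_nonneg _) hC₁
          exact le_add_of_nonneg_left (by positivity)
      · refine (ih t ht).trans (le_of_eq ?_)
        rw [pow_succ]
        ring
      · rw [h.initial_vorticity, h.initial_density, h.initial_vorticity, h.initial_density]
        simp only [gap, sub_self, nsq]
        norm_num
        positivity
  refine ⟨16 * B₁ * Real.exp ((1 + 2) * C₁ * T), by positivity, fun n t => ?_⟩
  have ht := clamp_mem hT t
  have := key n _ ht
  rw [(h.vorticity _).clamp, (h.vorticity _).clamp, (h.density _).clamp, (h.density _).clamp] at this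
  refine this.trans ?_
  have h2 : Real.exp ((1 + 2) * C₁ * clamp T t) ≤ Real.exp ((1 + 2) * C₁ * T) :=
    Real.exp_le_exp.2 (mul_le_mul_of_nonneg_left ht.2 (by positivity))
  have h3 := mul_le_mul_of_nonneg_left h2 (show 0 ≤ 16 * B₁ * (1 / 2) ^ n by positivity)
  linarith

/-- Geometric decay in L² and uniform bounds in all H^k interpolate to geometric uniform convergence
of every spatial derivative; dominated convergence carries the integrated equations to the limit. -/
lemma exists_limit (h : IsIteration a T ω₀ ρ₀ W R) (ha : 0 < a) (hT : 0 ≤ T)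
    (hB : ∀ k, ∃ B, ∀ n t, energy (k + 1) (W n t) (R n t) ≤ B) :
    ∃ ω ρ, IsEvolution T ω ∧ IsEvolution T ρ ∧ ω 0 = ω₀ ∧ ρ 0 = ρ₀ ∧
      IsTransported T (fun t => conv 0 a (ω t)) ω ρ := by
  obtain ⟨C, hC, hgap⟩ := h.gap_le ha hT hB
  have limit : ∀ F : ℕ → ℝ → ℝ → ℝ, (∀ n, IsEvolution T (F n)) →
      (∀ k, ∃ B, ∀ n t, nsq (iteratedDeriv (k + 1) (F n t)) ≤ B) →
      (∀ n t, nsq (fun x => F (n + 1) t x - F n t x) ≤ C * (1 / 2) ^ n) →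
      ∃ f : ℝ → ℝ → ℝ, IsEvolution T f ∧ ∀ k, TendstoUniformly
        (fun n (p : ℝ × ℝ) => iteratedDeriv k (F n p.1) p.2) (fun p => iteratedDeriv k (f p.1) p.2)
        atTop := by
    intro F hF hb hg
    have hb' : ∀ k, ∃ B, ∀ n t, nsq (iteratedDeriv k (F n t)) ≤ B := fun k => by
      obtain ⟨B, hB⟩ := hb k
      refine ⟨4 * B, fun n t => ?_⟩
      have := nsq_iteratedDeriv_le ((hF n).contDiff t) ((hF n).supp t) k 1
      linarith [hB n t]
    have hcd : ∀ n (t : ℝ), ContDiff ℝ (⊤ : ℕ∞) fun x => F (n + 1) t x - F n t x := fun n t =>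
      ((hF _).contDiff t).sub ((hF _).contDiff t)
    have hit : ∀ k n t x, iteratedDeriv k (fun x => F (n + 1) t x - F n t x) x
        = iteratedDeriv k (F (n + 1) t) x - iteratedDeriv k (F n t) x := fun k n t x =>
      iteratedDeriv_fun_sub (contDiff_of_top ((hF _).contDiff t) k).contDiffAt
        (contDiff_of_top ((hF _).contDiff t) k).contDiffAt
    have hgeo := exists_geometric_sup (h := fun n t x => F (n + 1) t x - F n t x) hcd
      (fun n t x hx => by rw [(hF _).supp t x hx, (hF _).supp t x hx, sub_zero]) (fun k => by
        obtain ⟨B, hB⟩ := hb' k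
        refine ⟨2 * B + 2 * B, fun n t => ?_⟩
        have e : iteratedDeriv k (fun x => F (n + 1) t x - F n t x)
          = fun x => iteratedDeriv k (F (n + 1) t) x - iteratedDeriv k (F n t) x :=
          funext (hit k n t)
        rw [e]
        exact (nsq_add_le (contDiff_iteratedDeriv ((hF _).contDiff t) k).continuous
          (contDiff_iteratedDeriv ((hF _).contDiff t) k).continuous).trans
          (add_le_add (by linarith [hB (n + 1) t]) (by linarith [hB n t])))
      hC (by norm_num) (by norm_num) hg
    obtain ⟨f, hf, hlim⟩ := exists_limit_of_geometric (fun n => (hF n).sm)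
      (by simpa only [hit] using hgeo)
    exact ⟨f, .of_tendsto hF hf fun t x => by
      simpa using (hlim 0).tendsto_at (t, x), hlim⟩
  obtain ⟨ω, hω, lω⟩ := limit W h.vorticity (fun k => (hB k).imp fun B hB n t =>
      (le_add_of_nonneg_right (nsq_nonneg _)).trans (hB n t)) fun n t =>
    (le_add_of_nonneg_right (nsq_nonneg _)).trans (hgap n t)
  obtain ⟨ρ, hρ, lρ⟩ := limit R h.density (fun k => (hB k).imp fun B hB n t =>
      (le_add_of_nonneg_left (nsq_nonneg _)).trans (hB n t)) fun n t =>
    (le_add_of_nonneg_left (nsq_nonneg _)).trans (hgap n t)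
  have pω : ∀ t x, Tendsto (fun n => W n t x) atTop (𝓝 (ω t x)) := fun t x => by
    simpa using (lω 0).tendsto_at (t, x)
  have pρ : ∀ t x, Tendsto (fun n => R n t x) atTop (𝓝 (ρ t x)) := fun t x => by
    simpa using (lρ 0).tendsto_at (t, x)
  have pω' : ∀ t x, Tendsto (fun n => deriv (W n t) x) atTop (𝓝 (deriv (ω t) x)) := fun t x => by
    simpa using (lω 1).tendsto_at (t, x)
  have pρ' : ∀ t x, Tendsto (fun n => deriv (R n t) x) atTop (𝓝 (deriv (ρ t) x)) := fun t x => by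
    simpa using (lρ 1).tendsto_at (t, x)
  obtain ⟨B₁, hB₁⟩ := hB 0
  obtain ⟨B₂, hB₂⟩ := hB 1
  have bω : ∀ n t x, |W n t x| ≤ 1 + 2 * B₁ := fun n t x => by
    simpa using (h.vorticity n).abs_le_of_nsq_le (j := 0)
      ((le_add_of_nonneg_right (nsq_nonneg _)).trans (hB₁ n t)) x
  have bω' : ∀ n t x, |deriv (W n t) x| ≤ 1 + 2 * B₂ := fun n t x => by
    simpa using (h.vorticity n).abs_le_of_nsq_le (j := 1)
      ((le_add_of_nonneg_right (nsq_nonneg _)).trans (hB₂ n t)) x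
  have bρ : ∀ n t x, |R n t x| ≤ 1 + 2 * B₁ := fun n t x => by
    simpa using (h.density n).abs_le_of_nsq_le (j := 0)
      ((le_add_of_nonneg_left (nsq_nonneg _)).trans (hB₁ n t)) x
  have bρ' : ∀ n t x, |deriv (R n t) x| ≤ 1 + 2 * B₂ := fun n t x => by
    simpa using (h.density n).abs_le_of_nsq_le (j := 1)
      ((le_add_of_nonneg_left (nsq_nonneg _)).trans (hB₂ n t)) x
  have B₁0 : 0 ≤ 1 + 2 * B₁ := (abs_nonneg _).trans (bω 0 0 0)
  have B₂0 : 0 ≤ 1 + 2 * B₂ := (abs_nonneg _).trans (bω' 0 0 0)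
  have uω : ∀ t, TendstoUniformly (fun n => W n t) (ω t) atTop := fun t => by
    simpa [Function.comp_def] using (lω 0).comp fun x => (t, x)
  have uω' : ∀ t, TendstoUniformly (fun n => deriv (W n t)) (deriv (ω t)) atTop := fun t => by
    simpa [Function.comp_def] using (lω 1).comp fun x => (t, x)
  set m := kernMass a with hm
  have hm0 : 0 ≤ m := kernMass_nonneg a
  have pv : ∀ t x, Tendsto (fun n => conv 0 a (W n t) x) atTop (𝓝 (conv 0 a (ω t) x)) :=
    fun t x => tendsto_conv_of_tendstoUniformly ha le_rfl ha.le
      (fun n => ((h.vorticity n).contDiff t).continuous) (fun n => bω n t) (uω t) x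
  have ev : ∀ {w : ℝ → ℝ → ℝ}, IsEvolution T w → ∀ t x,
      deriv (conv 0 a (w t)) x = conv 0 a (deriv (w t)) x := fun hw t x => by
    rw [deriv_conv ha le_rfl ha.le (hw.sm 1) (hw.bd hT 1)]
  have pv' : ∀ t x, Tendsto (fun n => deriv (conv 0 a (W n t)) x) atTop
      (𝓝 (deriv (conv 0 a (ω t)) x)) := fun t x => by
    rw [ev hω]
    simp only [ev (h.vorticity _)]
    exact tendsto_conv_of_tendstoUniformly ha le_rfl ha.le
      (fun n => ((h.vorticity n).sm 1).deriv.continuous_space t) (fun n => bω' n t) (uω' t) x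
  have bv : ∀ n t x, |conv 0 a (W n t) x| ≤ m * (1 + 2 * B₁) := fun n t x =>
    abs_conv_le ha le_rfl ha.le (bω n t) x
  have bv' : ∀ n t x, |deriv (conv 0 a (W n t)) x| ≤ m * (1 + 2 * B₂) := fun n t x => by
    rw [ev (h.vorticity n)]
    exact abs_conv_le ha le_rfl ha.le (bω' n t) x
  have eH : ∀ {w r : ℝ → ℝ → ℝ}, IsEvolution T w → IsEvolution T r → ∀ s x,
      -deriv (fun y => conv 0 a (w s) y * r s y) x
        = -(deriv (conv 0 a (w s)) x * r s x + conv 0 a (w s) x * deriv (r s) x) :=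
    fun hw hr s x => by
      have := (((sm_velocity ha hT hw 1).hasDerivAt s x).mul ((hr.sm 1).hasDerivAt s x)).deriv
      rw [neg_inj]
      exact this
  have eω0 : ω 0 = ω₀ := funext fun x => tendsto_nhds_unique (pω 0 x) (by
    simp only [h.initial_vorticity]; exact tendsto_const_nhds)
  have eρ0 : ρ 0 = ρ₀ := funext fun x => tendsto_nhds_unique (pρ 0 x) (by
    simp only [h.initial_density]; exact tendsto_const_nhds)
  refine ⟨ω, ρ, hω, hρ, eω0, eρ0, fun t ht x => ?_, fun t ht x => ?_⟩
  · refine tendsto_nhds_unique ((pω t x).comp (tendsto_add_atTop_nat 1)) ?_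
    have e : ((fun n => W n t x) ∘ fun n => n + 1) = fun n => ω 0 x
        + ∫ s in (0 : ℝ)..t, (R (n + 1) s x - conv 0 a (W n s) x * deriv (W (n + 1) s) x) :=
      funext fun n => by
        simp only [Function.comp_apply, (h.transported n).vorticity t ht x, h.initial_vorticity,
          eω0]
    rw [e]
    refine Tendsto.const_add _ (intervalIntegral.tendsto_integral_filter_of_dominated_convergence
      (fun _ => (1 + 2 * B₁) + m * (1 + 2 * B₁) * (1 + 2 * B₂)) (.of_forall fun n => ?_)
      (.of_forall fun n => ae_of_all _ fun s _ => ?_) intervalIntegrable_const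
      (ae_of_all _ fun s _ => ?_))
    · exact (((h.density (n + 1)).sm 0).sub ((sm_velocity ha hT (h.vorticity n) 0).mul
        ((h.vorticity (n + 1)).sm 1).deriv)).continuous_time x |>.aestronglyMeasurable
    · rw [Real.norm_eq_abs]
      refine (abs_sub _ _).trans (add_le_add (bρ _ _ _) ?_)
      rw [abs_mul]
      exact mul_le_mul (bv _ _ _) (bω' _ _ _) (abs_nonneg _) (by positivity)
    · exact ((pρ s x).comp (tendsto_add_atTop_nat 1)).sub
        ((pv s x).mul ((pω' s x).comp (tendsto_add_atTop_nat 1)))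
  · refine tendsto_nhds_unique ((pρ t x).comp (tendsto_add_atTop_nat 1)) ?_
    have e : ((fun n => R n t x) ∘ fun n => n + 1) = fun n => ρ 0 x
        + ∫ s in (0 : ℝ)..t, -deriv (fun y => conv 0 a (W n s) y * R (n + 1) s y) x :=
      funext fun n => by
        simp only [Function.comp_apply, (h.transported n).density t ht x, h.initial_density, eρ0]
    rw [e]
    refine Tendsto.const_add _ (intervalIntegral.tendsto_integral_filter_of_dominated_convergence
      (fun _ => m * (1 + 2 * B₂) * (1 + 2 * B₁) + m * (1 + 2 * B₁) * (1 + 2 * B₂))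
      (.of_forall fun n => ?_)
      (.of_forall fun n => ae_of_all _ fun s _ => ?_) intervalIntegrable_const
      (ae_of_all _ fun s _ => ?_))
    · exact ((sm_velocity ha hT (h.vorticity n) 1).mul
        ((h.density (n + 1)).sm 1)).deriv.neg.continuous_time x |>.aestronglyMeasurable
    · rw [eH (h.vorticity n) (h.density (n + 1)), Real.norm_eq_abs, abs_neg]
      refine (abs_add_le _ _).trans (add_le_add ?_ ?_)
      · rw [abs_mul]
        exact mul_le_mul (bv' _ _ _) (bρ _ _ _) (abs_nonneg _) (by positivity)
      · rw [abs_mul]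
        exact mul_le_mul (bv _ _ _) (bρ' _ _ _) (abs_nonneg _) (by positivity)
    · rw [eH hω hρ]
      simp only [eH (h.vorticity _) (h.density _)]
      exact (((pv' s x).mul ((pρ s x).comp (tendsto_add_atTop_nat 1))).add
        ((pv s x).mul ((pρ' s x).comp (tendsto_add_atTop_nat 1)))).neg

end IsIteration

end Convergence

/-- Local existence, on a time interval depending only on the size of the data. -/
theorem local_existence {a : ℝ} (ha : 0 < a) (M : ℝ) : ∃ τ > 0, ∀ ω₀ ρ₀ : ℝ → ℝ, IsProfile ω₀ →
    IsProfile ρ₀ → energy 1 ω₀ ρ₀ ≤ M → ∃ ω ρ, IsEvolution τ ω ∧ IsEvolution τ ρ ∧ ω 0 = ω₀ ∧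
      ρ 0 = ρ₀ ∧ IsTransported τ (fun t => conv 0 a (ω t)) ω ρ := by
  have hlog : 0 < Real.log 2 := Real.log_pos (by norm_num)
  -- This time turns the smallness condition of `energy_one_le`, taken with |M|, into an equality.
  have hτ : 0 < Real.log 2 / (10000 * (1 + 2 * |M|)) := by positivity
  refine ⟨_, hτ, fun ω₀ ρ₀ hω hρ hE => ?_⟩
  obtain ⟨W, R, h⟩ := exists_isIteration ha hτ.le hω hρ
  refine h.exists_limit ha hτ.le fun k => h.exists_energy_le ha hτ.le
    (h.energy_one_le ha hτ.le (hE.trans (le_abs_self M)) (le_of_eq ?_)) k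
  field_simp

/-! ### Characteristics and uniqueness -/

section Characteristics

variable {T B K : ℝ} {v ω ρ Φ : ℝ → ℝ → ℝ}

/-- The material derivative. Near time t the composition splits into a spatial part with f frozen at
t and an integral over [t,r], the latter handled by `hasDerivAt_diagonal_integral`. -/
lemma IsFlow.hasDerivWithinAt_comp (hT : 0 ≤ T) (h : IsFlow T v Φ) {f H : ℝ → ℝ → ℝ} (hf : Sm 1 f)
    (hH : Sm 0 H) (hfH : ∀ t ∈ Icc 0 T, ∀ x, f t x = f 0 x + ∫ s in (0 : ℝ)..t, H s x)
    {t : ℝ} (ht : t ∈ Icc 0 T) (x : ℝ) :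
    HasDerivWithinAt (fun s => f s (Φ s x)) (H t (Φ t x) + v t (Φ t x) * deriv (f t) (Φ t x))
      (Icc 0 T) t := by
  have h1 : HasDerivWithinAt (fun r => f t (Φ r x)) (deriv (f t) (Φ t x) * v t (Φ t x)) (Icc 0 T) t :=
    HasDerivAt.comp_hasDerivWithinAt (h₂ := f t) (h := fun r => Φ r x) t (hf.hasDerivAt t _)
      (h.ode x t ht)
  have hkc : Continuous fun p : ℝ × ℝ => H p.1 (Φ p.2 x) :=
    hH.continuous.comp (continuous_fst.prodMk ((h.continuous_time hT x).comp continuous_snd))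
  have h2 := (hasDerivAt_diagonal_integral (h := fun s r => H s (Φ r x)) hkc t).hasDerivWithinAt
    (s := Icc 0 T)
  have heq : ∀ r ∈ Icc 0 T, f r (Φ r x) = f t (Φ r x) + ∫ s in t..r, H s (Φ r x) := by
    intro r hr
    have hc := hH.continuous_time (Φ r x)
    rw [hfH r hr, hfH t ht, ← intervalIntegral.integral_add_adjacent_intervals
      (hc.intervalIntegrable 0 t) (hc.intervalIntegrable t r)]
    ring
  refine ((h1.add h2).congr heq (heq t ht)).congr_deriv ?_
  ring

namespace IsTransported

lemma sm_vorticity_rhs (hv : Sm 1 v) (hω : Sm 1 ω) (hρ : Sm 1 ρ) :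
    Sm 0 fun s x => ρ s x - v s x * deriv (ω s) x :=
  hρ.of_succ.sub (hv.of_succ.mul hω.deriv)

lemma deriv_mul_eq (hv : Sm 1 v) (hρ : Sm 1 ρ) (t x : ℝ) :
    deriv (fun y => v t y * ρ t y) x = deriv (v t) x * ρ t x + v t x * deriv (ρ t) x :=
  ((hv.hasDerivAt t x).mul (hρ.hasDerivAt t x)).deriv

lemma vorticity_comp (htr : IsTransported T v ω ρ) (hT : 0 ≤ T) (h : IsFlow T v Φ) (hv : Sm 1 v)
    (hK : ∀ t x, |deriv (v t) x| ≤ K) (hω : Sm 1 ω) (hρ : Sm 1 ρ) {t : ℝ} (ht : t ∈ Icc 0 T)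
    (x : ℝ) : ω t (Φ t x) = ω 0 x + ∫ s in (0 : ℝ)..t, ρ s (Φ s x) := by
  have hΦ := h.continuous hT hv hK
  have := eq_integral_of_hasDerivWithinAt (T := T) (f := fun s => ω s (Φ s x))
    (g := fun s => ρ s (Φ s x)) ?_ (fun s hs => ?_) ht
  · rwa [h.zero] at this
  · exact (hρ.continuous.comp (continuous_id.prodMk (h.continuous_time hT x))).continuousOn
  · refine (h.hasDerivWithinAt_comp hT hω (sm_vorticity_rhs hv hω hρ) htr.vorticity hs x).congr_deriv ?_
    ring

lemma density_comp (htr : IsTransported T v ω ρ) (hT : 0 ≤ T) (h : IsFlow T v Φ) (hv : Sm 1 v)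
    (hρ : Sm 1 ρ) {t : ℝ} (ht : t ∈ Icc 0 T) (x : ℝ) :
    ρ t (Φ t x) = ρ 0 x * Real.exp (∫ s in (0 : ℝ)..t, -deriv (v s) (Φ s x)) := by
  have := eq_mul_exp_of_hasDerivWithinAt (T := T) (f := fun s => ρ s (Φ s x))
    (q := fun s => -deriv (v s) (Φ s x)) ?_ (fun s hs => ?_) ht
  · rwa [h.zero] at this
  · exact (hv.deriv.continuous.comp (continuous_id.prodMk (h.continuous_time hT x))).neg
  · refine (h.hasDerivWithinAt_comp hT hρ ((hv.mul hρ).deriv.neg) htr.density hs x).congr_deriv ?_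
    rw [deriv_mul_eq hv hρ]
    ring

end IsTransported

end Characteristics

/-- The solutions of the system with the density gradient `ρ = θ_x` in place of `θ`, once
continuously differentiable in space, constant outside the time interval `[0,T]`. -/
structure IsRegular (a T : ℝ) (ω ρ : ℝ → ℝ → ℝ) : Prop where
  sm_vorticity : Sm 1 ω
  sm_density : Sm 1 ρ
  clamp_vorticity : ∀ t, ω (clamp T t) = ω t
  clamp_density : ∀ t, ρ (clamp T t) = ρ t
  odd : ∀ t, Function.Odd (ω t)
  supp_vorticity : ∀ t x, 1 < |x| → ω t x = 0
  supp_density : ∀ t x, 1 < |x| → ρ t x = 0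
  transported : IsTransported T (fun t => conv 0 a (ω t)) ω ρ

section Uniqueness

variable {a T : ℝ}

lemma IsEvolution.isRegular {ω ρ : ℝ → ℝ → ℝ} (hω : IsEvolution T ω) (hρ : IsEvolution T ρ)
    (htr : IsTransported T (fun t => conv 0 a (ω t)) ω ρ) : IsRegular a T ω ρ :=
  ⟨hω.sm 1, hρ.sm 1, hω.clamp, hρ.clamp, hω.odd, hω.supp, hρ.supp, htr⟩

lemma eq_zero_of_nsq_le_zero {f : ℝ → ℝ} (hf : Continuous f) (hs : ∀ x, 1 < |x| → f x = 0)
    (h : nsq f ≤ 0) (x : ℝ) : f x = 0 := by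
  by_contra hx
  have hx1 : x ∈ Icc (-1 : ℝ) 1 := abs_le.1 (not_lt.1 fun h => hx (hs x h))
  have := intervalIntegral.integral_pos (a := -1) (b := 1) (f := fun x => f x ^ 2) (by norm_num)
    (hf.pow 2).continuousOn (fun x _ => sq_nonneg _) ⟨x, hx1, by positivity⟩
  exact absurd h (not_le.2 this)

namespace IsRegular

variable {ω ρ ω' ρ' : ℝ → ℝ → ℝ}

lemma bd (h : IsRegular a T ω ρ) (hT : 0 ≤ T) : Bd 1 ω :=
  Bd.of_clamp hT h.sm_vorticity h.clamp_vorticity h.supp_vorticity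

lemma sm_velocity (h : IsRegular a T ω ρ) (ha : 0 < a) (hT : 0 ≤ T) :
    Sm 1 fun t => conv 0 a (ω t) := h.sm_vorticity.conv ha le_rfl ha.le (h.bd hT)

lemma bd_velocity (h : IsRegular a T ω ρ) (ha : 0 < a) (hT : 0 ≤ T) :
    Bd 1 fun t => conv 0 a (ω t) := Bd.conv ha le_rfl ha.le h.sm_vorticity (h.bd hT)

/-- Uniqueness for the evolution problem. -/
theorem unique (h : IsRegular a T ω ρ) (h' : IsRegular a T ω' ρ') (ha : 0 < a) (hT : 0 ≤ T)
    (hω : ω 0 = ω' 0) (hρ : ρ 0 = ρ' 0) {t : ℝ} (ht : t ∈ Icc 0 T) : ω t = ω' t ∧ ρ t = ρ' t := by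
  obtain ⟨b, hb⟩ := (h.bd_velocity ha hT).deriv.bound
  obtain ⟨R₁, hR₁⟩ := (h'.bd hT).deriv.bound
  have hbρ := Bd.of_clamp hT h'.sm_density h'.clamp_density h'.supp_density
  obtain ⟨R₂, hR₂⟩ := hbρ.deriv.bound
  obtain ⟨R₃, hR₃⟩ := hbρ.bound
  have hsq : ∀ {y R : ℝ}, |y| ≤ R → y ^ 2 ≤ R ^ 2 := fun h => by
    rw [← sq_abs]; exact pow_le_pow_left₀ (abs_nonneg _) h 2
  obtain ⟨Y', hY⟩ := gap_inequality (h.sm_velocity ha hT) (h'.sm_velocity ha hT) h.sm_vorticity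
    h'.sm_vorticity h.sm_density h'.sm_density h.supp_vorticity h'.supp_vorticity h.supp_density
    h'.supp_density (fun t => odd_zero (conv_odd (h.odd t)))
    (fun t => odd_zero (conv_odd (h'.odd t))) h.transported h'.transported
  have key := le_mul_exp_of_deriv_le (κ := fun _ => (3 * b + 3) + 5 * (R₁ ^ 2 + R₂ ^ 2 + R₃ ^ 2) * 16)
    continuous_const (fun t ht => (hY t ht).1) (fun t ht => ?_) ht
  · have h0 : gap (ω 0) (ρ 0) (ω' 0) (ρ' 0) = 0 := by
      rw [hω, hρ]; simp [gap, nsq]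
    rw [h0, zero_mul] at key
    have n1 := nsq_nonneg fun x => ω t x - ω' t x
    have n2 := nsq_nonneg fun x => ρ t x - ρ' t x
    unfold gap at key
    refine ⟨funext fun x => sub_eq_zero.1 ?_, funext fun x => sub_eq_zero.1 ?_⟩
    · exact eq_zero_of_nsq_le_zero (f := fun x => ω t x - ω' t x)
        ((h.sm_vorticity.continuous_space t).sub (h'.sm_vorticity.continuous_space t))
        (fun x hx => by rw [h.supp_vorticity t x hx, h'.supp_vorticity t x hx, sub_zero])
        (by linarith) x
    · exact eq_zero_of_nsq_le_zero (f := fun x => ρ t x - ρ' t x)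
        ((h.sm_density.continuous_space t).sub (h'.sm_density.continuous_space t))
        (fun x hx => by rw [h.supp_density t x hx, h'.supp_density t x hx, sub_zero])
        (by linarith) x
  · have hcd : ∀ {f : ℝ → ℝ → ℝ}, Sm 1 f → ContDiff ℝ 1 (f t) := fun h => by
      exact_mod_cast h.contDiff t
    refine ((hY t ht).2 b (R₁ ^ 2 + R₂ ^ 2 + R₃ ^ 2) _ (fun x _ => hb t x) (fun x _ => ?_)
      (fun x _ => ?_) (fun x _ => ?_) (nsq_deriv_velocity_sub_le ha (hcd h.sm_vorticity)
        (hcd h'.sm_vorticity) (h.supp_vorticity t) (h'.supp_vorticity t))).trans ?_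
    · linarith [hsq (hR₁ t x), sq_nonneg R₂, sq_nonneg R₃]
    · linarith [hsq (hR₂ t x), sq_nonneg R₁, sq_nonneg R₃]
    · linarith [hsq (hR₃ t x), sq_nonneg R₂, sq_nonneg R₁]
    · have g1 : nsq (fun x => ω t x - ω' t x) ≤ gap (ω t) (ρ t) (ω' t) (ρ' t) :=
        le_add_of_nonneg_right (nsq_nonneg _)
      have := mul_le_mul_of_nonneg_left g1
        (show 0 ≤ 5 * (R₁ ^ 2 + R₂ ^ 2 + R₃ ^ 2) * 16 by positivity)
      linarith

end IsRegular

end Uniqueness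

/-! ### Classical solutions in terms of vorticity and density gradient -/

section InitialData

variable {ω₀ θ₀ : ℝ → ℝ}

lemma eq_zero_of_tsupport_subset {f : ℝ → ℝ} (h : tsupport f ⊆ Icc (-1) 1) {x : ℝ}
    (hx : 1 < |x|) : f x = 0 :=
  image_eq_zero_of_notMem_tsupport fun hmem => absurd (abs_le.2 (h hmem)) (not_le.2 hx)

lemma tsupport_subset_of_eq_zero {f : ℝ → ℝ} (h : ∀ x, 1 < |x| → f x = 0) :
    tsupport f ⊆ Icc (-1) 1 :=
  closure_minimal (fun x hx => abs_le.1 (not_lt.1 fun hx' => hx (h x hx'))) isClosed_Icc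

lemma nonneg_of_tsupport_subset {f : ℝ → ℝ} (h : tsupport f ⊆ Icc (-1) 1)
    (hf : ∀ x ∈ Icc (0 : ℝ) 1, 0 ≤ f x) (x : ℝ) (hx : 0 ≤ x) : 0 ≤ f x := by
  rcases le_or_gt x 1 with h1 | h1
  · exact hf x ⟨hx, h1⟩
  · exact (eq_zero_of_tsupport_subset h (h1.trans_le (le_abs_self x))).ge

lemma IsInitialData.isProfile_vorticity (h : IsInitialData ω₀ θ₀) : IsProfile ω₀ :=
  ⟨h.smooth_vorticity, h.odd_vorticity, fun _ => eq_zero_of_tsupport_subset h.supp_vorticity,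
    nonneg_of_tsupport_subset h.supp_vorticity h.nonneg_vorticity⟩

lemma IsInitialData.isProfile_density (h : IsInitialData ω₀ θ₀) : IsProfile (deriv θ₀) :=
  ⟨by simpa using contDiff_iteratedDeriv h.smooth_density 1, h.odd_density_deriv,
    fun _ => eq_zero_of_tsupport_subset h.supp_density_deriv,
    nonneg_of_tsupport_subset h.supp_density_deriv h.nonneg_density_deriv⟩

end InitialData

section Classical

variable {a T t₀ : ℝ} {ω₀ θ₀ : ℝ → ℝ} {ω θ : ℝ → ℝ → ℝ}

lemma SpatiallyCk.sm_clamp {m : ℕ∞} {f : ℝ → ℝ → ℝ} (h : SpatiallyCk m T f) (ht₀ : t₀ ∈ Ico 0 T)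
    {n : ℕ} (hn : (n : ℕ∞) ≤ m) : Sm n fun t => f (clamp t₀ t) := by
  have hc : ∀ t, clamp t₀ t ∈ Ico 0 T := fun t =>
    ⟨(clamp_mem ht₀.1 t).1, (clamp_mem ht₀.1 t).2.trans_lt ht₀.2⟩
  refine Sm.of_iteratedDeriv (fun t => (h.1 _ (hc t)).of_le (by exact_mod_cast hn)) fun k hk => ?_
  exact (h.2 k ((by exact_mod_cast hk : (k : ℕ∞) ≤ n).trans hn)).comp_continuous
    (((continuous_clamp t₀).comp continuous_fst).prodMk continuous_snd) fun p => ⟨hc _, mem_univ _⟩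

end Classical

/-- Along the flow of the odd velocity field generated by `ω`, profiles stay profiles. -/
lemma isRegular_of_isTransported {a T B : ℝ} (ha : 0 < a) (hT : 0 ≤ T) {ω ρ : ℝ → ℝ → ℝ}
    (sω : Sm 1 ω) (sρ : Sm 1 ρ) (cω : ∀ t, ω (clamp T t) = ω t) (cρ : ∀ t, ρ (clamp T t) = ρ t)
    (hB : ∀ t x, |ω t x| ≤ B ∧ |deriv (ω t) x| ≤ B) (hodd : ∀ t, Function.Odd (ω t))
    (hω₀ : IsProfile (ω 0)) (hρ₀ : IsProfile (ρ 0))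
    (htr : IsTransported T (fun t => conv 0 a (ω t)) ω ρ) : IsRegular a T ω ρ := by
  have hbd : Bd 1 ω := fun k hk => ⟨B, fun t x => by
    interval_cases k
    · simpa using (hB t x).1
    · simpa using (hB t x).2⟩
  have hv : Sm 1 fun t => conv 0 a (ω t) := sω.conv ha le_rfl ha.le hbd
  have hvb := Bd.conv ha le_rfl ha.le sω hbd
  obtain ⟨V, hV⟩ := hvb.bound
  obtain ⟨K, hK⟩ := hvb.deriv.bound
  have hvodd : ∀ t, Function.Odd (conv 0 a (ω t)) := fun t => conv_odd (hodd t)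
  obtain ⟨Φ, h⟩ := exists_isFlow hT hv hV hK
  have hsurj := h.apply_inv hT hv hV hK
  have hωc := fun t ht x => htr.vorticity_comp hT h hv hK sω sρ (t := t) ht x
  have hρc := fun t ht x => htr.density_comp hT h hv sρ (t := t) ht x
  -- The order matters. Positivity follows from the formulas along characteristics without any
  -- knowledge of the support; it makes the velocity point inwards, and only then is the support
  -- confined.
  have hpos : ∀ t x, 0 ≤ x → 0 ≤ ω t x := fun t x hx => by
    rw [← cω]
    have ht := clamp_mem hT t
    have hi := h.inv_nonneg hT hv hV hK hvodd (clamp T t) hx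
    have := hωc _ ht (IsFlow.inv Φ (clamp T t) x)
    rw [hsurj] at this
    rw [this]
    refine add_nonneg (hω₀.nonneg _ hi) (intervalIntegral.integral_nonneg ht.1 fun s hs => ?_)
    rw [hρc s ⟨hs.1, hs.2.trans ht.2⟩]
    exact mul_nonneg (hρ₀.nonneg _ hi) (Real.exp_pos _).le
  have hneg : ∀ t x, 0 ≤ x → conv 0 a (ω t) x ≤ 0 := fun t x hx =>
    conv_nonpos ha (sω.continuous_space t) (fun x => (hB t x).1) (hodd t) (hpos t) hx
  have habs := h.abs_le_abs_inv hT hv hV hK hvodd hneg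
  refine ⟨sω, sρ, cω, cρ, hodd, fun t x hx => ?_, fun t x hx => ?_, htr⟩
  · rw [← cω]
    have ht := clamp_mem hT t
    have := hωc _ ht (IsFlow.inv Φ (clamp T t) x)
    have hi := hx.trans_le (habs (clamp T t) x)
    rw [hsurj] at this
    rw [this, hω₀.supp _ hi, zero_add]
    refine (intervalIntegral.integral_congr (g := fun _ => (0 : ℝ)) fun s hs => ?_).trans (by simp)
    rw [uIcc_of_le ht.1] at hs
    simp only [hρc s ⟨hs.1, hs.2.trans ht.2⟩, hρ₀.supp _ hi, zero_mul]
  · rw [← cρ]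
    have ht := clamp_mem hT t
    have := hρc _ ht (IsFlow.inv Φ (clamp T t) x)
    rw [hsurj] at this
    rw [this, hρ₀.supp _ (hx.trans_le (habs (clamp T t) x)), zero_mul]

section Classical

variable {a T t₀ : ℝ} {ω₀ θ₀ : ℝ → ℝ} {ω θ : ℝ → ℝ → ℝ}

namespace IsSolution

lemma sm_vorticity (h : IsSolution 1 a T ω₀ θ₀ ω θ) (ht₀ : t₀ ∈ Ico 0 T) :
    Sm 1 fun t => ω (clamp t₀ t) := h.regular_vorticity.sm_clamp ht₀ (by simp)

lemma sm_density (h : IsSolution 1 a T ω₀ θ₀ ω θ) (ht₀ : t₀ ∈ Ico 0 T) :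
    Sm 2 fun t => θ (clamp t₀ t) := h.regular_density.sm_clamp ht₀ (by norm_num)

lemma clamp_mem_Ico (ht₀ : t₀ ∈ Ico 0 T) (t : ℝ) : clamp t₀ t ∈ Ico 0 T :=
  ⟨(clamp_mem ht₀.1 t).1, (clamp_mem ht₀.1 t).2.trans_lt ht₀.2⟩

lemma velocity_eq (h : IsSolution 1 a T ω₀ θ₀ ω θ) (ha : 0 < a) {t : ℝ} (ht : t ∈ Ico 0 T) :
    velocity a (ω t) = conv 0 a (ω t) := by
  obtain ⟨B, hB⟩ := h.bounded t ht.2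
  refine velocity_eq_conv ha (h.regular_vorticity.1 t ht).continuous
    (fun x => (hB t ⟨ht.1, le_rfl⟩ x).1) (h.odd_vorticity t ht)

/-- A classical solution is regular in the sense of `IsRegular` on closed subintervals. -/
theorem isRegular (h : IsSolution 1 a T ω₀ θ₀ ω θ) (ha : 0 < a) (hd : IsInitialData ω₀ θ₀)
    (ht₀ : t₀ ∈ Ico 0 T) :
    IsRegular a t₀ (fun t => ω (clamp t₀ t)) (fun t => deriv (θ (clamp t₀ t))) := by
  have hT := ht₀.1
  have hc := clamp_mem_Ico ht₀
  have h0 : clamp t₀ 0 = 0 := clamp_of_mem ⟨le_rfl, hT⟩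
  have sω := h.sm_vorticity ht₀
  have sθ := h.sm_density ht₀
  obtain ⟨B, hB⟩ := h.bounded t₀ ht₀.2
  have hB' : ∀ t x, |ω (clamp t₀ t) x| ≤ B ∧ |deriv (ω (clamp t₀ t)) x| ≤ B :=
    fun t x => hB _ (clamp_mem hT t) x
  have hbd : Bd 1 fun t => ω (clamp t₀ t) := fun k hk => ⟨B, fun t x => by
    interval_cases k
    · simpa using (hB' t x).1
    · simpa using (hB' t x).2⟩
  have sv : Sm 1 fun t => conv 0 a (ω (clamp t₀ t)) := sω.conv ha le_rfl ha.le hbd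
  have hsub : Icc 0 t₀ ⊆ Ico 0 T := fun t ht => ⟨ht.1, ht.2.trans_lt ht₀.2⟩
  have eω : ∀ t ∈ Icc 0 t₀, ∀ x, ω (clamp t₀ t) x = ω (clamp t₀ 0) x
      + ∫ s in (0 : ℝ)..t, (deriv (θ (clamp t₀ s)) x
        - conv 0 a (ω (clamp t₀ s)) x * deriv (ω (clamp t₀ s)) x) := by
    intro t ht x
    refine eq_integral_of_hasDerivWithinAt (T := t₀) (f := fun s => ω (clamp t₀ s) x) ?_
      (fun s hs => ?_) ht
    · exact ((IsTransported.sm_vorticity_rhs sv sω sθ.deriv).continuous_time x).continuousOn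
    · have := (h.vorticity_eq s (hsub hs) x).mono hsub
      rw [h.velocity_eq ha (hsub hs)] at this
      simp only [clamp_of_mem hs]
      exact this.congr (fun r hr => by rw [clamp_of_mem hr]) (by rw [clamp_of_mem hs])
  have eθ : ∀ t ∈ Icc 0 t₀, ∀ x, θ (clamp t₀ t) x = θ (clamp t₀ 0) x
      + ∫ s in (0 : ℝ)..t, -(conv 0 a (ω (clamp t₀ s)) x * deriv (θ (clamp t₀ s)) x) := by
    intro t ht x
    refine eq_integral_of_hasDerivWithinAt (T := t₀) (f := fun s => θ (clamp t₀ s) x) ?_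
      (fun s hs => ?_) ht
    · exact ((sv.mul sθ.deriv).neg.continuous_time x).continuousOn
    · have := (h.density_eq s (hsub hs) x).mono hsub
      rw [h.velocity_eq ha (hsub hs)] at this
      simp only [clamp_of_mem hs]
      exact this.congr (fun r hr => by rw [clamp_of_mem hr]) (by rw [clamp_of_mem hs])
  refine isRegular_of_isTransported ha hT sω sθ.deriv (fun t => by rw [clamp_clamp hT])
    (fun t => by rw [clamp_clamp hT]) hB' (fun t => h.odd_vorticity _ (hc t))
    (by rw [h0, h.initial_vorticity]; exact hd.isProfile_vorticity)
    (by rw [h0, h.initial_density]; exact hd.isProfile_density) ⟨eω, fun t ht x => ?_⟩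
  -- The conservation law for θ_x is the spatial derivative of the integrated equation for θ.
  have sp : Sm 1 fun s y => conv 0 a (ω (clamp t₀ s)) y * deriv (θ (clamp t₀ s)) y :=
    sv.mul sθ.deriv
  have h2 := (sθ.hasDerivAt 0 x).add (hasDerivAt_integral_param
    (f := fun s y => -(conv 0 a (ω (clamp t₀ s)) y * deriv (θ (clamp t₀ s)) y))
    sp.neg.continuous sp.neg.deriv.continuous (fun s y => sp.neg.hasDerivAt s y) 0 t x)
  have h3 : θ (clamp t₀ t) = fun y => θ (clamp t₀ 0) y
      + ∫ s in (0 : ℝ)..t, -(conv 0 a (ω (clamp t₀ s)) y * deriv (θ (clamp t₀ s)) y) :=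
    funext (eθ t ht)
  have h4 := h2
  simp only [deriv.fun_neg] at h4
  refine HasDerivAt.deriv ?_
  rw [h3]
  exact h4

/-- The origin is a stagnation point. The value of θ there is therefore conserved, which allows θ to
be recovered from its gradient. -/
lemma density_zero (h : IsSolution 1 a T ω₀ θ₀ ω θ) (ha : 0 < a) (h0 : θ₀ 0 = 0) {t : ℝ}
    (ht : t ∈ Ico 0 T) : θ t 0 = 0 := by
  have hsub : Icc 0 t ⊆ Ico 0 T := fun s hs => ⟨hs.1, hs.2.trans_lt ht.2⟩
  have := eq_integral_of_hasDerivWithinAt (T := t) (f := fun s => θ s 0) (g := fun _ => 0)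
    continuousOn_const (fun s hs => ?_) ⟨ht.1, le_rfl⟩
  · rw [this, h.initial_density, h0]; simp
  · have := (h.density_eq s (hsub hs) 0).mono hsub
    rwa [h.velocity_eq ha (hsub hs), odd_zero (conv_odd (h.odd_vorticity s (hsub hs))), zero_mul,
      neg_zero] at this

lemma density_eq_integral (h : IsSolution 1 a T ω₀ θ₀ ω θ) (ha : 0 < a) (h0 : θ₀ 0 = 0) {t : ℝ}
    (ht : t ∈ Ico 0 T) (x : ℝ) : θ t x = ∫ y in (0 : ℝ)..x, deriv (θ t) y := by
  have hc := (h.regular_density.1 t ht).of_le (show ((1 : ℕ∞) : WithTop ℕ∞) ≤ _ from by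
    exact_mod_cast le_add_of_nonneg_left zero_le_one)
  rw [intervalIntegral.integral_deriv_eq_sub
    (fun y _ => hc.differentiable (by norm_num) y)
    ((hc.continuous_deriv (by norm_num)).intervalIntegrable _ _), h.density_zero ha h0 ht, sub_zero]

end IsSolution

lemma Sm.spatiallyCk {f : ℝ → ℝ → ℝ} (hf : ∀ n, Sm n f) (m : ℕ∞) (T : ℝ) : SpatiallyCk m T f :=
  ⟨fun t _ => (contDiff_top_of_sm hf t).of_le (by exact_mod_cast le_top), fun k _ =>
    (Sm.iteratedDeriv (n := 0) (hf (0 + k))).continuous.continuousOn⟩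

/-- The density with given gradient, vanishing at the origin. -/
noncomputable def primitive (ρ : ℝ → ℝ → ℝ) (t x : ℝ) : ℝ := ∫ y in (0 : ℝ)..x, ρ t y

lemma hasDerivAt_primitive_space {ρ : ℝ → ℝ → ℝ} (hρ : Sm 0 ρ) (t x : ℝ) :
    HasDerivAt (primitive ρ t) (ρ t x) x := hasDerivAt_primitive (hρ.continuous_space t) x

lemma sm_primitive {ρ : ℝ → ℝ → ℝ} (hρ : ∀ n, Sm n ρ) (n : ℕ) : Sm n (primitive ρ) := by
  have hc : Continuous fun p : ℝ × ℝ => primitive ρ p.1 p.2 :=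
    intervalIntegral.continuous_parametric_intervalIntegral_of_continuous
      (f := fun (p : ℝ × ℝ) s => ρ p.1 s)
      ((hρ 0).continuous.comp (by fun_prop : Continuous fun q : (ℝ × ℝ) × ℝ => (q.1.1, q.2)))
      continuous_snd
  cases n with
  | zero => exact hc
  | succ n => exact Sm.of_hasDerivAt hc (hasDerivAt_primitive_space (hρ 0)) (hρ n)

lemma hasDerivWithinAt_primitive_time {v ρ : ℝ → ℝ → ℝ} (hv : Sm 1 v) (hρ : Sm 1 ρ)
    (h0 : ∀ t, ρ t 0 = 0) (htr : IsTransported T v ω ρ) {t : ℝ} (ht : t ∈ Icc 0 T) (x : ℝ) :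
    HasDerivWithinAt (fun s => primitive ρ s x) (-(v t x * ρ t x)) (Icc 0 T) t := by
  have sp : Sm 1 fun s y => v s y * ρ s y := hv.mul hρ
  refine (hasDerivWithinAt_space_integral hρ.of_succ sp.deriv.neg htr.density 0 x ht).congr_deriv ?_
  rw [intervalIntegral.integral_neg, intervalIntegral.integral_eq_sub_of_hasDerivAt
    (fun y _ => sp.hasDerivAt t y) ((sp.deriv.continuous_space t).intervalIntegrable _ _), h0]
  ring

/-- A smooth evolution is a classical solution. -/
theorem IsEvolution.isSolution {ρ : ℝ → ℝ → ℝ} (ha : 0 < a) (hT : 0 ≤ T) (hω : IsEvolution T ω)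
    (hρ : IsEvolution T ρ) (htr : IsTransported T (fun t => conv 0 a (ω t)) ω ρ)
    (hd : IsInitialData ω₀ θ₀) (h0 : ω 0 = ω₀) (h0' : ρ 0 = deriv θ₀) :
    IsSolution (⊤ : ℕ∞) a T ω₀ θ₀ ω (primitive ρ) := by
  have hbd := hω.bd hT 1
  obtain ⟨B, hB⟩ := hbd.bound
  obtain ⟨B', hB'⟩ := hbd.deriv.bound
  have hv := sm_velocity ha hT hω
  have hvel : ∀ t, velocity a (ω t) = conv 0 a (ω t) := fun t =>
    velocity_eq_conv ha (hω.contDiff t).continuous (hB t) (hω.odd t)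
  have hder : ∀ t, deriv (primitive ρ t) = ρ t := fun t => funext fun x =>
    (hasDerivAt_primitive_space (hρ.sm 0) t x).deriv
  refine ⟨Sm.spatiallyCk hω.sm _ _, Sm.spatiallyCk (sm_primitive hρ.sm) _ _, fun t _ => hω.odd t,
    fun t₀ _ => ⟨max B B', fun t _ x => ⟨(hB t x).trans (le_max_left _ _),
      (hB' t x).trans (le_max_right _ _)⟩⟩, fun t ht x => ?_, fun t ht x => ?_, h0, ?_⟩
  · rw [hder, hvel]
    exact (hasDerivWithinAt_of_integral_eq (IsTransported.sm_vorticity_rhs (hv 1) (hω.sm 1)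
      (hρ.sm 1)) htr.vorticity (Ico_subset_Icc_self ht) x).mono Ico_subset_Icc_self
  · rw [hder, hvel]
    exact (hasDerivWithinAt_primitive_time (hv 1) (hρ.sm 1) (fun t => odd_zero (hρ.odd t)) htr
      (Ico_subset_Icc_self ht) x).mono Ico_subset_Icc_self
  · ext x
    have hc := contDiff_of_top hd.smooth_density 1
    simp only [primitive, h0']
    rw [intervalIntegral.integral_deriv_eq_sub
      (fun y _ => hc.differentiable (by norm_num) y)
      ((hc.continuous_deriv (by norm_num)).intervalIntegrable _ _), hd.density_zero, sub_zero]

end Classical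

/-! ### Pointwise inequalities for the half-line kernel -/

section KernelInequalities

variable {e a x y : ℝ}

/-- The kernel of the velocity on the half-line, up to the factor `-1/π`. -/
noncomputable def halfKern (e a x y : ℝ) : ℝ := kern e a (x + y) - kern e a (x - y)

lemma halfKern_comm (e a x y : ℝ) : halfKern e a x y = halfKern e a y x := by
  unfold halfKern
  rw [add_comm, ← kern_neg (z := x - y), neg_sub]

/-- With p = (x-y)² and q = (x+y)² the kernel is log(1 + r), where r = 4xy(a-e)/((p+e)(q+a)), and
log(1+r) ≥ 2r/(r+2). This particular lower bound has a denominator symmetric in p and q, which makes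
the two inequalities below polynomial. -/
lemma le_halfKern (he : 0 ≤ e) (hea : e < a) (hx : 0 < x) (hy : 0 < y)
    (hp : 0 < (x - y) ^ 2 + e) :
    8 * x * y * (a - e) / (2 * ((x - y) ^ 2 * (x + y) ^ 2) + (a + e) * ((x - y) ^ 2 + (x + y) ^ 2)
      + 2 * (a * e)) ≤ halfKern e a x y := by
  have ha : 0 < a := he.trans_lt hea
  have hxy : 0 < x * y := mul_pos hx hy
  set p := (x - y) ^ 2 with hpd
  set q := (x + y) ^ 2 with hqd
  have hq : q = p + 4 * (x * y) := by rw [hpd, hqd]; ring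
  have hp0 : 0 ≤ p := sq_nonneg _
  have hq0 : 0 < q := by positivity
  have hqe : 0 < q + e := by linarith
  have hpa : 0 < p + a := by linarith
  have hqa : 0 < q + a := by linarith
  have hae : 0 < a - e := by linarith
  have hden : 0 < (p + e) * (q + a) := mul_pos hp hqa
  set r := 4 * (x * y) * (a - e) / ((p + e) * (q + a)) with hr
  have hr0 : 0 ≤ r := by positivity
  have h1 : 1 + r = (q + e) * (p + a) / ((p + e) * (q + a)) := by
    rw [hr, hq]; field_simp; ring
  have h2 := Real.le_log_one_add_of_nonneg hr0
  rw [h1, Real.log_div (by positivity) hden.ne', Real.log_mul hqe.ne' hpa.ne',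
    Real.log_mul hp.ne' hqa.ne'] at h2
  have h3 : 2 * r / (r + 2) = 8 * x * y * (a - e)
      / (2 * (p * q) + (a + e) * (p + q) + 2 * (a * e)) := by
    have hD : 2 * (p * q) + (a + e) * (p + q) + 2 * (a * e)
        = 4 * (x * y) * (a - e) + 2 * ((p + e) * (q + a)) := by rw [hq]; ring
    rw [hD, hr]
    have : 0 < 4 * (x * y) * (a - e) + 2 * ((p + e) * (q + a)) := by positivity
    field_simp
    ring
  rw [← h3]
  unfold halfKern kern
  linarith

/-- The `x`-derivative of `halfKern`. -/
noncomputable def halfKernDeriv (e a x y : ℝ) : ℝ :=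
  (a - e) * (2 * (x + y) / (((x + y) ^ 2 + e) * ((x + y) ^ 2 + a))
    - 2 * (x - y) / (((x - y) ^ 2 + e) * ((x - y) ^ 2 + a)))

/-- Compared with the rational lower bound. The condition y ≤ x enters through p + q = 2(x² + y²) ≤
4x²; what remains is (ae - pq)D ≤ 2PQ, whose difference has only nonnegative terms. -/
lemma mul_halfKernDeriv_le (he : 0 < e) (hea : e < a) (hy : 0 < y) (hyx : y ≤ x) :
    x * halfKernDeriv e a x y ≤ halfKern e a x y := by
  have hx : 0 < x := hy.trans_le hyx
  have ha : 0 < a := he.trans hea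
  refine le_trans ?_ (le_halfKern he.le hea hx hy (by positivity))
  have hxy : 0 < x * y := mul_pos hx hy
  unfold halfKernDeriv
  set p := (x - y) ^ 2 with hpd
  set q := (x + y) ^ 2 with hqd
  have hq : q = p + 4 * (x * y) := by rw [hpd, hqd]; ring
  have hx2 : (p + q) / 4 ≤ x ^ 2 := by rw [hpd, hqd]; nlinarith
  have hp0 : 0 ≤ p := sq_nonneg _
  have hq0 : 0 < q := by positivity
  have hae : 0 < a - e := by linarith
  set P := (p + e) * (p + a) with hP
  set Q := (q + e) * (q + a) with hQ
  have hP0 : 0 < P := by positivity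
  have hQ0 : 0 < Q := by positivity
  set D := 2 * (p * q) + (a + e) * (p + q) + 2 * (a * e) with hD
  have hD0 : 0 < D := by positivity
  have e1 : x * ((a - e) * (2 * (x + y) / Q - 2 * (x - y) / P))
      = (a - e) * (2 * x ^ 2 * (P - Q) + 2 * (x * y) * (P + Q)) / (P * Q) := by
    field_simp; ring
  rw [e1, div_le_div_iff₀ (by positivity) hD0]
  have e2 : P - Q = -(4 * (x * y)) * (p + q + a + e) := by rw [hP, hQ, hq]; ring
  have h1 : 2 * x ^ 2 * (P - Q) + 2 * (x * y) * (P + Q) ≤ 4 * (x * y) * (a * e - p * q) := by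
    rw [e2]
    have h2 := mul_le_mul_of_nonneg_left hx2
      (show 0 ≤ 8 * (x * y) * (p + q + a + e) by positivity)
    have e3 : P + Q = (p + q) ^ 2 - 2 * (p * q) + (a + e) * (p + q) + 2 * (a * e) := by
      rw [hP, hQ]; ring
    rw [e3]
    nlinarith
  have h4 : (a * e - p * q) * D ≤ 2 * (P * Q) := by
    have e5 : 2 * (P * Q) - (a * e - p * q) * D = 2 * (p * q) ^ 2 + 2 * (a + e) * (p * q) * (p + q)
        + 2 * (a * e) * (p ^ 2 + q ^ 2) + 2 * (a + e) ^ 2 * (p * q)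
        + (a * e) * (a + e) * (p + q) + (p * q) * (2 * (p * q) + (a + e) * (p + q)) := by
      rw [hP, hQ, hD]; ring
    have : 0 ≤ 2 * (P * Q) - (a * e - p * q) * D := by rw [e5]; positivity
    linarith
  calc (a - e) * (2 * x ^ 2 * (P - Q) + 2 * (x * y) * (P + Q)) * D
      ≤ (a - e) * (4 * (x * y) * (a * e - p * q)) * D := by
        gcongr
    _ = (a - e) * (4 * (x * y)) * ((a * e - p * q) * D) := by ring
    _ ≤ (a - e) * (4 * (x * y)) * (2 * (P * Q)) := by gcongr
    _ = 8 * x * y * (a - e) * (P * Q) := by ring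

/-- The symmetric companion, without any ordering of x and y: after clearing denominators the
difference is (p - q)² times a nonnegative polynomial. -/
lemma halfKernDeriv_symm_le (he : 0 < e) (hea : e < a) (hx : 0 < x) (hy : 0 < y) :
    x * y ^ 2 * halfKernDeriv e a x y + x ^ 2 * y * halfKernDeriv e a y x
      ≤ (x ^ 2 + y ^ 2) * halfKern e a x y := by
  have ha : 0 < a := he.trans hea
  refine le_trans ?_ (mul_le_mul_of_nonneg_left (le_halfKern he.le hea hx hy (by positivity))
    (by positivity))
  have hxy : 0 < x * y := mul_pos hx hy
  unfold halfKernDeriv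
  have e0 : (y - x) ^ 2 = (x - y) ^ 2 := by ring
  rw [add_comm y x, e0]
  set p := (x - y) ^ 2 with hpd
  set q := (x + y) ^ 2 with hqd
  have hs : x ^ 2 + y ^ 2 = (p + q) / 2 := by rw [hpd, hqd]; ring
  have hp0 : 0 ≤ p := sq_nonneg _
  have hq0 : 0 < q := by positivity
  have hae : 0 < a - e := by linarith
  set P := (p + e) * (p + a) with hP
  set Q := (q + e) * (q + a) with hQ
  have hP0 : 0 < P := by positivity
  have hQ0 : 0 < Q := by positivity
  set D := 2 * (p * q) + (a + e) * (p + q) + 2 * (a * e) with hD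
  have hD0 : 0 < D := by positivity
  have e1 : x * y ^ 2 * ((a - e) * (2 * (x + y) / Q - 2 * (x - y) / P))
      + x ^ 2 * y * ((a - e) * (2 * (x + y) / Q - 2 * (y - x) / P))
      = 2 * (a - e) * (x * y) * (q * P + p * Q) / (P * Q) := by
    rw [hpd, hqd]; field_simp; ring
  rw [e1, hs, mul_div_assoc', div_le_div_iff₀ (by positivity) hD0]
  have h1 : (q * P + p * Q) * D ≤ 2 * (p + q) * (P * Q) := by
    have e5 : 2 * (p + q) * (P * Q) - (q * P + p * Q) * D
        = (p - q) ^ 2 * ((a + e) * (p * q) + 2 * (a * e) * (p + q) + (a + e) * (a * e)) := by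
      rw [hP, hQ, hD]; ring
    have : 0 ≤ 2 * (p + q) * (P * Q) - (q * P + p * Q) * D := by rw [e5]; positivity
    linarith
  calc 2 * (a - e) * (x * y) * (q * P + p * Q) * D
      = 2 * (a - e) * (x * y) * ((q * P + p * Q) * D) := by ring
    _ ≤ 2 * (a - e) * (x * y) * (2 * (p + q) * (P * Q)) := by gcongr
    _ = (p + q) / 2 * (8 * x * y * (a - e)) * (P * Q) := by ring

/-- Positivity of the symmetrised kernel. -/
lemma symmetrised_nonneg (he : 0 < e) (hea : e < a) (hx : 0 < x) (hy : 0 < y) {α β : ℝ}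
    (hα : 0 ≤ α) (hβ : 0 ≤ β) (h1 : y ≤ x → y * β ≤ x * α) (h2 : x ≤ y → x * α ≤ y * β) :
    0 ≤ α * y * (halfKern e a x y - x * halfKernDeriv e a x y)
      + β * x * (halfKern e a y x - y * halfKernDeriv e a y x) := by
  have key : ∀ {x y α β : ℝ}, 0 < x → 0 < y → 0 ≤ α → 0 ≤ β → y ≤ x → y * β ≤ x * α →
      0 ≤ α * y * (halfKern e a x y - x * halfKernDeriv e a x y)
        + β * x * (halfKern e a y x - y * halfKernDeriv e a y x) := by
    intro x y α β hx hy hα hβ hyx h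
    have i2 := mul_halfKernDeriv_le he hea hy hyx
    have i1 := halfKernDeriv_symm_le he hea hx hy
    rw [halfKern_comm e a y x]
    -- After multiplication by x, the factor xα may be lowered to yβ because H - xH_x ≥ 0, where H
    -- is the kernel. What is left is β times (x² + y²)H - (xy²H_x + x²yH_y) ≥ 0.
    have j1 := mul_le_mul_of_nonneg_right h
      (mul_nonneg hy.le (sub_nonneg.2 i2))
    have j2 := mul_nonneg hβ (sub_nonneg.2 i1)
    have : 0 ≤ x * (α * y * (halfKern e a x y - x * halfKernDeriv e a x y)
        + β * x * (halfKern e a x y - y * halfKernDeriv e a y x)) := by nlinarith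
    exact nonneg_of_mul_nonneg_right this hx
  rcases le_total y x with h | h
  · exact key hx hy hα hβ h (h1 h)
  · have := key hy hx hβ hα h (h2 h)
    linarith

/-- The lower bound for the kernel that drives the growth. -/
lemma le_halfKern_zero (ha : 0 < a) (hx : 0 < x) (hxy : x < y) (hy : y ≤ 1) :
    4 * a / (1 + 2 * a) * (x / y) ≤ halfKern 0 a x y := by
  have hy0 : 0 < y := hx.trans hxy
  have hp : 0 < (x - y) ^ 2 + 0 := by
    have : x - y ≠ 0 := (sub_neg.2 hxy).ne
    positivity
  refine le_trans ?_ (le_halfKern le_rfl ha hx hy0 hp)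
  -- Here y ≤ 1 is used: 0 ≤ y² - x² ≤ y. The denominator is then at most 2y²(1 + 2a), the source of
  -- the constant.
  have h1 : (x - y) ^ 2 * (x + y) ^ 2 ≤ y ^ 2 := by
    have e1 : (x - y) ^ 2 * (x + y) ^ 2 = (y ^ 2 - x ^ 2) ^ 2 := by ring
    have e2 : 0 ≤ y ^ 2 - x ^ 2 := by nlinarith
    have e3 : y ^ 2 - x ^ 2 ≤ y := by nlinarith
    rw [e1]
    exact pow_le_pow_left₀ e2 e3 2
  have h2 : (x - y) ^ 2 + (x + y) ^ 2 ≤ 4 * y ^ 2 := by nlinarith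
  have hD : 0 < 2 * ((x - y) ^ 2 * (x + y) ^ 2) + (a + 0) * ((x - y) ^ 2 + (x + y) ^ 2)
      + 2 * (a * 0) := by positivity
  rw [div_mul_div_comm, div_le_div_iff₀ (by positivity) hD]
  have h3 := mul_le_mul_of_nonneg_left h2 ha.le
  have h4 : 2 * ((x - y) ^ 2 * (x + y) ^ 2) + (a + 0) * ((x - y) ^ 2 + (x + y) ^ 2)
      + 2 * (a * 0) ≤ 2 * y ^ 2 * (1 + 2 * a) := by linarith
  have h5 := mul_le_mul_of_nonneg_left h4 (show 0 ≤ 4 * a * x by positivity)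
  calc _ ≤ _ := h5
    _ = _ := by ring

end KernelInequalities

/-! ### Positivity of the quadratic form -/

section HalfLine

variable {e a : ℝ} {f : ℝ → ℝ}

lemma conv_eq_halfKern (ha : 0 < a) (he : 0 ≤ e) (hea : e ≤ a) (hf : Continuous f)
    (hs : ∀ x, 1 < |x| → f x = 0) (hodd : Function.Odd f) (x : ℝ) :
    conv e a f x = -(1 / Real.pi * ∫ y in (0 : ℝ)..1, halfKern e a x y * f y) := by
  obtain ⟨B, hB⟩ := exists_bound_of_supp hf hs
  rw [conv_eq_Ioi ha he hea hf hB hodd, ← mul_neg, ← intervalIntegral.integral_neg,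
    intervalIntegral.integral_of_le zero_le_one]
  congr 1
  have h1 : ∀ y, (kern e a (x - y) - kern e a (x + y)) * f y = -(halfKern e a x y * f y) :=
    fun y => by unfold halfKern; ring
  simp only [h1]
  refine setIntegral_eq_of_subset_of_forall_sdiff_eq_zero measurableSet_Ioi Ioc_subset_Ioi_self
    fun y hy => ?_
  have : 1 < |y| := by
    have h0 : 0 < y := hy.1
    rw [abs_of_pos h0]
    by_contra hcon
    exact hy.2 ⟨h0, not_lt.1 hcon⟩
  rw [hs y this, mul_zero, neg_zero]

lemma continuous_halfKern (he : 0 < e) (ha : 0 < a) :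
    Continuous fun p : ℝ × ℝ => halfKern e a p.1 p.2 := by
  unfold halfKern kern
  have h : ∀ c : ℝ, 0 < c → ∀ g : ℝ × ℝ → ℝ, Continuous g →
      Continuous fun p => Real.log (g p ^ 2 + c) := fun c hc g hg =>
    ((hg.pow 2).add_const c).log fun p => (add_pos_of_nonneg_of_pos (sq_nonneg _) hc).ne'
  exact ((h e he _ (by fun_prop)).sub (h a ha _ (by fun_prop))).sub
    ((h e he _ (by fun_prop)).sub (h a ha _ (by fun_prop)))

lemma continuous_halfKernDeriv (he : 0 < e) (ha : 0 < a) :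
    Continuous fun p : ℝ × ℝ => halfKernDeriv e a p.1 p.2 := by
  unfold halfKernDeriv
  refine continuous_const.mul ((Continuous.div (by fun_prop) (by fun_prop) fun p => ?_).sub
    (Continuous.div (by fun_prop) (by fun_prop) fun p => ?_)) <;> positivity

lemma hasDerivAt_halfKern (he : 0 < e) (ha : 0 < a) (x y : ℝ) :
    HasDerivAt (fun x => halfKern e a x y) (halfKernDeriv e a x y) x := by
  have n : ∀ c b : ℝ, HasDerivAt (fun x : ℝ => (x + b) ^ 2 + c) (2 * (x + b)) x := fun c b => by
    simpa using (((hasDerivAt_id x).add_const b).pow 2).add_const c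
  have l : ∀ c b : ℝ, 0 < c → HasDerivAt (fun x : ℝ => Real.log ((x + b) ^ 2 + c))
      (2 * (x + b) / ((x + b) ^ 2 + c)) x := fun c b hc => (n c b).log (by positivity)
  have := ((l e y he).sub (l a y ha)).sub ((l e (-y) he).sub (l a (-y) ha))
  refine this.congr_deriv ?_
  unfold halfKernDeriv
  simp only [← sub_eq_add_neg]
  have h1 : 0 < (x + y) ^ 2 + e := by positivity
  have h2 : 0 < (x + y) ^ 2 + a := by positivity
  have h3 : 0 < (x - y) ^ 2 + e := by positivity
  have h4 : 0 < (x - y) ^ 2 + a := by positivity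
  field_simp
  ring

/-- For e > 0 the kernel is smooth, so the convolution can be differentiated either in f or in the
kernel; uniqueness of the derivative equates the results. -/
lemma conv_deriv_eq_halfKernDeriv (ha : 0 < a) (he : 0 < e) (hea : e ≤ a) (hf : ContDiff ℝ 1 f)
    (hs : ∀ x, 1 < |x| → f x = 0) (hodd : Function.Odd f) (x : ℝ) :
    conv e a (deriv f) x = -(1 / Real.pi * ∫ y in (0 : ℝ)..1, halfKernDeriv e a x y * f y) := by
  have hf' := hf.continuous_deriv le_rfl
  have hfc := hf.continuous
  obtain ⟨B, hB⟩ := exists_bound_of_supp hf.continuous hs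
  obtain ⟨B', hB'⟩ := exists_bound_of_supp hf' (deriv_eq_zero_of_supp hs)
  have h1 := hasDerivAt_conv ha he.le hea
    (fun x => (hf.differentiable (by norm_num) x).hasDerivAt) hf' hB hB' x
  have h2 := ((hasDerivAt_integral_param (f := fun y x => halfKern e a x y * f y)
    (f' := fun y x => halfKernDeriv e a x y * f y)
    (((continuous_halfKern he ha).comp continuous_swap).mul (hfc.comp continuous_fst))
    (((continuous_halfKernDeriv he ha).comp continuous_swap).mul (hfc.comp continuous_fst))
    (fun y x => (hasDerivAt_halfKern he ha x y).mul_const _) 0 1 x).const_mul (1 / Real.pi)).neg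
  have h3 : conv e a f = fun x => -(1 / Real.pi * ∫ y in (0 : ℝ)..1, halfKern e a x y * f y) :=
    funext (conv_eq_halfKern ha he.le hea hfc hs hodd)
  rw [h3] at h1
  exact h1.unique h2

/-- By Fubini, twice the integral is the integral of K(x,y) + K(y,x). The open square suffices since
its boundary is null. -/
lemma integral_integral_nonneg_of_symm {K : ℝ → ℝ → ℝ} (hK : Continuous fun p : ℝ × ℝ => K p.1 p.2)
    (h : ∀ x ∈ Ioo (0 : ℝ) 1, ∀ y ∈ Ioo (0 : ℝ) 1, 0 ≤ K x y + K y x) :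
    0 ≤ ∫ x in (0 : ℝ)..1, ∫ y in (0 : ℝ)..1, K x y := by
  have hK' : Continuous fun p : ℝ × ℝ => K p.2 p.1 := hK.comp continuous_swap
  have hswap : ∫ x in (0 : ℝ)..1, ∫ y in (0 : ℝ)..1, K x y
      = ∫ x in (0 : ℝ)..1, ∫ y in (0 : ℝ)..1, K y x := by
    refine intervalIntegral_intervalIntegral_swap (F := K) ?_
    rw [uIoc_of_le zero_le_one]
    exact (hK.continuousOn.integrableOn_compact (isCompact_Icc.prod isCompact_Icc)).mono_set
      (prod_mono Ioc_subset_Icc_self Ioc_subset_Icc_self)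
  have c1 : Continuous fun x => ∫ y in (0 : ℝ)..1, K x y :=
    intervalIntegral.continuous_parametric_intervalIntegral_of_continuous' hK 0 1
  have c2 : Continuous fun x => ∫ y in (0 : ℝ)..1, K y x :=
    intervalIntegral.continuous_parametric_intervalIntegral_of_continuous' hK' 0 1
  have hsum : 0 ≤ (∫ x in (0 : ℝ)..1, ∫ y in (0 : ℝ)..1, K x y)
      + ∫ x in (0 : ℝ)..1, ∫ y in (0 : ℝ)..1, K y x := by
    rw [← intervalIntegral.integral_add (c1.intervalIntegrable _ _) (c2.intervalIntegrable _ _)]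
    have hne : ∀ᵐ x : ℝ, x ≠ 1 := by rw [ae_iff]; simp
    refine intervalIntegral.integral_nonneg_of_ae_restrict zero_le_one ?_
    filter_upwards [ae_restrict_mem measurableSet_Icc, ae_restrict_of_ae hne,
      ae_restrict_of_ae ae_ne_zero] with x hx hx1 hx0
    have hx' : x ∈ Ioo (0 : ℝ) 1 := ⟨lt_of_le_of_ne hx.1 (Ne.symm hx0), lt_of_le_of_ne hx.2 hx1⟩
    have d1 : Continuous fun y => K x y := hK.comp (continuous_const.prodMk continuous_id)
    have d2 : Continuous fun y => K y x := hK.comp (continuous_id.prodMk continuous_const)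
    simp only [Pi.zero_apply]
    rw [← intervalIntegral.integral_add (d1.intervalIntegrable _ _) (d2.intervalIntegrable _ _)]
    refine intervalIntegral.integral_nonneg_of_ae_restrict zero_le_one ?_
    filter_upwards [ae_restrict_mem measurableSet_Icc, ae_restrict_of_ae hne,
      ae_restrict_of_ae ae_ne_zero] with y hy hy1 hy0
    exact h x hx' y ⟨lt_of_le_of_ne hy.1 (Ne.symm hy0), lt_of_le_of_ne hy.2 hy1⟩
  linarith

/-- Positivity of the quadratic form that governs the growth of `∫ θ ω / x`. -/
theorem quadratic_form_nonneg {A W : ℝ → ℝ} (ha : 0 < a) (hf : ContDiff ℝ 1 f)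
    (hs : ∀ x, 1 < |x| → f x = 0) (hodd : Function.Odd f) (hA : Continuous A) (hW : Continuous W)
    (hfW : ∀ x, f x = x * W x) (hA0 : ∀ x ∈ Ioo (0 : ℝ) 1, 0 ≤ A x)
    (hW0 : ∀ x ∈ Ioo (0 : ℝ) 1, 0 ≤ W x)
    (hmono : ∀ x ∈ Ioo (0 : ℝ) 1, ∀ y ∈ Ioo (0 : ℝ) 1, y ≤ x → y * A y ≤ x * A x) :
    0 ≤ ∫ x in (0 : ℝ)..1, A x * W x * (x * conv 0 a (deriv f) x - conv 0 a f x) := by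
  have hf' := hf.continuous_deriv le_rfl
  have hfc := hf.continuous
  obtain ⟨B, hB⟩ := exists_bound_of_supp hf.continuous hs
  obtain ⟨B', hB'⟩ := exists_bound_of_supp hf' (deriv_eq_zero_of_supp hs)
  -- At e = 0 the differentiated kernel has a nonintegrable singularity 1/(x - y), so symmetrisation
  -- is carried out for e > 0. The limit is taken in the form where the derivative sits on f.
  have reg : ∀ e ∈ Ioo 0 a,
      0 ≤ ∫ x in (0 : ℝ)..1, A x * W x * (x * conv e a (deriv f) x - conv e a f x) := by
    intro e he
    have c1 := continuous_halfKern he.1 ha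
    have c2 := continuous_halfKernDeriv he.1 ha
    set K : ℝ → ℝ → ℝ := fun x y =>
      W x * W y * (A x * y * (halfKern e a x y - x * halfKernDeriv e a x y)) with hK
    have cK : Continuous fun p : ℝ × ℝ => K p.1 p.2 := by
      simp only [hK]
      fun_prop
    have e1 : ∀ x, A x * W x * (x * conv e a (deriv f) x - conv e a f x)
        = 1 / Real.pi * ∫ y in (0 : ℝ)..1, K x y := by
      intro x
      have d1 : Continuous fun y => halfKern e a x y :=
        c1.comp (continuous_const.prodMk continuous_id)
      have d2 : Continuous fun y => halfKernDeriv e a x y :=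
        c2.comp (continuous_const.prodMk continuous_id)
      have e2 : ∫ y in (0 : ℝ)..1, K x y = A x * W x * ((∫ y in (0 : ℝ)..1, halfKern e a x y * f y)
          - x * ∫ y in (0 : ℝ)..1, halfKernDeriv e a x y * f y) := by
        rw [← intervalIntegral.integral_const_mul, ← intervalIntegral.integral_sub
          (by apply Continuous.intervalIntegrable; fun_prop)
          (by apply Continuous.intervalIntegrable; fun_prop),
          ← intervalIntegral.integral_const_mul]
        congr 1
        ext y
        simp only [hK, hfW]
        ring
      rw [e2, conv_deriv_eq_halfKernDeriv ha he.1 he.2.le hf hs hodd,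
        conv_eq_halfKern ha he.1.le he.2.le hfc hs hodd]
      ring
    simp only [e1]
    rw [intervalIntegral.integral_const_mul]
    refine mul_nonneg (by positivity) (integral_integral_nonneg_of_symm cK fun x hx y hy => ?_)
    have := symmetrised_nonneg he.1 he.2 hx.1 hy.1 (hA0 x hx) (hA0 y hy) (hmono x hx y hy)
      (hmono y hy x hx)
    have h2 := mul_nonneg (mul_nonneg (hW0 x hx) (hW0 y hy)) this
    simp only [hK]
    linarith
  have hlim : Tendsto (fun e => ∫ x in (0 : ℝ)..1,
      A x * W x * (x * conv e a (deriv f) x - conv e a f x)) (𝓝[>] 0)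
      (𝓝 (∫ x in (0 : ℝ)..1, A x * W x * (x * conv 0 a (deriv f) x - conv 0 a f x))) := by
    have hmem : ∀ᶠ e in 𝓝[>] (0 : ℝ), e ∈ Ioo 0 a := Ioo_mem_nhdsGT ha
    have cc : ∀ e ∈ Ioo 0 a, ∀ {g : ℝ → ℝ} {C : ℝ}, Continuous g → (∀ x, |g x| ≤ C) →
        Continuous (conv e a g) := fun e he g C hg hC =>
      continuous_conv (X := ℝ) (f := fun _ => g) ha he.1.le he.2.le (hg.comp continuous_snd)
        continuous_id fun _ => hC
    refine intervalIntegral.tendsto_integral_filter_of_dominated_convergence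
      (fun x => |A x * W x| * (|x| * (kernMass a * B') + kernMass a * B)) ?_ ?_ ?_ ?_
    · filter_upwards [hmem] with e he
      have := cc e he hfc hB
      have := cc e he hf' hB'
      exact Continuous.aestronglyMeasurable (by fun_prop)
    · filter_upwards [hmem] with e he
      refine ae_of_all _ fun x _ => ?_
      rw [norm_mul]
      refine mul_le_mul_of_nonneg_left ((abs_sub _ _).trans (add_le_add ?_ ?_)) (abs_nonneg _)
      · rw [abs_mul]
        exact mul_le_mul_of_nonneg_left (abs_conv_le ha he.1.le he.2.le hB' x) (abs_nonneg _)
      · exact abs_conv_le ha he.1.le he.2.le hB x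
    · apply Continuous.intervalIntegrable
      fun_prop
    · exact ae_of_all _ fun x _ => (((tendsto_conv ha hf' hB' x).const_mul x).sub
        (tendsto_conv ha hfc hB x)).const_mul _
  refine ge_of_tendsto hlim ?_
  filter_upwards [Ioo_mem_nhdsGT ha] with e he using reg e he

end HalfLine

/-! ### Quotients by x, and the lower bound for the inward velocity -/

/-- The averages `∫₀¹ σ^j f(t, σ x) dσ`. -/
noncomputable def dilate (j : ℕ) (f : ℝ → ℝ → ℝ) (t x : ℝ) : ℝ :=
  ∫ σ in (0 : ℝ)..1, σ ^ j * f t (σ * x)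

lemma sm_dilate {n : ℕ} {f : ℝ → ℝ → ℝ} (hf : Sm n f) (j : ℕ) : Sm n (dilate j f) := by
  have hc : ∀ {g : ℝ → ℝ → ℝ}, (Continuous fun p : ℝ × ℝ => g p.1 p.2) → ∀ j,
      Continuous fun p : ℝ × ℝ => dilate j g p.1 p.2 := fun {g} hg j => by
    refine intervalIntegral.continuous_parametric_intervalIntegral_of_continuous'
      (f := fun (p : ℝ × ℝ) σ => σ ^ j * g p.1 (σ * p.2)) ?_ 0 1
    have : Continuous fun q : (ℝ × ℝ) × ℝ => g q.1.1 (q.2 * q.1.2) :=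
      hg.comp (by fun_prop : Continuous fun q : (ℝ × ℝ) × ℝ => (q.1.1, q.2 * q.1.2))
    exact (continuous_snd.pow j).mul this
  induction n generalizing f j with
  | zero => exact hc hf j
  | succ n ih =>
    refine Sm.of_hasDerivAt (hc hf.continuous j) (f' := dilate (j + 1) fun t => deriv (f t))
      (fun t x => ?_) (ih hf.deriv (j + 1))
    have c1 : Continuous fun q : ℝ × ℝ => f t (q.1 * q.2) :=
      (hf.continuous_space t).comp (by fun_prop)
    have c2 : Continuous fun q : ℝ × ℝ => deriv (f t) (q.1 * q.2) :=
      (hf.deriv.continuous_space t).comp (by fun_prop)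
    refine hasDerivAt_integral_param (f := fun σ x => σ ^ j * f t (σ * x))
      (f' := fun σ x => σ ^ (j + 1) * deriv (f t) (σ * x)) ((continuous_fst.pow j).mul c1)
      ((continuous_fst.pow (j + 1)).mul c2) (fun σ x => ?_) 0 1 x
    have h1 : HasDerivAt (fun x => σ * x) σ x := by simpa using (hasDerivAt_id x).const_mul σ
    refine (((hf.hasDerivAt t (σ * x)).comp x h1).const_mul (σ ^ j)).congr_deriv ?_
    ring

/-- Represents f/x as a function that is regular at the origin too. In this way θ/x, ω/x and u/x are
treated without division by zero. -/
lemma eq_mul_dilate_deriv {f : ℝ → ℝ → ℝ} (hf : Sm 1 f) (h0 : ∀ t, f t 0 = 0) (t x : ℝ) :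
    f t x = x * dilate 0 (fun t => deriv (f t)) t x := by
  have := sub_eq_integral_deriv_mul (hf.1 t) (hf.deriv.continuous_space t) x 0
  rw [h0, sub_zero, sub_zero] at this
  rw [this, mul_comm]
  simp [dilate]

section Growth

variable {a : ℝ}

/-- The kernel is nonnegative, so the part y < x may be dropped; for y > x it is at least a multiple
of x/y, and f(y)/y = W(y). -/
lemma mul_integral_le_neg_conv {f W : ℝ → ℝ} (ha : 0 < a) (hf : Continuous f)
    (hs : ∀ x, 1 < |x| → f x = 0) (hodd : Function.Odd f) (hpos : ∀ x, 0 ≤ x → 0 ≤ f x)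
    (hW : Continuous W) (hfW : ∀ x, f x = x * W x) {x : ℝ} (hx : 0 < x) (hx1 : x ≤ 1) :
    1 / Real.pi * (4 * a / (1 + 2 * a)) * (x * ∫ y in x..1, W y) ≤ -conv 0 a f x := by
  obtain ⟨B, hB⟩ := exists_bound_of_supp hf hs
  rw [conv_eq_halfKern ha le_rfl ha.le hf hs hodd, neg_neg, mul_assoc]
  refine mul_le_mul_of_nonneg_left ?_ (by positivity)
  have hi : Integrable fun y => halfKern 0 a x y * f y :=
    (((integrable_kern ha le_rfl ha.le).comp_add_left x).sub
      ((integrable_kern ha le_rfl ha.le).comp_sub_left x)).mul_bdd hf.aestronglyMeasurable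
      (ae_of_all _ hB)
  have hii : ∀ b c : ℝ, IntervalIntegrable (fun y => halfKern 0 a x y * f y) volume b c :=
    fun b c => hi.intervalIntegrable
  have hne : ∀ᵐ y : ℝ, y ≠ x := by rw [ae_iff]; simp
  rw [← intervalIntegral.integral_add_adjacent_intervals (hii 0 x) (hii x 1)]
  have h1 : 0 ≤ ∫ y in (0 : ℝ)..x, halfKern 0 a x y * f y := by
    refine intervalIntegral.integral_nonneg_of_ae_restrict hx.le ?_
    filter_upwards [ae_restrict_mem measurableSet_Icc, ae_restrict_of_ae hne] with y hy hyx
    refine mul_nonneg ?_ (hpos y hy.1)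
    have := kern_sub_nonpos ha hx.le hy.1 hyx.symm
    unfold halfKern
    linarith
  have h2 : 4 * a / (1 + 2 * a) * (x * ∫ y in x..1, W y) ≤ ∫ y in x..1, halfKern 0 a x y * f y := by
    rw [← mul_assoc, ← intervalIntegral.integral_const_mul]
    refine intervalIntegral.integral_mono_ae_restrict hx1
      (by apply Continuous.intervalIntegrable; fun_prop) (hii x 1) ?_
    filter_upwards [ae_restrict_mem measurableSet_Icc, ae_restrict_of_ae hne] with y hy hyx
    have hxy : x < y := lt_of_le_of_ne hy.1 (Ne.symm hyx)
    have hy0 : 0 < y := hx.trans hxy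
    have := mul_le_mul_of_nonneg_right (le_halfKern_zero ha hx hxy hy.2) (hpos y hy0.le)
    refine le_trans (le_of_eq ?_) this
    rw [hfW]
    field_simp
  linarith

end Growth

/-! ### A system of differential inequalities that blows up -/

section Comparison

variable {T c : ℝ} {I J I' J' : ℝ → ℝ}

/-- The differential inequalities `I' ≥ c J`, `J' ≥ I² / 2` have no global positive solutions. -/
theorem lt_of_deriv_ge (hc : 0 < c) (hT : 0 ≤ T)
    (hI : ∀ t ∈ Icc 0 T, HasDerivWithinAt I (I' t) (Icc 0 T) t)
    (hJ : ∀ t ∈ Icc 0 T, HasDerivWithinAt J (J' t) (Icc 0 T) t)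
    (hI' : ∀ t ∈ Icc 0 T, c * J t ≤ I' t) (hJ' : ∀ t ∈ Icc 0 T, 1 / 2 * I t ^ 2 ≤ J' t)
    (hI0 : 0 < I 0) (hJ0 : 0 ≤ J 0) : T < 8 / √(c * I 0) := by
  have mono : ∀ {f f' : ℝ → ℝ} {s : ℝ}, 0 ≤ s →
      (∀ t ∈ Icc s T, HasDerivWithinAt f (f' t) (Icc 0 T) t) → (∀ t ∈ Icc s T, 0 ≤ f' t) →
      MonotoneOn f (Icc s T) := fun {f f' s} hs hd hn => by
    have hsub : Icc s T ⊆ Icc 0 T := Icc_subset_Icc_left hs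
    exact monotoneOn_of_hasDerivWithinAt_nonneg (convex_Icc s T)
      (fun t ht => (hd t ht).continuousWithinAt.mono hsub)
      (fun t ht => (hd t (interior_subset ht)).mono (interior_subset.trans hsub))
      fun t ht => hn t (interior_subset ht)
  have mJ : MonotoneOn J (Icc 0 T) := mono le_rfl hJ fun t ht =>
    (by positivity : (0 : ℝ) ≤ 1 / 2 * I t ^ 2).trans (hJ' t ht)
  have pJ : ∀ t ∈ Icc 0 T, 0 ≤ J t := fun t ht => hJ0.trans (mJ ⟨le_rfl, hT⟩ ht ht.1)
  have mI : MonotoneOn I (Icc 0 T) := mono le_rfl hI fun t ht =>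
    (mul_nonneg hc.le (pJ t ht)).trans (hI' t ht)
  -- From time s on I stays above I(s), so J ≥ I(s)²(t - s)/2; inserting this in the inequality for
  -- I' and integrating gives quadratic growth.
  have step : ∀ s ∈ Icc 0 T, 0 ≤ I s → ∀ t ∈ Icc s T, I s + c * I s ^ 2 * (t - s) ^ 2 / 4 ≤ I t := by
    intro s hs hIs t ht
    have h1 : ∀ t ∈ Icc s T, 1 / 2 * I s ^ 2 * (t - s) ≤ J t := by
      intro t ht
      have := mono hs.1 (f := fun t => J t - 1 / 2 * I s ^ 2 * (t - s))
        (f' := fun t => J' t - 1 / 2 * I s ^ 2)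
        (fun t ht => (hJ t ⟨hs.1.trans ht.1, ht.2⟩).sub (by
          simpa using (((hasDerivAt_id t).sub_const s).const_mul
            (1 / 2 * I s ^ 2)).hasDerivWithinAt (s := Icc 0 T)))
        (fun t ht => by
          have h2 := hJ' t ⟨hs.1.trans ht.1, ht.2⟩
          have h3 := pow_le_pow_left₀ hIs (mI hs ⟨hs.1.trans ht.1, ht.2⟩ ht.1) 2
          linarith) ⟨le_rfl, hs.2⟩ ht ht.1
      simp only [sub_self, mul_zero, sub_zero] at this
      linarith [pJ s hs]
    have := mono hs.1 (f := fun t => I t - c * I s ^ 2 / 4 * (t - s) ^ 2)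
      (f' := fun t => I' t - c * I s ^ 2 / 4 * (2 * (t - s)))
      (fun t ht => (hI t ⟨hs.1.trans ht.1, ht.2⟩).sub (by
        have := ((((hasDerivAt_id t).sub_const s).pow 2).const_mul
          (c * I s ^ 2 / 4)).hasDerivWithinAt (s := Icc 0 T)
        simpa using this))
      (fun t ht => by
        have h2 := hI' t ⟨hs.1.trans ht.1, ht.2⟩
        have h3 := mul_le_mul_of_nonneg_left (h1 t ht) hc.le
        linarith) ⟨le_rfl, hs.2⟩ ht ht.1
    simp only [sub_self, ne_eq, OfNat.ofNat_ne_zero, not_false_eq_true, zero_pow, mul_zero,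
      sub_zero] at this
    linarith
  by_contra hcon
  have hcI : 0 < c * I 0 := mul_pos hc hI0
  -- I at least doubles on successive intervals of lengths δ(3/4)ⁿ: by the choice of δ the increment
  -- is at least 2ⁿ I(0)·(9/8)ⁿ. The lengths add up to 4δ = 8/√(c I(0)).
  set δ := 2 / √(c * I 0) with hδ
  have hδ0 : 0 < δ := by positivity
  have hδ2 : c * I 0 * δ ^ 2 = 4 := by
    rw [hδ, div_pow, Real.sq_sqrt hcI.le]; field_simp; norm_num
  have hTδ : 4 * δ ≤ T := by
    refine le_trans (le_of_eq ?_) (not_lt.1 hcon)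
    rw [hδ]; ring
  have hmem : ∀ n : ℕ, 4 * δ * (1 - (3 / 4) ^ n) ∈ Icc 0 T := fun n => by
    have h1 : ((3 : ℝ) / 4) ^ n ≤ 1 := pow_le_one₀ (by norm_num) (by norm_num)
    have h2 : (0 : ℝ) < (3 / 4) ^ n := by positivity
    constructor
    · exact mul_nonneg (by positivity) (by linarith)
    · nlinarith
  have key : ∀ n : ℕ, 2 ^ n * I 0 ≤ I (4 * δ * (1 - (3 / 4) ^ n)) := by
    intro n
    induction n with
    | zero => simp
    | succ n ih =>
      have h0 : 0 ≤ 2 ^ n * I 0 := by positivity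
      have hle : 4 * δ * (1 - (3 / 4) ^ n) ≤ 4 * δ * (1 - (3 / 4) ^ (n + 1)) := by
        have : (0 : ℝ) < (3 / 4) ^ n := by positivity
        rw [pow_succ]; nlinarith
      have h1 := step _ (hmem n) (h0.trans ih) _ ⟨hle, (hmem (n + 1)).2⟩
      have h2 : 4 * δ * (1 - (3 / 4) ^ (n + 1)) - 4 * δ * (1 - (3 / 4) ^ n) = δ * (3 / 4) ^ n := by
        rw [pow_succ]; ring
      rw [h2] at h1
      have h3 := pow_le_pow_left₀ h0 ih 2
      have h4 : 2 ^ n * I 0 ≤ c * (2 ^ n * I 0) ^ 2 * (δ * (3 / 4) ^ n) ^ 2 / 4 := by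
        have e : c * (2 ^ n * I 0) ^ 2 * (δ * (3 / 4) ^ n) ^ 2 / 4
            = 2 ^ n * I 0 * (2 ^ n * ((3 / 4) ^ n) ^ 2) * (c * I 0 * δ ^ 2 / 4) := by ring
        have e2 : (2 : ℝ) ^ n * ((3 / 4) ^ n) ^ 2 = (9 / 8) ^ n := by
          rw [← pow_mul, mul_comm n 2, pow_mul, ← mul_pow]; norm_num
        rw [e, hδ2, e2]
        have : (1 : ℝ) ≤ (9 / 8) ^ n := one_le_pow₀ (by norm_num)
        nlinarith
      have h5 : c * (2 ^ n * I 0) ^ 2 * (δ * (3 / 4) ^ n) ^ 2 / 4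
          ≤ c * I (4 * δ * (1 - (3 / 4) ^ n)) ^ 2 * (δ * (3 / 4) ^ n) ^ 2 / 4 := by gcongr
      rw [pow_succ]
      linarith
  obtain ⟨n, hn⟩ := pow_unbounded_of_one_lt (I T / I 0) (by norm_num : (1 : ℝ) < 2)
  rw [div_lt_iff₀ hI0] at hn
  exact absurd ((key n).trans (mI (hmem n) ⟨hT, le_rfl⟩ (hmem n).2)) (not_le.2 hn)

end Comparison

/-! ### Growth of ∫ θ/x and ∫ θω/x, and the bound on the existence time -/

section BlowUp

variable {a T : ℝ} {ω ρ : ℝ → ℝ → ℝ}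

lemma primitive_eq_mul_dilate {T : ℝ} (hρ : IsEvolution T ρ) (t x : ℝ) :
    primitive ρ t x = x * dilate 0 ρ t x := by
  have h := eq_mul_dilate_deriv (sm_primitive hρ.sm 1) (fun t => by simp [primitive]) t x
  have e : (fun t => deriv (primitive ρ t)) = ρ := funext fun t => funext fun x =>
    (hasDerivAt_primitive_space (hρ.sm 0) t x).deriv
  rwa [e] at h

lemma dilate_nonneg {T : ℝ} (hρ : IsEvolution T ρ) (t : ℝ) {x : ℝ} (hx : 0 ≤ x) :
    0 ≤ dilate 0 ρ t x :=
  intervalIntegral.integral_nonneg zero_le_one fun _ hσ =>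
    mul_nonneg (pow_nonneg hσ.1 0) (hρ.nonneg t _ (mul_nonneg hσ.1 hx))

/-- Away from the origin this is the equation for θ divided by x; at the origin both sides vanish
with ρ. -/
lemma dilate_transport (ha : 0 < a) (hT : 0 ≤ T) (hω : IsEvolution T ω) (hρ : IsEvolution T ρ)
    (htr : IsTransported T (fun t => conv 0 a (ω t)) ω ρ) {t : ℝ} (ht : t ∈ Icc 0 T) (x : ℝ) :
    dilate 0 ρ t x = dilate 0 ρ 0 x + ∫ s in (0 : ℝ)..t,
      -(dilate 0 (fun t => deriv (conv 0 a (ω t))) s x * ρ s x) := by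
  have hv := sm_velocity ha hT hω
  rcases eq_or_ne x 0 with rfl | hx
  · have h0 : ∀ t, ρ t 0 = 0 := fun t => odd_zero (hρ.odd t)
    simp [dilate, h0]
  · have h1 := eq_integral_of_hasDerivWithinAt (T := T) (f := fun s => primitive ρ s x)
      (g := fun s => -(conv 0 a (ω s) x * ρ s x))
      (((hv 0).mul (hρ.sm 0)).neg.continuous_time x).continuousOn
      (fun s hs => hasDerivWithinAt_primitive_time (hv 1) (hρ.sm 1)
        (fun t => odd_zero (hρ.odd t)) htr hs x) ht
    simp only [primitive_eq_mul_dilate hρ] at h1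
    refine mul_left_cancel₀ hx ?_
    rw [h1, mul_add, ← intervalIntegral.integral_const_mul]
    congr 2
    ext s
    rw [eq_mul_dilate_deriv (hv 1) (fun t => odd_zero (conv_odd (hω.odd t))) s x]
    ring

/-- The first growth estimate, at a fixed time. -/
lemma growth_first (ha : 0 < a) (hT : 0 ≤ T) (hω : IsEvolution T ω) (hρ : IsEvolution T ρ) (t : ℝ) :
    1 / Real.pi * (4 * a / (1 + 2 * a)) * ∫ x in (0 : ℝ)..1, dilate 0 ρ t x * ω t x
      ≤ ∫ x in (0 : ℝ)..1, -(dilate 0 (fun t => deriv (conv 0 a (ω t))) t x * ρ t x) := by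
  have hv := sm_velocity ha hT hω
  have cρ := (hρ.sm 0).continuous_space t
  have cA := (sm_dilate (hρ.sm 0) 0).continuous_space t
  have cU := (sm_dilate (hv 1).deriv 0).continuous_space t
  have cW := (sm_dilate (hω.sm 1).deriv 0).continuous_space t
  set A := dilate 0 ρ t
  set U := dilate 0 (fun t => deriv (conv 0 a (ω t))) t with hU
  set W := dilate 0 (fun t => deriv (ω t)) t with hW
  set c := 1 / Real.pi * (4 * a / (1 + 2 * a))
  have hfW : ∀ x, ω t x = x * W x := eq_mul_dilate_deriv (hω.sm 1) (fun t => odd_zero (hω.odd t)) t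
  have hvU : ∀ x, conv 0 a (ω t) x = x * U x :=
    eq_mul_dilate_deriv (hv 1) (fun t => odd_zero (conv_odd (hω.odd t))) t
  have hθA : ∀ x, primitive ρ t x = x * A x := primitive_eq_mul_dilate hρ t
  have dG : ∀ x, HasDerivAt (fun x => ∫ y in x..1, W y) (-W x) x := fun x =>
    intervalIntegral.integral_hasDerivAt_left (cW.intervalIntegrable _ _)
      cW.stronglyMeasurable.stronglyMeasurableAtFilter cW.continuousAt
  have cG : Continuous fun x => ∫ y in x..1, W y :=
    continuous_iff_continuousAt.2 fun x => (dG x).continuousAt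
  have hibp := intervalIntegral.integral_mul_deriv_eq_deriv_mul (a := 0) (b := 1)
    (u := fun x => ∫ y in x..1, W y) (v := primitive ρ t) (u' := fun x => -W x) (v' := ρ t)
    (fun x _ => dG x) (fun x _ => hasDerivAt_primitive_space (hρ.sm 0) t x)
    (cW.neg.intervalIntegrable _ _) (cρ.intervalIntegrable _ _)
  -- Integration by parts rewrites ∫ Aω = ∫ θW, with W = ω/x, as an integral against ρ, so that the
  -- pointwise lower bound for -u/x can be inserted under it.
  have e1 : ∫ x in (0 : ℝ)..1, A x * ω t x = ∫ x in (0 : ℝ)..1, (∫ y in x..1, W y) * ρ t x := by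
    have h0 : primitive ρ t 0 = 0 := by simp [primitive]
    rw [hibp, h0, intervalIntegral.integral_same, zero_mul, mul_zero, sub_zero, zero_sub,
      ← intervalIntegral.integral_neg]
    congr 1
    ext x
    rw [hfW, hθA]
    ring
  rw [e1, ← intervalIntegral.integral_const_mul]
  refine intervalIntegral.integral_mono_on zero_le_one
    (by apply Continuous.intervalIntegrable; fun_prop)
    (by apply Continuous.intervalIntegrable; fun_prop) fun x hx => ?_
  rcases hx.1.eq_or_lt with rfl | hx0
  · rw [odd_zero (hρ.odd t)]; simp
  · have h1 := mul_integral_le_neg_conv ha ((hω.sm 0).continuous_space t) (hω.supp t) (hω.odd t)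
      (hω.nonneg t) cW hfW hx0 hx.2
    rw [hvU] at h1
    have h2 : c * ∫ y in x..1, W y ≤ -U x := by
      refine le_of_mul_le_mul_left ?_ hx0
      linarith
    have := mul_le_mul_of_nonneg_right h2 (hρ.nonneg t x hx.1)
    linarith

/-- The second growth estimate, at a fixed time. -/
lemma growth_second (ha : 0 < a) (hT : 0 ≤ T) (hω : IsEvolution T ω) (hρ : IsEvolution T ρ) (t : ℝ) :
    1 / 2 * (∫ x in (0 : ℝ)..1, dilate 0 ρ t x) ^ 2 ≤ ∫ x in (0 : ℝ)..1,
      (-(dilate 0 (fun t => deriv (conv 0 a (ω t))) t x * ρ t x) * ω t x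
        + dilate 0 ρ t x * (ρ t x - conv 0 a (ω t) x * deriv (ω t) x)) := by
  have hv := sm_velocity ha hT hω
  have sA := sm_dilate (hρ.sm 1) 0
  have sU := sm_dilate (hv 2).deriv 0
  have cρ := (hρ.sm 0).continuous_space t
  have cω := (hω.sm 0).continuous_space t
  have cω' := (hω.sm 1).deriv.continuous_space t
  have cA := sA.continuous_space t
  have cA' := sA.deriv.continuous_space t
  have cU := sU.continuous_space t
  have cU' := sU.deriv.continuous_space t
  have cW := (sm_dilate (hω.sm 1).deriv 0).continuous_space t
  have dA := sA.hasDerivAt t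
  have dU := sU.hasDerivAt t
  have dω := (hω.sm 1).hasDerivAt t
  have dθ := hasDerivAt_primitive_space (hρ.sm 0) t
  have cθ : Continuous (primitive ρ t) := (sm_primitive hρ.sm 0).continuous_space t
  have hApos : ∀ x, 0 ≤ x → 0 ≤ dilate 0 ρ t x := fun x hx => dilate_nonneg hρ t hx
  have hfW : ∀ x, ω t x = x * dilate 0 (fun t => deriv (ω t)) t x :=
    eq_mul_dilate_deriv (hω.sm 1) (fun t => odd_zero (hω.odd t)) t
  have hvU : ∀ x, conv 0 a (ω t) x = x * dilate 0 (fun t => deriv (conv 0 a (ω t))) t x :=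
    eq_mul_dilate_deriv (hv 1) (fun t => odd_zero (conv_odd (hω.odd t))) t
  have hθA : ∀ x, primitive ρ t x = x * dilate 0 ρ t x := primitive_eq_mul_dilate hρ t
  set A := dilate 0 ρ t
  set U := dilate 0 (fun t => deriv (conv 0 a (ω t))) t with hU
  set W := dilate 0 (fun t => deriv (ω t)) t with hW
  have hρA : ∀ x, ρ t x = A x + x * deriv A x := fun x => by
    have h1 := ((hasDerivAt_id x).mul (dA x))
    have h2 : primitive ρ t = fun x => x * A x := funext hθA
    have h3 := dθ x
    rw [h2] at h3
    have := h3.unique h1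
    simpa using this
  have hv' : ∀ x, conv 0 a (deriv (ω t)) x = U x + x * deriv U x := fun x => by
    have h1 := ((hasDerivAt_id x).mul (dU x))
    have h2 : conv 0 a (ω t) = fun x => x * U x := funext hvU
    have h3 := (hv 1).hasDerivAt t x
    rw [deriv_conv ha le_rfl ha.le (hω.sm 1) (hω.bd hT 1)] at h3
    rw [h2] at h3
    have := h3.unique h1
    simpa using this
  have hω1 : ω t 1 = 0 := eq_zero_of_abs_le cω (hω.supp t) (by simp)
  have hθ0 : primitive ρ t 0 = 0 := by simp [primitive]
  -- the transport terms
  have i1 := intervalIntegral.integral_mul_deriv_eq_deriv_mul (a := 0) (b := 1) (u := U)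
    (v := fun x => primitive ρ t x * ω t x) (u' := deriv U)
    (v' := fun x => ρ t x * ω t x + primitive ρ t x * deriv (ω t) x)
    (fun x _ => dU x) (fun x _ => (dθ x).mul (dω x)) (cU'.intervalIntegrable _ _)
    (by apply Continuous.intervalIntegrable; fun_prop)
  rw [hω1, hθ0, mul_zero, mul_zero, zero_mul, mul_zero, sub_zero, zero_sub] at i1
  have q0 := quadratic_form_nonneg ha (contDiff_of_top (hω.contDiff t) 1) (hω.supp t) (hω.odd t) cA
    cW hfW (fun x hx => hApos x hx.1.le) (fun x hx => by
      have := hω.nonneg t x hx.1.le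
      rw [hfW] at this
      exact nonneg_of_mul_nonneg_right this hx.1) (fun x hx y hy hyx => by
      rw [← hθA, ← hθA]
      have h1 := intervalIntegral.integral_nonneg (μ := volume) hyx fun z hz =>
        hρ.nonneg t z (hy.1.le.trans hz.1)
      have h2 := intervalIntegral.integral_add_adjacent_intervals (μ := volume)
        (cρ.intervalIntegrable 0 y) (cρ.intervalIntegrable y x)
      unfold primitive
      linarith)
  -- From u = xU one gets x u_x - u = x²U', so the quadratic form is exactly ∫ U'θω, the transport
  -- contribution left by `i1`.
  have e1 : ∀ x, A x * W x * (x * conv 0 a (deriv (ω t)) x - conv 0 a (ω t) x)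
      = deriv U x * (primitive ρ t x * ω t x) := fun x => by
    rw [hv', hvU, hθA, hfW]; ring
  simp only [e1] at q0
  -- the buoyancy term
  have i2 := intervalIntegral.integral_eq_sub_of_hasDerivAt (a := 0) (b := 1)
    (f := fun x => x * A x ^ 2) (f' := fun x => 2 * (A x * ρ t x) - A x ^ 2)
    (fun x _ => by
      refine ((hasDerivAt_id x).mul ((dA x).pow 2)).congr_deriv ?_
      rw [hρA]
      simp only [id, Pi.pow_apply, Nat.cast_ofNat, Nat.add_one_sub_one, pow_one]
      ring)
    (by apply Continuous.intervalIntegrable; fun_prop)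
  rw [intervalIntegral.integral_sub (by apply Continuous.intervalIntegrable; fun_prop)
    (by apply Continuous.intervalIntegrable; fun_prop), intervalIntegral.integral_const_mul] at i2
  -- The unit interval has length 1, so (∫ A)² ≤ ∫ A², while `i2` gives 2∫ Aρ = ∫ A² + A(1)².
  have cs := sq_integral_mul_le (a := 0) (b := 1) zero_le_one cA (continuous_const (y := (1 : ℝ)))
  simp only [mul_one, one_pow, intervalIntegral.integral_const, sub_zero, smul_eq_mul] at cs
  have e2 : ∀ x, -(U x * ρ t x) * ω t x + A x * (ρ t x - conv 0 a (ω t) x * deriv (ω t) x)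
      = A x * ρ t x - U x * (ρ t x * ω t x + primitive ρ t x * deriv (ω t) x) := fun x => by
    rw [hvU, hθA]; ring
  simp only [e2]
  rw [intervalIntegral.integral_sub (by apply Continuous.intervalIntegrable; fun_prop)
    (by apply Continuous.intervalIntegrable; fun_prop), i1]
  have := sq_nonneg (A 1)
  linarith

/-- Upper bound for the existence time. -/
theorem lt_of_isEvolution (ha : 0 < a) (hT : 0 ≤ T) (hω : IsEvolution T ω) (hρ : IsEvolution T ρ)
    (htr : IsTransported T (fun t => conv 0 a (ω t)) ω ρ)
    (hI : 0 < ∫ x in (0 : ℝ)..1, dilate 0 ρ 0 x) :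
    T < 8 / √(1 / Real.pi * (4 * a / (1 + 2 * a)) * ∫ x in (0 : ℝ)..1, dilate 0 ρ 0 x) := by
  have hv := sm_velocity ha hT hω
  have sA := sm_dilate (hρ.sm 0) 0
  have sU := sm_dilate (hv 1).deriv 0
  have sF : Sm 0 fun s x => -(dilate 0 (fun t => deriv (conv 0 a (ω t))) s x * ρ s x) :=
    (sU.mul (hρ.sm 0)).neg
  have sH : Sm 0 fun s x => ρ s x - conv 0 a (ω s) x * deriv (ω s) x :=
    IsTransported.sm_vorticity_rhs (hv 1) (hω.sm 1) (hρ.sm 1)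
  have hA := fun t ht x => dilate_transport ha hT hω hρ htr (t := t) ht x
  have sG : Sm 0 fun s x => -(dilate 0 (fun t => deriv (conv 0 a (ω t))) s x * ρ s x) * ω s x
      + dilate 0 ρ s x * (ρ s x - conv 0 a (ω s) x * deriv (ω s) x) :=
    (sF.mul (hω.sm 0)).add (sA.mul sH)
  refine lt_of_deriv_ge (I := fun t => ∫ x in (0 : ℝ)..1, dilate 0 ρ t x)
    (J := fun t => ∫ x in (0 : ℝ)..1, dilate 0 ρ t x * ω t x) (by positivity) hT
    (fun t ht => hasDerivWithinAt_space_integral sA sF hA 0 1 ht)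
    (fun t ht => hasDerivWithinAt_space_integral (sA.mul (hω.sm 0)) sG (fun t ht x => ?_) 0 1 ht)
    (fun t _ => growth_first ha hT hω hρ t) (fun t _ => growth_second ha hT hω hρ t) hI ?_
  · refine eq_integral_of_hasDerivWithinAt (f := fun s => dilate 0 ρ s x * ω s x)
      (sG.continuous_time x).continuousOn (fun s hs => ?_) ht
    exact (hasDerivWithinAt_of_integral_eq sF hA hs x).mul
      (hasDerivWithinAt_of_integral_eq sH htr.vorticity hs x)
  · exact intervalIntegral.integral_nonneg zero_le_one fun x hx =>
      mul_nonneg (dilate_nonneg hρ 0 hx.1) (hω.nonneg 0 x hx.1)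

/-- By oddness ρ₀ is positive somewhere on [0,1], so its average, which is the value of θ₀/x at x =
1, is positive; continuity does the rest. -/
lemma IsInitialData.integral_dilate_pos {T : ℝ} {ω₀ θ₀ : ℝ → ℝ} (hd : IsInitialData ω₀ θ₀)
    (hρ : IsEvolution T ρ) (h0 : ρ 0 = deriv θ₀) : 0 < ∫ x in (0 : ℝ)..1, dilate 0 ρ 0 x := by
  have hp := hd.isProfile_density
  have cA := (sm_dilate (hρ.sm 0) 0).continuous_space 0
  have cρ := (hρ.sm 0).continuous_space 0
  obtain ⟨x, hx⟩ := hd.density_nontrivial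
  rw [← h0] at hx hp
  have hx' : ρ 0 |x| ≠ 0 := by
    rcases abs_choice x with h | h <;> rw [h]
    · exact hx
    · rw [hp.odd]; exact neg_ne_zero.2 hx
  have hle : |x| ≤ 1 := not_lt.1 fun h => hx (hp.supp x h)
  refine intervalIntegral.integral_pos zero_lt_one cA.continuousOn
    (fun y hy => dilate_nonneg hρ 0 hy.1.le) ⟨1, ⟨zero_le_one, le_rfl⟩, ?_⟩
  refine intervalIntegral.integral_pos zero_lt_one (by fun_prop)
    (fun σ hσ => ?_) ⟨|x|, ⟨abs_nonneg x, hle⟩, ?_⟩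
  · rw [pow_zero, one_mul, mul_one]; exact hp.nonneg _ hσ.1.le
  · rw [pow_zero, one_mul, mul_one]
    exact lt_of_le_of_ne (hp.nonneg _ (abs_nonneg x)) hx'.symm

end BlowUp

/-! ### Restriction and gluing of smooth solutions -/

/-- Smooth solutions on the closed time interval `[0,T]`, in terms of `ω` and `ρ = θ_x`. -/
structure IsSmoothSolution (a T : ℝ) (ω₀ ρ₀ : ℝ → ℝ) (ω ρ : ℝ → ℝ → ℝ) : Prop where
  vorticity : IsEvolution T ω
  density : IsEvolution T ρ
  initial_vorticity : ω 0 = ω₀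
  initial_density : ρ 0 = ρ₀
  transported : IsTransported T (fun t => conv 0 a (ω t)) ω ρ

section Restriction

variable {a T T' : ℝ} {ω₀ ρ₀ : ℝ → ℝ} {ω ρ ω' ρ' : ℝ → ℝ → ℝ}

lemma IsEvolution.isProfile (h : IsEvolution T ω) (t : ℝ) : IsProfile (ω t) :=
  ⟨h.contDiff t, h.odd t, h.supp t, h.nonneg t⟩

lemma IsEvolution.restrict (h : IsEvolution T ω) (hT' : 0 ≤ T') :
    IsEvolution T' fun t => ω (HouLuoLine.clamp T' t) :=
  ⟨fun n => (h.sm n).reparam (continuous_clamp T'), fun t => by rw [clamp_clamp hT'],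
    fun t => h.odd _, fun t => h.supp _, fun t => h.nonneg _⟩

namespace IsSmoothSolution

lemma isRegular (h : IsSmoothSolution a T ω₀ ρ₀ ω ρ) : IsRegular a T ω ρ :=
  h.vorticity.isRegular h.density h.transported

lemma restrict (h : IsSmoothSolution a T ω₀ ρ₀ ω ρ) (h0 : 0 ≤ T') (hT' : T' ≤ T) :
    IsSmoothSolution a T' ω₀ ρ₀ (fun t => ω (clamp T' t)) fun t => ρ (clamp T' t) := by
  have e0 : clamp T' 0 = 0 := clamp_of_mem ⟨le_rfl, h0⟩
  have hc : ∀ t ∈ Icc 0 T', ∀ s ∈ uIcc 0 t, clamp T' s = s := fun t ht s hs => by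
    rw [uIcc_of_le ht.1] at hs
    exact clamp_of_mem ⟨hs.1, hs.2.trans ht.2⟩
  refine ⟨h.vorticity.restrict h0, h.density.restrict h0, by simp only [e0, h.initial_vorticity],
    by simp only [e0, h.initial_density], fun t ht x => ?_, fun t ht x => ?_⟩
  · simp only [e0, clamp_of_mem ht]
    rw [h.transported.vorticity t ⟨ht.1, ht.2.trans hT'⟩]
    congr 1
    exact intervalIntegral.integral_congr fun s hs => by simp only [hc t ht s hs]
  · simp only [e0, clamp_of_mem ht]
    rw [h.transported.density t ⟨ht.1, ht.2.trans hT'⟩]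
    congr 1
    exact intervalIntegral.integral_congr fun s hs => by simp only [hc t ht s hs]

lemma unique (h : IsSmoothSolution a T ω₀ ρ₀ ω ρ) (h' : IsSmoothSolution a T' ω₀ ρ₀ ω' ρ')
    (ha : 0 < a) {t : ℝ} (h0 : 0 ≤ t) (ht : t ≤ T) (ht' : t ≤ T') : ω t = ω' t ∧ ρ t = ρ' t := by
  have r := h.restrict h0 ht
  have r' := h'.restrict h0 ht'
  have := r.isRegular.unique r'.isRegular ha h0
    (r.initial_vorticity.trans r'.initial_vorticity.symm)
    (r.initial_density.trans r'.initial_density.symm) ⟨h0, le_rfl⟩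
  simpa only [clamp_of_mem (show t ∈ Icc 0 t from ⟨h0, le_rfl⟩)] using this

/-- A smooth solution can be continued by one that starts from its final state. -/
lemma extend {τ : ℝ} (h : IsSmoothSolution a T ω₀ ρ₀ ω ρ) (ha : 0 < a) (hT : 0 ≤ T) (hτ : 0 ≤ τ)
    (h' : IsSmoothSolution a τ (ω T) (ρ T) ω' ρ') :
    ∃ ω ρ, IsSmoothSolution a (T + τ) ω₀ ρ₀ ω ρ := by
  -- The glued family is f(t) + f'(t - T) - f(T). As both families are frozen outside their
  -- intervals, one summand always cancels f(T), and spatial smoothness and joint continuity at t =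
  -- T need no separate argument.
  have left : ∀ {f f' : ℝ → ℝ → ℝ}, IsEvolution τ f' → f' 0 = f T → ∀ t ≤ T,
      (fun x => f t x + f' (t - T) x - f T x) = f t := fun {f f'} hf' h0 t ht => by
    have : f' (t - T) = f T := by
      rw [← hf'.clamp, ← h0]
      congr 1
      simp [HouLuoLine.clamp, sub_nonpos.2 ht]
    ext x; rw [this]; ring
  have right : ∀ {f f' : ℝ → ℝ → ℝ}, IsEvolution T f → ∀ t, T ≤ t →
      (fun x => f t x + f' (t - T) x - f T x) = f' (t - T) := fun {f f'} hf t ht => by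
    have : f t = f T := by
      rw [← hf.clamp]
      congr 1
      simp [HouLuoLine.clamp, ht, hT]
    ext x; rw [this]; ring
  have evo : ∀ {f f' : ℝ → ℝ → ℝ}, IsEvolution T f → IsEvolution τ f' → f' 0 = f T →
      IsEvolution (T + τ) fun t x => f t x + f' (t - T) x - f T x := by
    intro f f' hf hf' h0
    have prof : ∀ t, IsProfile fun x => f t x + f' (t - T) x - f T x := fun t => by
      rcases le_total t T with ht | ht
      · rw [left hf' h0 t ht]; exact hf.isProfile t
      · rw [right hf t ht]; exact hf'.isProfile _
    refine ⟨fun n => ((hf.sm n).add ((hf'.sm n).reparam (continuous_sub_right T))).sub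
      (Sm.of_contDiff ((hf.isProfile T).contDiff n)), fun t => ?_, fun t => (prof t).odd,
      fun t => (prof t).supp, fun t => (prof t).nonneg⟩
    have e1 : f (HouLuoLine.clamp (T + τ) t) = f t := by
      rw [← hf.clamp, ← hf.clamp t]
      congr 1
      simp only [HouLuoLine.clamp]
      rcases le_total t 0 with h | h
      · simp [h, hT]
      · rcases le_total t (T + τ) with h2 | h2
        · simp [h, h2]
        · have : T ≤ t := by linarith
          simp [h2, this, hT, hτ, add_nonneg]
    have e2 : f' (HouLuoLine.clamp (T + τ) t - T) = f' (t - T) := by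
      rw [← hf'.clamp, ← hf'.clamp (t - T)]
      congr 1
      simp only [HouLuoLine.clamp]
      rcases le_total t 0 with h | h
      · have : t - T ≤ 0 := by linarith
        simp [h, this, hT]
      · rcases le_total t (T + τ) with h2 | h2
        · simp [h, h2]
        · have : τ ≤ t - T := by linarith
          simp [h2, this, hT, hτ, add_nonneg]
    simp only [e1, e2]
  set Ω : ℝ → ℝ → ℝ := fun t x => ω t x + ω' (t - T) x - ω T x with hΩ
  set P : ℝ → ℝ → ℝ := fun t x => ρ t x + ρ' (t - T) x - ρ T x with hP
  have lΩ : ∀ t ≤ T, Ω t = ω t := left h'.vorticity h'.initial_vorticity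
  have lP : ∀ t ≤ T, P t = ρ t := left h'.density h'.initial_density
  have rΩ : ∀ t, T ≤ t → Ω t = ω' (t - T) := right h.vorticity
  have rP : ∀ t, T ≤ t → P t = ρ' (t - T) := right h.density
  have eΩ : IsEvolution (T + τ) Ω := evo h.vorticity h'.vorticity h'.initial_vorticity
  have eP : IsEvolution (T + τ) P := evo h.density h'.density h'.initial_density
  have glue : ∀ {f f' g F F' G : ℝ → ℝ → ℝ},
      (∀ t ∈ Icc 0 T, ∀ x, f t x = f 0 x + ∫ s in (0 : ℝ)..t, F s x) →
      (∀ t ∈ Icc 0 τ, ∀ x, f' t x = f' 0 x + ∫ s in (0 : ℝ)..t, F' s x) → f' 0 = f T →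
      (∀ t ≤ T, g t = f t) → (∀ t, T ≤ t → g t = f' (t - T)) →
      (∀ t ≤ T, ∀ x, G t x = F t x) → (∀ t, T ≤ t → ∀ x, G t x = F' (t - T) x) →
      Sm 0 G → ∀ t ∈ Icc 0 (T + τ), ∀ x, g t x = g 0 x + ∫ s in (0 : ℝ)..t, G s x := by
    intro f f' g F F' G hf hf' h0 gl gr Gl Gr sG t ht x
    have hleft : ∀ t ∈ Icc 0 T, ∫ s in (0 : ℝ)..t, F s x = ∫ s in (0 : ℝ)..t, G s x :=
      fun t ht => intervalIntegral.integral_congr fun s hs => by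
        rw [uIcc_of_le ht.1] at hs
        exact (Gl s (hs.2.trans ht.2) x).symm
    rcases le_total t T with htT | htT
    · rw [gl t htT, gl 0 hT, hf t ⟨ht.1, htT⟩, hleft t ⟨ht.1, htT⟩]
    · have hGc := sG.continuous_time x
      have e1 : ∫ s in (0 : ℝ)..(t - T), F' s x = ∫ s in T..t, G s x := by
        have := intervalIntegral.integral_comp_sub_right (a := T) (b := t) (fun s => F' s x) T
        rw [sub_self] at this
        rw [← this]
        refine intervalIntegral.integral_congr fun s hs => ?_
        rw [uIcc_of_le htT] at hs
        exact (Gr s hs.1 x).symm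
      rw [gr t htT, gl 0 hT, hf' (t - T) ⟨sub_nonneg.2 htT, by linarith [ht.2]⟩, h0,
        hf T ⟨hT, le_rfl⟩, hleft T ⟨hT, le_rfl⟩, e1, add_assoc,
        intervalIntegral.integral_add_adjacent_intervals (hGc.intervalIntegrable _ _)
          (hGc.intervalIntegrable _ _)]
  have hv := sm_velocity ha (add_nonneg hT hτ) eΩ
  refine ⟨Ω, P, eΩ, eP, by rw [lΩ 0 hT, h.initial_vorticity], by rw [lP 0 hT, h.initial_density],
    ?_, ?_⟩
  · exact glue h.transported.vorticity h'.transported.vorticity h'.initial_vorticity lΩ rΩ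
      (fun t ht x => by rw [lΩ t ht, lP t ht]) (fun t ht x => by rw [rΩ t ht, rP t ht])
      (IsTransported.sm_vorticity_rhs (hv 1) (eΩ.sm 1) (eP.sm 1))
  · exact glue h.transported.density h'.transported.density h'.initial_density lP rP
      (fun t ht x => by rw [lΩ t ht, lP t ht]) (fun t ht x => by rw [rΩ t ht, rP t ht])
      ((hv 1).mul (eP.sm 1)).deriv.neg

end IsSmoothSolution

end Restriction

/-! ### The velocity gradient controls the energy -/

section Continuation

variable {a T L : ℝ} {ω₀ ρ₀ : ℝ → ℝ} {ω ρ : ℝ → ℝ → ℝ} {b : ℝ → ℝ}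

namespace IsSmoothSolution

/-- Along characteristics ρ equals ρ₀ exp(-∫ u_x), and those starting in [-1,1] remain there, where
|u_x| ≤ b. -/
lemma sq_density_le (h : IsSmoothSolution a T ω₀ ρ₀ ω ρ) (ha : 0 < a) (hT : 0 ≤ T)
    (hb : Continuous b) (hbv : ∀ t, ∀ x ∈ Icc (-1 : ℝ) 1, |deriv (conv 0 a (ω t)) x| ≤ b t)
    (hL : ∫ s in (0 : ℝ)..T, b s ≤ L) {R : ℝ} (hR : ∀ x, |ρ₀ x| ≤ R) {t : ℝ} (ht : t ∈ Icc 0 T)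
    (x : ℝ) : ρ t x ^ 2 ≤ (R * Real.exp L) ^ 2 := by
  have hv := sm_velocity ha hT h.vorticity 1
  obtain ⟨V, hV⟩ := (h.isRegular.bd_velocity ha hT).bound
  obtain ⟨K, hK⟩ := (h.isRegular.bd_velocity ha hT).deriv.bound
  have hodd : ∀ t, Function.Odd (conv 0 a (ω t)) := fun t => conv_odd (h.vorticity.odd t)
  have hR0 : 0 ≤ R := (abs_nonneg _).trans (hR 0)
  obtain ⟨Φ, hΦ⟩ := exists_isFlow hT hv hV hK
  have habs := hΦ.abs_le_abs_inv hT hv hV hK hodd fun t x hx =>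
    velocity_nonpos ha hT h.vorticity t hx
  set y := IsFlow.inv Φ t x with hy
  have h1 := h.transported.density_comp hT hΦ hv (h.density.sm 1) ht y
  rw [hΦ.apply_inv hT hv hV hK, h.initial_density] at h1
  rw [h1, ← sq_abs]
  refine pow_le_pow_left₀ (abs_nonneg _) ?_ 2
  rw [abs_mul, Real.abs_exp]
  by_cases hy1 : 1 < |y|
  · have : ρ₀ y = 0 := by rw [← h.initial_density]; exact h.density.supp 0 y hy1
    rw [this, abs_zero, zero_mul]; positivity
  · refine mul_le_mul (hR y) (Real.exp_le_exp.2 ?_) (Real.exp_pos _).le hR0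
    have hmem : ∀ s, Φ s y ∈ Icc (-1 : ℝ) 1 := fun s => by
      have := habs s (Φ s y)
      rw [hΦ.inv_apply hT hv] at this
      exact abs_le.1 (this.trans (not_lt.1 hy1))
    have hb0 : ∀ s, 0 ≤ b s := fun s => (abs_nonneg _).trans (hbv s 0 (by norm_num))
    have c1 : Continuous fun s => -deriv (conv 0 a (ω s)) (Φ s y) :=
      (hv.deriv.continuous.comp (continuous_id.prodMk (hΦ.continuous_time hT y))).neg
    calc ∫ s in (0 : ℝ)..t, -deriv (conv 0 a (ω s)) (Φ s y) ≤ ∫ s in (0 : ℝ)..t, b s :=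
          intervalIntegral.integral_mono_on ht.1 (c1.intervalIntegrable _ _)
            (hb.intervalIntegrable _ _) fun s _ =>
            (neg_le_abs _).trans (hbv s _ (hmem s))
      _ ≤ ∫ s in (0 : ℝ)..T, b s := by
          rw [← intervalIntegral.integral_add_adjacent_intervals (hb.intervalIntegrable 0 t)
            (hb.intervalIntegrable t T)]
          exact le_add_of_nonneg_right
            (intervalIntegral.integral_nonneg ht.2 fun s _ => hb0 s)
      _ ≤ L := hL

/-- The first energy is controlled by the time integral of the velocity gradient. -/
theorem energy_le (h : IsSmoothSolution a T ω₀ ρ₀ ω ρ) (ha : 0 < a) (hT : 0 ≤ T)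
    (hb : Continuous b) (hbv : ∀ t, ∀ x ∈ Icc (-1 : ℝ) 1, |deriv (conv 0 a (ω t)) x| ≤ b t)
    (hL : ∫ s in (0 : ℝ)..T, b s ≤ L) {R : ℝ} (hR : ∀ x, |ρ₀ x| ≤ R) :
    energy 1 (ω T) (ρ T) ≤ energy 1 ω₀ ρ₀
      * Real.exp (67 * (T + L) + 16 * (R * Real.exp L) ^ 2 * T) := by
  obtain ⟨Y', hY⟩ := energy_inequality 1 (sm_velocity ha hT h.vorticity) h.vorticity h.density
    h.transported
  have hb0 : ∀ s, 0 ≤ b s := fun s => (abs_nonneg _).trans (hbv s 0 (by norm_num))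
  -- Now sup|ρ| is known, so the inequality is linear in the energy: 67 is the commutator constant
  -- for k = 1, and 16 comes from the L² bound of u_xx.
  have key := le_mul_exp_of_deriv_le (κ := fun t => 67 * (1 + b t) + 16 * (R * Real.exp L) ^ 2)
    (by fun_prop) (fun t ht => (hY t ht).1) (fun t ht => ?_) (⟨hT, le_rfl⟩ : T ∈ Icc 0 T)
  · rw [h.initial_vorticity, h.initial_density] at key
    refine key.trans (mul_le_mul_of_nonneg_left (Real.exp_le_exp.2 ?_) (energy_nonneg _ _ _))
    rw [intervalIntegral.integral_add (by apply Continuous.intervalIntegrable; fun_prop)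
      (by apply Continuous.intervalIntegrable; fun_prop), intervalIntegral.integral_const_mul,
      intervalIntegral.integral_add (by apply Continuous.intervalIntegrable; fun_prop)
      (hb.intervalIntegrable _ _), intervalIntegral.integral_const, intervalIntegral.integral_const]
    simp only [sub_zero, smul_eq_mul, mul_one]
    linarith
  · refine ((hY t ht).2 (b t) 0 ((R * Real.exp L) ^ 2) _ (hb0 t) le_rfl (hbv t)
      (fun i h1 h2 => by omega) (nsq_iteratedDeriv_velocity_le ha hT h.vorticity 1 t)
      (fun x _ => h.sq_density_le ha hT hb hbv hL hR ht x) le_rfl).trans ?_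
    have h1 : nsq (iteratedDeriv 1 (ω t)) ≤ energy 1 (ω t) (ρ t) :=
      le_add_of_nonneg_right (nsq_nonneg _)
    have h2 := mul_le_mul_of_nonneg_left h1 (show 0 ≤ 16 * (R * Real.exp L) ^ 2 by positivity)
    norm_num at h2 ⊢
    linarith

end IsSmoothSolution

end Continuation

/-! ### The time integral of the supremum norm of the velocity gradient -/

section Gradient

variable {a T : ℝ} {ω₀ ρ₀ : ℝ → ℝ} {ω ρ ω' : ℝ → ℝ → ℝ}

/-- The set where the bound holds is closed with null complement, hence everything. -/
lemma le_eLpNorm_top_of_continuous {f : ℝ → ℝ} (hf : Continuous f) (x : ℝ) :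
    ENNReal.ofReal |f x| ≤ eLpNorm f ∞ volume := by
  rw [eLpNorm_exponent_top]
  have hclosed : IsClosed {x | ‖f x‖ₑ ≤ eLpNormEssSup f volume} :=
    isClosed_le hf.enorm continuous_const
  have h0 : volume {x | ‖f x‖ₑ ≤ eLpNormEssSup f volume}ᶜ = 0 :=
    ae_iff.1 (enorm_ae_le_eLpNormEssSup f volume)
  have h1 := hclosed.isOpen_compl.eq_empty_of_measure_zero h0
  have h2 : x ∈ {x | ‖f x‖ₑ ≤ eLpNormEssSup f volume} := by
    rw [compl_empty_iff.1 h1]; trivial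
  have h3 : ENNReal.ofReal |f x| = ‖f x‖ₑ := by rw [← Real.norm_eq_abs, ofReal_norm]
  rw [h3]
  exact h2

lemma gradientIntegral_mono (a : ℝ) (ω : ℝ → ℝ → ℝ) : Monotone (gradientIntegral a ω) :=
  fun _ _ h => lintegral_mono_set (Ioo_subset_Ioo_right h)

lemma gradientIntegral_congr {t : ℝ} (h : ∀ s ∈ Ioo 0 t, ω s = ω' s) :
    gradientIntegral a ω t = gradientIntegral a ω' t :=
  setLIntegral_congr_fun measurableSet_Ioo fun s hs => by simp only [h s hs]

/-- The maximum over `[-1,1]` of the modulus of the velocity gradient. -/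
noncomputable def gradientSup (a : ℝ) (ω : ℝ → ℝ → ℝ) (t : ℝ) : ℝ :=
  sSup ((fun x => |deriv (conv 0 a (ω t)) x|) '' Icc (-1) 1)

namespace IsSmoothSolution

lemma velocity_eq (h : IsSmoothSolution a T ω₀ ρ₀ ω ρ) (ha : 0 < a) (hT : 0 ≤ T) (t : ℝ) :
    velocity a (ω t) = conv 0 a (ω t) := by
  obtain ⟨B, hB⟩ := (h.vorticity.bd hT 1).bound
  exact velocity_eq_conv ha (h.vorticity.contDiff t).continuous (hB t) (h.vorticity.odd t)

lemma continuous_abs_deriv (h : IsSmoothSolution a T ω₀ ρ₀ ω ρ) (ha : 0 < a) (hT : 0 ≤ T) :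
    Continuous fun p : ℝ × ℝ => |deriv (conv 0 a (ω p.1)) p.2| :=
  (sm_velocity ha hT h.vorticity 1).deriv.continuous.abs

/-- The maximum over a compact interval is continuous in time, as the Gronwall rate must be, and it
is still dominated by the full L^∞ norm. -/
lemma continuous_gradientSup (h : IsSmoothSolution a T ω₀ ρ₀ ω ρ) (ha : 0 < a) (hT : 0 ≤ T) :
    Continuous (gradientSup a ω) :=
  isCompact_Icc.continuous_sSup (f := fun t x => |deriv (conv 0 a (ω t)) x|)
    (h.continuous_abs_deriv ha hT)

lemma isCompact_gradient (h : IsSmoothSolution a T ω₀ ρ₀ ω ρ) (ha : 0 < a) (hT : 0 ≤ T) (t : ℝ) :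
    IsCompact ((fun x => |deriv (conv 0 a (ω t)) x|) '' Icc (-1) 1) :=
  isCompact_Icc.image ((h.continuous_abs_deriv ha hT).comp (continuous_const.prodMk continuous_id))

lemma abs_deriv_le_gradientSup (h : IsSmoothSolution a T ω₀ ρ₀ ω ρ) (ha : 0 < a) (hT : 0 ≤ T)
    (t : ℝ) : ∀ x ∈ Icc (-1 : ℝ) 1, |deriv (conv 0 a (ω t)) x| ≤ gradientSup a ω t :=
  fun _ hx => le_csSup (h.isCompact_gradient ha hT t).bddAbove (mem_image_of_mem _ hx)

lemma gradientSup_le {K t : ℝ} (hK : ∀ x, |deriv (conv 0 a (ω t)) x| ≤ K) :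
    gradientSup a ω t ≤ K :=
  csSup_le ((nonempty_Icc.2 (by norm_num)).image _) fun y ⟨x, _, hx⟩ => hx ▸ hK x

lemma ofReal_gradientSup_le (h : IsSmoothSolution a T ω₀ ρ₀ ω ρ) (ha : 0 < a) (hT : 0 ≤ T) (t : ℝ) :
    ENNReal.ofReal (gradientSup a ω t) ≤ eLpNorm (deriv (velocity a (ω t))) ∞ volume := by
  rw [h.velocity_eq ha hT]
  obtain ⟨x, _, hx⟩ := (h.isCompact_gradient ha hT t).sSup_mem
    ((nonempty_Icc.2 (by norm_num)).image _)
  have : gradientSup a ω t = |deriv (conv 0 a (ω t)) x| := hx.symm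
  rw [this]
  exact le_eLpNorm_top_of_continuous
    ((sm_velocity ha hT h.vorticity 1).deriv.continuous_space t) x

lemma ofReal_integral_gradientSup_le (h : IsSmoothSolution a T ω₀ ρ₀ ω ρ) (ha : 0 < a)
    (hT : 0 ≤ T) :
    ENNReal.ofReal (∫ s in (0 : ℝ)..T, gradientSup a ω s) ≤ gradientIntegral a ω T := by
  have hc := h.continuous_gradientSup ha hT
  rw [intervalIntegral.integral_of_le hT, integral_Ioc_eq_integral_Ioo,
    ofReal_integral_eq_lintegral_ofReal]
  · exact lintegral_mono fun s => h.ofReal_gradientSup_le ha hT s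
  · exact hc.integrableOn_Icc.mono_set Ioo_subset_Icc_self
  · exact ae_of_all _ fun s => (abs_nonneg _).trans
      (h.abs_deriv_le_gradientSup ha hT s 0 (by norm_num))

lemma gradientIntegral_lt_top (h : IsSmoothSolution a T ω₀ ρ₀ ω ρ) (ha : 0 < a) (hT : 0 ≤ T) :
    gradientIntegral a ω T < ∞ := by
  obtain ⟨K, hK⟩ := (h.isRegular.bd_velocity ha hT).deriv.bound
  have h1 : gradientIntegral a ω T ≤ ∫⁻ _ in Ioo (0 : ℝ) T, ENNReal.ofReal K := by
    refine lintegral_mono fun s => ?_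
    rw [h.velocity_eq ha hT]
    simp only [eLpNorm_exponent_top]
    refine essSup_le_of_ae_le _ (ae_of_all _ fun x => ?_)
    simp only [← ofReal_norm]
    exact ENNReal.ofReal_le_ofReal (hK s x)
  refine h1.trans_lt ?_
  rw [setLIntegral_const, Real.volume_Ioo]
  exact ENNReal.mul_lt_top ENNReal.ofReal_lt_top ENNReal.ofReal_lt_top

end IsSmoothSolution

end Gradient

/-! ### The maximal solution -/

section Exhaustion

variable {a T : ℝ} {m : ℕ∞} {ω₀ θ₀ : ℝ → ℝ}

lemma SpatiallyCk.of_exhaustion {f : ℝ → ℝ → ℝ}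
    (h : ∀ t ∈ Ico 0 T, ∃ S ∈ Ioo t T, ∃ g, SpatiallyCk m S g ∧ ∀ s ∈ Ico 0 S, f s = g s) :
    SpatiallyCk m T f := by
  refine ⟨fun t ht => ?_, fun k hk p hp => ?_⟩
  · obtain ⟨S, hS, g, hg, hfg⟩ := h t ht
    rw [hfg t ⟨ht.1, hS.1⟩]
    exact hg.1 t ⟨ht.1, hS.1⟩
  · obtain ⟨S, hS, g, hg, hfg⟩ := h p.1 hp.1
    have hp' : p ∈ Ico 0 S ×ˢ (univ : Set ℝ) := ⟨⟨hp.1.1, hS.1⟩, mem_univ _⟩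
    have h1 := (hg.2 k hk p hp').congr (g := fun p : ℝ × ℝ => iteratedDeriv k (f p.1) p.2) (fun q hq => by rw [hfg _ hq.1]) (by rw [hfg _ hp'.1])
    refine h1.mono_of_mem_nhdsWithin ?_
    have h2 : Iio S ×ˢ (univ : Set ℝ) ∈ 𝓝 p := (isOpen_Iio.prod isOpen_univ).mem_nhds ⟨hS.1, trivial⟩
    filter_upwards [self_mem_nhdsWithin, mem_nhdsWithin_of_mem_nhds h2] with q hq hq'
    exact ⟨⟨hq.1.1, hq'.1⟩, mem_univ _⟩

lemma IsSolution.of_exhaustion {ω θ : ℝ → ℝ → ℝ} (hT : 0 < T)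
    (h : ∀ t ∈ Ico 0 T, ∃ S ∈ Ioo t T, ∃ ω' θ', IsSolution m a S ω₀ θ₀ ω' θ' ∧
      ∀ s ∈ Ico 0 S, ω s = ω' s ∧ θ s = θ' s) : IsSolution m a T ω₀ θ₀ ω θ := by
  have nhds : ∀ {t S : ℝ}, t ∈ Ico 0 T → t < S → Ico 0 S ∈ 𝓝[Ico 0 T] t := fun {t S} ht hS => by
    filter_upwards [self_mem_nhdsWithin, mem_nhdsWithin_of_mem_nhds (Iio_mem_nhds hS)] with s h1 h2
    exact ⟨h1.1, h2⟩
  refine ⟨.of_exhaustion fun t ht => ?_, .of_exhaustion fun t ht => ?_, fun t ht => ?_,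
    fun t ht => ?_, fun t ht x => ?_, fun t ht x => ?_, ?_, ?_⟩
  · obtain ⟨S, hS, ω', θ', hs, he⟩ := h t ht
    exact ⟨S, hS, ω', hs.regular_vorticity, fun s hs => (he s hs).1⟩
  · obtain ⟨S, hS, ω', θ', hs, he⟩ := h t ht
    exact ⟨S, hS, θ', hs.regular_density, fun s hs => (he s hs).2⟩
  · obtain ⟨S, hS, ω', θ', hs, he⟩ := h t ht
    rw [(he t ⟨ht.1, hS.1⟩).1]
    exact hs.odd_vorticity t ⟨ht.1, hS.1⟩
  · rcases lt_or_ge t 0 with h0 | h0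
    · exact ⟨0, fun s hs => absurd (hs.1.trans hs.2) (not_le.2 h0)⟩
    · obtain ⟨S, hS, ω', θ', hs, he⟩ := h t ⟨h0, ht⟩
      obtain ⟨B, hB⟩ := hs.bounded t hS.1
      exact ⟨B, fun s hs x => by
        rw [(he s ⟨hs.1, hs.2.trans_lt hS.1⟩).1]; exact hB s hs x⟩
  · obtain ⟨S, hS, ω', θ', hs, he⟩ := h t ht
    have ht' : t ∈ Ico 0 S := ⟨ht.1, hS.1⟩
    rw [(he t ht').1, (he t ht').2]
    exact ((hs.vorticity_eq t ht' x).congr (fun s hs => by rw [(he s hs).1])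
      (by rw [(he t ht').1])).mono_of_mem_nhdsWithin (nhds ht hS.1)
  · obtain ⟨S, hS, ω', θ', hs, he⟩ := h t ht
    have ht' : t ∈ Ico 0 S := ⟨ht.1, hS.1⟩
    rw [(he t ht').1, (he t ht').2]
    exact ((hs.density_eq t ht' x).congr (fun s hs => by rw [(he s hs).2])
      (by rw [(he t ht').2])).mono_of_mem_nhdsWithin (nhds ht hS.1)
  · obtain ⟨S, hS, ω', θ', hs, he⟩ := h 0 ⟨le_rfl, hT⟩
    rw [(he 0 ⟨le_rfl, hS.1⟩).1, hs.initial_vorticity]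
  · obtain ⟨S, hS, ω', θ', hs, he⟩ := h 0 ⟨le_rfl, hT⟩
    rw [(he 0 ⟨le_rfl, hS.1⟩).2, hs.initial_density]

end Exhaustion

section Maximal

variable {a : ℝ} {ω₀ ρ₀ θ₀ : ℝ → ℝ}

/-- The positive times up to which a smooth solution exists. -/
def existenceTimes (a : ℝ) (ω₀ ρ₀ : ℝ → ℝ) : Set ℝ :=
  {T | 0 < T ∧ ∃ ω ρ, IsSmoothSolution a T ω₀ ρ₀ ω ρ}

lemma existenceTimes_nonempty (ha : 0 < a) (hω : IsProfile ω₀) (hρ : IsProfile ρ₀) :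
    (existenceTimes a ω₀ ρ₀).Nonempty := by
  obtain ⟨τ, hτ, h⟩ := local_existence ha (energy 1 ω₀ ρ₀)
  obtain ⟨ω, ρ, h1, h2, h3, h4, h5⟩ := h ω₀ ρ₀ hω hρ le_rfl
  exact ⟨τ, hτ, ω, ρ, ⟨h1, h2, h3, h4, h5⟩⟩

lemma IsInitialData.bddAbove (hd : IsInitialData ω₀ θ₀) (ha : 0 < a) :
    BddAbove (existenceTimes a ω₀ (deriv θ₀)) := by
  refine ⟨8 / √(1 / Real.pi * (4 * a / (1 + 2 * a))
    * ∫ x in (0 : ℝ)..1, dilate 0 (fun _ => deriv θ₀) 0 x), ?_⟩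
  rintro T ⟨hT, ω, ρ, h⟩
  have hI := hd.integral_dilate_pos h.density h.initial_density
  have := (lt_of_isEvolution ha hT.le h.vorticity h.density h.transported hI).le
  simpa only [dilate, h.initial_density] using this

lemma exists_isSmoothSolution (hne : (existenceTimes a ω₀ ρ₀).Nonempty) {T : ℝ} (h0 : 0 ≤ T)
    (hT : T < sSup (existenceTimes a ω₀ ρ₀)) : ∃ ω ρ, IsSmoothSolution a T ω₀ ρ₀ ω ρ := by
  obtain ⟨S, ⟨_, ω, ρ, h⟩, hTS⟩ := exists_lt_of_lt_csSup hne hT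
  exact ⟨_, _, h.restrict h0 hTS.le⟩

/-- At the end of the maximal interval of existence the first energy is unbounded. -/
lemma exists_energy_gt (ha : 0 < a) (hne : (existenceTimes a ω₀ ρ₀).Nonempty)
    (hbdd : BddAbove (existenceTimes a ω₀ ρ₀)) (M : ℝ) :
    ∃ T ∈ Ioo 0 (sSup (existenceTimes a ω₀ ρ₀)), ∃ ω ρ, IsSmoothSolution a T ω₀ ρ₀ ω ρ ∧
      M < energy 1 (ω T) (ρ T) := by
  set S := sSup (existenceTimes a ω₀ ρ₀) with hS
  have hS0 : 0 < S := by
    obtain ⟨T, hT⟩ := hne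
    exact hT.1.trans_le (le_csSup hbdd hT)
  obtain ⟨τ, hτ, hloc⟩ := local_existence ha M
  -- A positive time closer to S than τ, so that an extension by τ would exceed the supremum.
  set T := max (S - τ / 2) (S / 2) with hTd
  have hT0 : 0 < T := lt_max_of_lt_right (by linarith)
  have hTS : T < S := max_lt (by linarith) (by linarith)
  have hTτ : S < T + τ := by have := le_max_left (S - τ / 2) (S / 2); linarith
  obtain ⟨ω, ρ, h⟩ := exists_isSmoothSolution hne hT0.le hTS
  refine ⟨T, ⟨hT0, hTS⟩, ω, ρ, h, ?_⟩
  by_contra hcon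
  obtain ⟨ω', ρ', h1, h2, h3, h4, h5⟩ := hloc (ω T) (ρ T) (h.vorticity.isProfile T)
    (h.density.isProfile T) (not_lt.1 hcon)
  have hmem : T + τ ∈ existenceTimes a ω₀ ρ₀ :=
    ⟨by linarith, h.extend ha hT0.le hτ.le ⟨h1, h2, h3, h4, h5⟩⟩
  exact absurd (le_csSup hbdd hmem) (not_le.2 hTτ)

/-- If the integral stayed below L up to T, `energy_le` would bound the energy by a quantity in
which T may be replaced by the finite supremum S, contradicting its unboundedness. -/
lemma exists_integral_gradientSup_gt (ha : 0 < a) (hρ : IsProfile ρ₀)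
    (hne : (existenceTimes a ω₀ ρ₀).Nonempty)
    (hbdd : BddAbove (existenceTimes a ω₀ ρ₀)) (L : ℝ) :
    ∃ T ∈ Ioo 0 (sSup (existenceTimes a ω₀ ρ₀)), ∃ ω ρ, IsSmoothSolution a T ω₀ ρ₀ ω ρ ∧
      L < ∫ s in (0 : ℝ)..T, gradientSup a ω s := by
  obtain ⟨R, hR⟩ := exists_bound_of_supp hρ.smooth.continuous hρ.supp
  set S := sSup (existenceTimes a ω₀ ρ₀) with hS
  obtain ⟨T, hT, ω, ρ, h, hM⟩ := exists_energy_gt ha hne hbdd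
    (energy 1 ω₀ ρ₀ * Real.exp (67 * (S + L) + 16 * (R * Real.exp L) ^ 2 * S))
  refine ⟨T, hT, ω, ρ, h, ?_⟩
  by_contra hcon
  have h1 := h.energy_le ha hT.1.le (h.continuous_gradientSup ha hT.1.le)
    (h.abs_deriv_le_gradientSup ha hT.1.le) (not_lt.1 hcon) hR
  have h2 : 67 * (T + L) + 16 * (R * Real.exp L) ^ 2 * T
      ≤ 67 * (S + L) + 16 * (R * Real.exp L) ^ 2 * S := by
    have := mul_le_mul_of_nonneg_left hT.2.le
      (show 0 ≤ 16 * (R * Real.exp L) ^ 2 by positivity)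
    linarith [hT.2]
  have h3 := mul_le_mul_of_nonneg_left (Real.exp_le_exp.2 h2) (energy_nonneg 1 ω₀ ρ₀)
  linarith

lemma IsSolution.eq_smooth {T T' t : ℝ} {ω θ ω' ρ' : ℝ → ℝ → ℝ} (h : IsSolution 1 a T ω₀ θ₀ ω θ)
    (ha : 0 < a) (hd : IsInitialData ω₀ θ₀) (h' : IsSmoothSolution a T' ω₀ (deriv θ₀) ω' ρ')
    (ht : t ∈ Ico 0 T) (ht' : t ≤ T') : ω t = ω' t ∧ θ t = primitive ρ' t := by
  have e0 : clamp t 0 = 0 := clamp_of_mem ⟨le_rfl, ht.1⟩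
  have et : clamp t t = t := clamp_of_mem ⟨ht.1, le_rfl⟩
  have := (h.isRegular ha hd ht).unique (h'.restrict ht.1 ht').isRegular ha ht.1
    (by simp only [e0, h.initial_vorticity, h'.initial_vorticity])
    (by simp only [e0, h.initial_density, h'.initial_density]) ⟨ht.1, le_rfl⟩
  simp only [et] at this
  refine ⟨this.1, funext fun x => ?_⟩
  rw [h.density_eq_integral ha hd.density_zero ht, this.2]
  rfl

/-- A classical solution living beyond the supremum S has bounded ω_x on [0,S], so |u_x| ≤ `kernMass
a` · |B| there. By uniqueness this bounds the gradient integrals of the smooth solutions, which are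
unbounded. -/
lemma IsSolution.le_sSup {T : ℝ} {ω θ : ℝ → ℝ → ℝ} (h : IsSolution 1 a T ω₀ θ₀ ω θ)
    (ha : 0 < a) (hd : IsInitialData ω₀ θ₀) : T ≤ sSup (existenceTimes a ω₀ (deriv θ₀)) := by
  have hne := existenceTimes_nonempty ha hd.isProfile_vorticity hd.isProfile_density
  have hbdd := hd.bddAbove ha
  set S := sSup (existenceTimes a ω₀ (deriv θ₀)) with hS
  by_contra hcon
  rw [not_le] at hcon
  obtain ⟨B, hB⟩ := h.bounded S hcon
  obtain ⟨T', hT', ω', ρ', h', hL⟩ := exists_integral_gradientSup_gt ha hd.isProfile_density hne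
    hbdd (kernMass a * |B| * S)
  have hK : ∀ s ∈ Icc 0 T', gradientSup a ω' s ≤ kernMass a * |B| := fun s hs => by
    refine IsSmoothSolution.gradientSup_le fun x => ?_
    rw [deriv_conv ha le_rfl ha.le (h'.vorticity.sm 1) (h'.vorticity.bd hT'.1.le 1),
      ← (h.eq_smooth ha hd h' ⟨hs.1, hs.2.trans_lt (hT'.2.trans hcon)⟩ hs.2).1]
    exact abs_conv_le ha le_rfl ha.le (fun y =>
      ((hB s ⟨hs.1, hs.2.trans hT'.2.le⟩ y).2).trans (le_abs_self B)) x
  have h1 := intervalIntegral.integral_mono_on hT'.1.le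
    ((h'.continuous_gradientSup ha hT'.1.le).intervalIntegrable _ _)
    (intervalIntegrable_const (μ := volume) (c := kernMass a * |B|)) hK
  rw [intervalIntegral.integral_const, sub_zero, smul_eq_mul] at h1
  have h2 := mul_le_mul_of_nonneg_left hT'.2.le
    (mul_nonneg (kernMass_nonneg a) (abs_nonneg B))
  linarith

theorem IsInitialData.blowsUpAt (hd : IsInitialData ω₀ θ₀) (ha : 0 < a) :
    ∃ Tstar : ℝ, 0 < Tstar ∧ BlowsUpAt a ω₀ θ₀ Tstar := by
  have hne := existenceTimes_nonempty ha hd.isProfile_vorticity hd.isProfile_density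
  have hbdd := hd.bddAbove ha
  have hmax : ∀ (T : ℝ) (ω' θ' : ℝ → ℝ → ℝ), IsSolution 1 a T ω₀ θ₀ ω' θ' →
    T ≤ sSup (existenceTimes a ω₀ (deriv θ₀)) := fun T ω' θ' h => h.le_sSup ha hd
  have hgrow := exists_integral_gradientSup_gt ha hd.isProfile_density hne hbdd
  set S := sSup (existenceTimes a ω₀ (deriv θ₀)) with hS
  have hS0 : 0 < S := by
    obtain ⟨T, hT⟩ := hne
    exact hT.1.trans_le (le_csSup hbdd hT)
  -- For each T < S a solution on [0,T] is selected. By uniqueness the selections agree on common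
  -- intervals, so the diagonal t ↦ F t t restricts to all of them.
  choose! F G hFG using fun (T : ℝ) (hT : T ∈ Ico 0 S) =>
    exists_isSmoothSolution hne hT.1 hT.2
  have heq : ∀ {T : ℝ} {ω ρ : ℝ → ℝ → ℝ}, IsSmoothSolution a T ω₀ (deriv θ₀) ω ρ →
      ∀ t ∈ Icc 0 T, t < S → F t t = ω t ∧ G t t = ρ t := fun {T ω ρ} h t ht htS =>
    (hFG t ⟨ht.1, htS⟩).unique h ha ht.1 le_rfl ht.2
  refine ⟨S, hS0, fun t => F t t, primitive fun t => G t t, ?_, fun t ht => ?_, fun t ht => ?_, ?_,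
    fun T ω' θ' h => ⟨hmax T ω' θ' h, fun t ht => ?_⟩⟩
  · refine .of_exhaustion hS0 fun t ht => ?_
    have hm : (t + S) / 2 ∈ Ioo t S := ⟨by linarith [ht.2], by linarith [ht.2]⟩
    have hm0 : 0 ≤ (t + S) / 2 := ht.1.trans hm.1.le
    have h := hFG ((t + S) / 2) ⟨hm0, hm.2⟩
    refine ⟨_, hm, _, _, h.vorticity.isSolution ha hm0 h.density h.transported hd
      h.initial_vorticity h.initial_density, fun s hs => ?_⟩
    have e := heq h s (Ico_subset_Icc_self hs) (hs.2.trans hm.2)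
    exact ⟨e.1, funext fun x => by simp only [primitive, e.2]⟩
  · have h := hFG t ht
    have : deriv (primitive (fun t => G t t) t) = G t t := funext fun x =>
      hasDerivAt_primitive ((h.density.contDiff t).continuous) x |>.deriv
    rw [this]
    exact ⟨tsupport_subset_of_eq_zero (h.vorticity.supp t),
      tsupport_subset_of_eq_zero (h.density.supp t)⟩
  · have h := hFG t ht
    rw [gradientIntegral_congr fun s hs =>
      (heq h s (Ioo_subset_Icc_self hs) (hs.2.trans ht.2)).1]
    exact h.gradientIntegral_lt_top ha ht.1
  · refine ENNReal.tendsto_nhds_top_iff_nnreal.2 fun L => ?_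
    obtain ⟨T, hT, ω, ρ, h, hL⟩ := hgrow L
    have h1 : (L : ℝ≥0∞) < gradientIntegral a (fun t => F t t) T := by
      rw [gradientIntegral_congr fun s hs =>
        (heq h s (Ioo_subset_Icc_self hs) (hs.2.trans hT.2)).1]
      refine lt_of_lt_of_le ?_ (h.ofReal_integral_gradientSup_le ha hT.1.le)
      rw [← ENNReal.ofReal_coe_nnreal]
      exact (ENNReal.ofReal_lt_ofReal_iff (L.2.trans_lt hL)).2 hL
    filter_upwards [Ioo_mem_nhdsLT hT.2] with t ht
    exact h1.trans_le (gradientIntegral_mono a _ ht.1.le)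
  · have htS := ht.2.trans_le (hmax T ω' θ' h)
    have := h.eq_smooth (ρ' := G t) ha hd (hFG t ⟨ht.1, htS⟩) ht le_rfl
    exact this

end Maximal

/-! ### Existence of admissible data -/

/-- A fluid at rest with the density `smoothTransition (x²)` is admissible. -/
lemma isInitialData_smoothTransition :
    IsInitialData (fun _ => 0) fun x => Real.smoothTransition (x ^ 2) := by
  have hs : ContDiff ℝ (⊤ : ℕ∞) fun x : ℝ => Real.smoothTransition (x ^ 2) :=
    Real.smoothTransition.contDiff.comp (contDiff_id.pow 2)
  have hd : ∀ x : ℝ, deriv (fun x : ℝ => Real.smoothTransition (x ^ 2)) x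
      = deriv Real.smoothTransition (x ^ 2) * (2 * x) := fun x => by
    have h1 : HasDerivAt (fun x : ℝ => x ^ 2) (2 * x) x := by simpa using hasDerivAt_pow 2 x
    have h2 : HasDerivAt Real.smoothTransition (deriv Real.smoothTransition (x ^ 2)) (x ^ 2) :=
      ((Real.smoothTransition.contDiff (n := 1)).differentiable (by norm_num) _).hasDerivAt
    exact (HasDerivAt.comp (h₂ := Real.smoothTransition) (h := fun x : ℝ => x ^ 2) x h2 h1).deriv
  refine ⟨contDiff_const, hs, fun x => by simp, fun x => ?_, ?_, ?_, fun x _ => le_rfl,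
    fun x hx => ?_, by simp [Real.smoothTransition.zero], ?_⟩
  · rw [hd, hd]; ring_nf
  · exact tsupport_subset_of_eq_zero fun _ _ => rfl
  · refine tsupport_subset_of_eq_zero fun x hx => ?_
    have h1 : (fun x : ℝ => Real.smoothTransition (x ^ 2)) =ᶠ[𝓝 x] fun _ => 1 := by
      filter_upwards [(isOpen_lt continuous_const continuous_abs).mem_nhds hx] with y hy
      refine Real.smoothTransition.one_of_one_le ?_
      have hy' : 1 < |y| := hy
      rw [← sq_abs]
      nlinarith
    rw [h1.deriv_eq, deriv_const]
  · rw [hd]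
    exact mul_nonneg (Real.smoothTransition.monotone.deriv_nonneg) (by linarith [hx.1])
  · by_contra! hcon
    have := is_const_of_deriv_eq_zero (hs.differentiable (by norm_num)) hcon 0 1
    simp [Real.smoothTransition.zero, Real.smoothTransition.one] at this

end HouLuoLine

theorem mainTheorem3 (a : ℝ) (ha : 0 < a) :
    (∃ ω₀ θ₀ : ℝ → ℝ, HouLuoLine.IsInitialData ω₀ θ₀) ∧
    ∀ ω₀ θ₀ : ℝ → ℝ, HouLuoLine.IsInitialData ω₀ θ₀ →
      ∃ Tstar : ℝ, 0 < Tstar ∧ HouLuoLine.BlowsUpAt a ω₀ θ₀ Tstar :=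
  ⟨⟨_, _, HouLuoLine.isInitialData_smoothTransition⟩, fun _ _ hd => hd.blowsUpAt ha⟩
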